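/- Let $W$ be a vector space over $\mathbb{C}$ and let $\mathcal{E}(W)=\mathrm{Hom}(W,W((x)))$, with $1_W$ the identity operator regarded as a constant series. *Definitions.* Let $\mathbb{C}_*(x_1,x_2)=\{f/h : f\in\mathbb{C}[[x_1,x_2]],\ 0\neq h\in\mathbb{C}[x_1,x_2]\}$, and let $\iota_{x_2,x_1}:\mathbb{C}_*(x_1,x_2)\to\mathbb{C}((x_2))((x_1))$ be the natural embedding. A subset $U\subset\mathcal{E}(W)$ is *pseudo-local* if for all $a,b\in U$ there are $0\ne p\in\mathbb{C}[x_1^{\pm1},x_2^{\pm1}]$ and finitely many $q_i\in\mathbb{C}_*(x_1,x_2)$, $u_i,v_i\in U$ with $$p(x_1,x_2)a(x_1)b(x_2)=\sum_{i}\iota_{x_2,x_1}(q_i(x_1,x_2))\,u_i(x_2)v_i(x_1).$$ For a subgroup $\Gamma\subset\mathbb{C}^\times$, $U$ is *pseudo $\Gamma$-local* if for all $a,b\in U$ there are $p(x)$ in the multiplicative monoid generated by the polynomials $x-\alpha$ $(\alpha\in\Gamma)$ and finitely many $q_i\in\mathbb{C}[[x_1,x_2]][x_1^{-1},x_2^{-1},(x_1-\alpha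 x_2)^{-1}\mid\alpha\in\Gamma]$, $u_i,v_i\in U$ with $$p(x_1/x_2)a(x_1)b(x_2)=\sum_{i}p(x_1/x_2)\,\iota_{x_2,x_1}(q_i(x_1,x_2))\,u_i(x_2)v_i(x_1).$$ A subset $U$ is *quasi compatible* if for every finite sequence $\psi_1,\dots,\psi_r$ in $U$ there is $0\ne p\in\mathbb{C}[x,y]$ with $\prod_{i<j}p(x_i,x_j)\,\psi_1(x_1)\cdots\psi_r(x_r)\in\mathrm{Hom}(W,W((x_1,\dots,x_r)))$. If $0\neq p\in\mathbb{C}[x_1,x_2]$ and $p(x_1,x_2)a(x_1)b(x_2)\in\mathrm{Hom}(W,W((x_1,x_2)))$, put $$Y_{\mathcal{E}}(a(x),x_0)b(x)=\sum_{n\in\mathbb{Z}}(a(x)_nb(x))x_0^{-n-1}=\iota_{x,x_0}\big(p(x+x_0,x)^{-1}\big)\,\big(p(x_1,x)a(x_1)b(x)\big)\big|_{x_1=x+x_0},$$ where $\iota_{x,x_0}$ expands in $\mathbb{C}((x))((x_0))$. A quasi compatible subspace is *closed* if it contains $a(x)_nb(x)$ for all its elements $a,b$ and all $n\in\mathbb{Z}$.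 A *nonlocal vertex algebra* is a vector space $V$ with a linear map $Y:V\to\mathrm{Hom}(V,V((x)))$ and a vector $\mathbf 1$ such that $Y(\mathbf 1,x)v=v$, $Y(v,x)\mathbf 1\in v+xV[[x]]$, and for all $u,v,w\in V$ there is $l\ge0$ with $(x_0+x_2)^lY(u,x_0+x_2)Y(v,x_2)w=(x_0+x_2)^lY(Y(u,x_0)v,x_2)w$. A *quasi $V$-module* is a vector space $W$ with a linear map $Y_W:V\to\mathcal{E}(W)$ such that $Y_W(\mathbf 1,x)=1_W$ and for all $u,v\in V$, $w\in W$ there is $0\ne f\in\mathbb{C}[x_1,x_2]$ with $f(x_0+x_2,x_2)Y_W(u,x_0+x_2)Y_W(v,x_2)w=f(x_0+x_2,x_2)Y_W(Y(u,x_0)v,x_2)w$. It is *faithful* if $Y_W$ is injective, and *pseudo-local* (resp. *pseudo $\Gamma$-local*) if the set $\{Y_W(v,x)\mid v\in V\}\subset\mathcal{E}(W)$ is. **Theorem.** Let $S$ be a pseudo-local subset of $\mathcal{E}(W)$. There is a smallest closed quasi compatible subspace $\langle S\rangle$ of $\mathcal{E}(W)$ containing $S\cup\{1_W\}$; on it $Y_{\mathcal{E}}$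 is well defined (independent of the choice of $p$), $(\langle S\rangle,Y_{\mathcal{E}},1_W)$ is a nonlocal vertex algebra, and $W$ is a faithful pseudo-local quasi $\langle S\rangle$-module with $Y_W(\alpha(x),x_0)=\alpha(x_0)$ for $\alpha(x)\in\langle S\rangle$. Furthermore, for every subgroup $\Gamma$ of $\mathbb{C}^\times$ such that $S$ is pseudo $\Gamma$-local, $W$ (with this structure) is a pseudo $\Gamma$-local quasi $\langle S\rangle$-module. -/

import Mathlib

noncomputable section

namespace NonlocalVA

/-! ### Formal series

`W((x))` is `HahnModule ℤ ℂ W`, and `Hom (W, W((x)))` is Mathlib's `VertexOperator ℂ W`.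
A formal series in `W[[x₁^{±1}, …, x_r^{±1}]]` is a function from `ℤ^r` to `W`. -/

/-- Formal series with integral exponents (unbounded in all directions) in `r` variables,
`W[[x₁^{±1}, …, x_r^{±1}]]`: `F m` is the coefficient of `x₁^{m₁} ⋯ x_r^{m_r}`. -/
abbrev Formal (r : ℕ) (W : Type*) := (Fin r → ℤ) → W

/-- Laurent polynomials `ℂ[x₁^{±1}, …, x_r^{±1}]`. -/
abbrev LaurentPoly (r : ℕ) := AddMonoidAlgebra ℂ (Fin r → ℤ)

/-- A polynomial, viewed as a Laurent polynomial. -/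
def polyToLaurent {r : ℕ} : MvPolynomial (Fin r) ℂ →ₐ[ℂ] LaurentPoly r :=
  MvPolynomial.aeval fun i => AddMonoidAlgebra.single (Pi.single i (1 : ℤ)) (1 : ℂ)

/-- For a polynomial `p(x)` in one variable, the Laurent polynomial `p(x₁ / x₂)`. -/
def ratioToLaurent : Polynomial ℂ →ₐ[ℂ] LaurentPoly 2 :=
  Polynomial.aeval (AddMonoidAlgebra.single ![(1 : ℤ), -1] (1 : ℂ))

section

variable {W : Type*} [AddCommGroup W] [Module ℂ W]

/-- The product of a Laurent polynomial and a formal series. -/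
def laurentMul {r : ℕ} (p : LaurentPoly r) (F : Formal r W) : Formal r W :=
  fun m => p.coeff.sum fun d c => c • F (m - d)

/-- The product of a polynomial and a formal series. -/
def polyMul {r : ℕ} (p : MvPolynomial (Fin r) ℂ) (F : Formal r W) : Formal r W :=
  laurentMul (polyToLaurent p) F

variable (W) in
/-- `W((x₁, …, x_r)) = W[[x₁, …, x_r]][x₁⁻¹, …, x_r⁻¹]`. -/
def lowerTrunc (r : ℕ) : Submodule ℂ (Formal r W) where
  carrier := {F | ∃ N : ℤ, ∀ m, (∃ i, m i < N) → F m = 0}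
  zero_mem' := ⟨0, fun _ _ => rfl⟩
  add_mem' := by
    rintro F G ⟨N, hN⟩ ⟨M, hM⟩
    refine ⟨min N M, fun m ⟨i, hi⟩ => ?_⟩
    simp [hN m ⟨i, lt_of_lt_of_le hi (min_le_left _ _)⟩,
      hM m ⟨i, lt_of_lt_of_le hi (min_le_right _ _)⟩]
  smul_mem' := by
    rintro c F ⟨N, hN⟩
    exact ⟨N, fun m hm => by simp [hN m hm]⟩

/-- For `ψ₁, …, ψ_r` in `Hom (W, W((x)))` and `w ∈ W`, the formal series
`ψ₁(x₁) ⋯ ψ_r(x_r) w`. -/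
def prodSeries {r : ℕ} (ψ : Fin r → VertexOperator ℂ W) (w : W) : Formal r W :=
  fun m => (List.ofFn fun i => (HVertexOperator.coeff (ψ i) (m i) : Module.End ℂ W)).prod w

variable (W) in
/-- The identity operator `1_W`, as a (constant) element of `Hom (W, W((x)))`. -/
def idOp : VertexOperator ℂ W :=
  VertexOperator.of_coeff (fun n => if n = 0 then LinearMap.id else 0) (by
    intro w
    refine ⟨0, fun n hn => ?_⟩
    by_contra h
    exact hn (by simp [show n ≠ 0 by omega]))

theorem coeff_idOp (n : ℤ) :
    HVertexOperator.coeff (idOp W) n = if n = 0 then LinearMap.id else 0 := rfl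

/-! ### Quasi compatibility -/

/-- The sequence `(ψ₁, …, ψ_r)` is quasi compatible: there is a nonzero polynomial `p(x, y)` with
`(∏_{i<j} p(x_i, x_j)) ψ₁(x₁) ⋯ ψ_r(x_r) ∈ Hom (W, W((x₁, …, x_r)))`. -/
def QuasiCompatibleSeq {r : ℕ} (ψ : Fin r → VertexOperator ℂ W) : Prop :=
  ∃ p : MvPolynomial (Fin 2) ℂ, p ≠ 0 ∧ ∀ w : W,
    polyMul (∏ i : Fin r, ∏ j ∈ Finset.Ioi i, MvPolynomial.rename ![i, j] p) (prodSeries ψ w)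
      ∈ lowerTrunc W r

/-- A set is quasi compatible if every finite sequence in it is. -/
def QuasiCompatible (U : Set (VertexOperator ℂ W)) : Prop :=
  ∀ (r : ℕ) (ψ : Fin r → VertexOperator ℂ W), (∀ i, ψ i ∈ U) → QuasiCompatibleSeq ψ

/-- `p(x₁, x₂) a(x₁) b(x₂) ∈ Hom (W, W((x₁, x₂)))`. -/
def Clears (p : MvPolynomial (Fin 2) ℂ) (a b : VertexOperator ℂ W) : Prop :=
  ∀ w : W, polyMul p (prodSeries ![a, b] w) ∈ lowerTrunc W 2

/-! ### Iterated Laurent series in two variables -/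

/-- The field `ℂ((y))((z))` of iterated Laurent series, with inner variable `y` and outer
variable `z`. -/
def IterField := LaurentSeries (LaurentSeries ℂ)

instance : Field IterField := inferInstanceAs (Field (LaurentSeries (LaurentSeries ℂ)))

/-- Complex numbers as constant series. -/
instance : Algebra ℂ IterField :=
  RingHom.toAlgebra ((HahnSeries.C : LaurentSeries ℂ →+* LaurentSeries (LaurentSeries ℂ)).comp
    (HahnSeries.C : ℂ →+* LaurentSeries ℂ))

/-- The inner variable `y` of `ℂ((y))((z))`. -/
def inn : IterField :=
  (HahnSeries.C (HahnSeries.single (1 : ℤ) (1 : ℂ)) : LaurentSeries (LaurentSeries ℂ))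

/-- The outer variable `z` of `ℂ((y))((z))`. -/
def out : IterField :=
  (HahnSeries.single (1 : ℤ) (1 : LaurentSeries ℂ) : LaurentSeries (LaurentSeries ℂ))

variable (W) in
/-- `W((y))((z))`, a vector space over `ℂ((y))((z))`. -/
def IterModule := HahnModule ℤ (LaurentSeries ℂ) (HahnModule ℤ ℂ W)

instance : AddCommGroup (IterModule W) :=
  inferInstanceAs (AddCommGroup (HahnModule ℤ (LaurentSeries ℂ) (HahnModule ℤ ℂ W)))

/-- The multiplication of series. -/
instance : Module IterField (IterModule W) :=
  inferInstanceAs (Module (HahnSeries ℤ (LaurentSeries ℂ))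
    (HahnModule ℤ (LaurentSeries ℂ) (HahnModule ℤ ℂ W)))

/-- The coefficient of `z^n`, an element of `W((y))`. -/
def outerCoeff (F : IterModule W) (n : ℤ) : HahnModule ℤ ℂ W :=
  ((HahnModule.of (LaurentSeries ℂ)).symm F).coeff n

/-- The coefficient of `y^m z^n`. -/
def coeff₂ (F : IterModule W) (m n : ℤ) : W :=
  ((HahnModule.of ℂ).symm (outerCoeff F n)).coeff m

/-- The series `u(y) v(z) w ∈ W((y))((z))`. -/
def comp₂ (u v : VertexOperator ℂ W) (w : W) : IterModule W :=
  HahnModule.of (LaurentSeries ℂ) (((HahnModule.of ℂ).symm (v w)).map u)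

/-! ### The partial operations `a(x)_n b(x)` -/

/-- Coefficient of `y^k z^j` in `G(y + z, y)`, where `(y + z)^m = ∑_{j ≥ 0} C(m, j) y^{m-j} z^j`. -/
def shiftCoeff (G : Formal 2 W) (j : ℕ) (k : ℤ) : W :=
  ∑ᶠ m : ℤ, (Ring.choose m j : ℤ) • G ![m, k + j - m]

theorem shiftCoeff_finite (G : lowerTrunc W 2) (j : ℕ) (k : ℤ) :
    (Function.support fun m : ℤ =>
      (Ring.choose m j : ℤ) • (G : Formal 2 W) ![m, k + j - m]).Finite := by
  obtain ⟨N, hN⟩ := G.2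
  refine (Set.finite_Icc N (k + j - N)).subset fun m hm => ?_
  by_contra h
  refine hm ?_
  have : (G : Formal 2 W) ![m, k + j - m] = 0 := by
    rw [Set.mem_Icc, not_and_or] at h
    rcases h with h | h
    · exact hN _ ⟨0, by simpa using h⟩
    · exact hN _ ⟨1, by simp only [Matrix.cons_val_one, Matrix.cons_val_fin_one]; omega⟩
  simp [this]

theorem shiftCoeff_bddBelow (G : lowerTrunc W 2) (j : ℕ) :
    BddBelow (Function.support (shiftCoeff (G : Formal 2 W) j)) := by
  obtain ⟨N, hN⟩ := G.2
  refine ⟨2 * N - j, fun k hk => ?_⟩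
  by_contra h
  refine hk ?_
  have : ∀ m : ℤ, (Ring.choose m j : ℤ) • (G : Formal 2 W) ![m, k + j - m] = 0 := by
    intro m
    have : (G : Formal 2 W) ![m, k + j - m] = 0 := by
      by_cases hm : m < N
      · exact hN _ ⟨0, by simpa using hm⟩
      · exact hN _ ⟨1, by simp only [Matrix.cons_val_one, Matrix.cons_val_fin_one]; omega⟩
    simp [this]
  simp [shiftCoeff, this]

/-- The substitution `G(x₁, x) ↦ G(x₁, x)|_{x₁ = x + x₀}` from `W((x₁, x))` to
`W((x))[[x₀]] ⊂ W((x))((x₀))`. -/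
def shift (G : lowerTrunc W 2) : IterModule W :=
  HahnModule.of (LaurentSeries ℂ) <| HahnSeries.ofSuppBddBelow
    (fun j : ℤ => if 0 ≤ j then
        HahnModule.of ℂ (HahnSeries.ofSuppBddBelow _ (shiftCoeff_bddBelow G j.toNat))
      else 0)
    ⟨0, fun j hj => by
      by_contra h
      exact hj (if_neg h)⟩

theorem coeff₂_shift (G : lowerTrunc W 2) (k j : ℤ) :
    coeff₂ (shift G) k j = if 0 ≤ j then shiftCoeff (G : Formal 2 W) j.toNat k else 0 := by
  by_cases h : 0 ≤ j
  · rw [if_pos h]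
    change ((HahnModule.of ℂ).symm (if 0 ≤ j then _ else _)).coeff k = _
    rw [if_pos h]
    rfl
  · rw [if_neg h]
    change ((HahnModule.of ℂ).symm (if 0 ≤ j then _ else _)).coeff k = _
    rw [if_neg h]
    rfl

theorem ext₂ {F G : IterModule W} (h : ∀ m n, coeff₂ F m n = coeff₂ G m n) : F = G := by
  refine HahnModule.ext _ _ (funext fun n => ?_)
  exact HahnModule.ext _ _ (funext fun m => h m n)

theorem coeff₂_add (F G : IterModule W) (m n : ℤ) :
    coeff₂ (F + G) m n = coeff₂ F m n + coeff₂ G m n := rfl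

theorem shift_add (F G : lowerTrunc W 2) : shift (F + G) = shift F + shift G := by
  refine ext₂ fun k j => ?_
  rw [coeff₂_add, coeff₂_shift, coeff₂_shift, coeff₂_shift]
  split_ifs
  · simp only [shiftCoeff]
    rw [← finsum_add_distrib (shiftCoeff_finite F _ _) (shiftCoeff_finite G _ _)]
    simp
  · simp

theorem algebraMap_eq (c : ℂ) : algebraMap ℂ IterField c =
    (HahnSeries.C (HahnSeries.C c) : LaurentSeries (LaurentSeries ℂ)) := rfl

theorem outerCoeff_algebraMap_smul (c : ℂ) (F : IterModule W) (n : ℤ) :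
    outerCoeff (algebraMap ℂ IterField c • F) n = c • outerCoeff F n := by
  have h : outerCoeff (algebraMap ℂ IterField c • F) (0 + n) =
      (HahnSeries.C c : LaurentSeries ℂ) • outerCoeff F n :=
    HahnModule.coeff_single_smul_vadd (Γ := ℤ) (Γ' := ℤ) (R := LaurentSeries ℂ)
      (V := HahnModule ℤ ℂ W) (r := HahnSeries.C c) (x := F) (a := n) (b := 0)
  rw [zero_add] at h
  rw [h]
  exact HahnModule.single_zero_smul_eq_smul _

theorem shift_smul (c : ℂ) (G : lowerTrunc W 2) : shift (c • G) = algebraMap ℂ IterField c • shift G := by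
  refine ext₂ fun k j => ?_
  have h1 : coeff₂ (algebraMap ℂ IterField c • shift G) k j = c • coeff₂ (shift G) k j := by
    unfold coeff₂
    rw [outerCoeff_algebraMap_smul]
    rfl
  rw [h1, coeff₂_shift, coeff₂_shift]
  split_ifs
  · simp only [shiftCoeff]
    rw [smul_finsum' _ (shiftCoeff_finite G _ _)]
    refine finsum_congr fun m => ?_
    simp [smul_comm c]
  · simp

theorem prodSeries_add {r : ℕ} (ψ : Fin r → VertexOperator ℂ W) (v w : W) :
    prodSeries ψ (v + w) = prodSeries ψ v + prodSeries ψ w := by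
  funext m
  simp [prodSeries]

theorem prodSeries_smul {r : ℕ} (ψ : Fin r → VertexOperator ℂ W) (c : ℂ) (w : W) :
    prodSeries ψ (c • w) = c • prodSeries ψ w := by
  funext m
  simp [prodSeries]

theorem polyMul_add {r : ℕ} (p : MvPolynomial (Fin r) ℂ) (F G : Formal r W) :
    polyMul p (F + G) = polyMul p F + polyMul p G := by
  funext m
  simp [polyMul, laurentMul, Finsupp.sum_add]

theorem polyMul_smul {r : ℕ} (p : MvPolynomial (Fin r) ℂ) (c : ℂ) (F : Formal r W) :
    polyMul p (c • F) = c • polyMul p F := by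
  funext m
  simp [polyMul, laurentMul, Finsupp.smul_sum, smul_comm c]

/-- The series `Y_𝓔(a(x), x₀) b(x) w = ι_{x,x₀}(p(x + x₀, x)⁻¹) (p(x₁, x) a(x₁) b(x) w)|_{x₁ = x + x₀}`
in `W((x))((x₀))`, for a polynomial `p` such that `p(x₁, x₂) a(x₁) b(x₂) ∈ Hom (W, W((x₁, x₂)))`.
The inverse is taken in the field `ℂ((x))((x₀))`. -/
def opeSeries (p : MvPolynomial (Fin 2) ℂ) {a b : VertexOperator ℂ W} (h : Clears p a b) (w : W) :
    IterModule W :=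
  (MvPolynomial.aeval ![inn + out, inn] p : IterField)⁻¹ •
    shift ⟨polyMul p (prodSeries ![a, b] w), h w⟩

/-- The operator `a(x)_n b(x)`: the coefficient of `x₀^{-n-1}` in `Y_𝓔(a(x), x₀) b(x)`, computed
with the polynomial `p`. -/
def nthProd (p : MvPolynomial (Fin 2) ℂ) {a b : VertexOperator ℂ W} (h : Clears p a b) (n : ℤ) :
    VertexOperator ℂ W where
  toFun w := outerCoeff (opeSeries p h w) (-n - 1)
  map_add' v w := by
    have : opeSeries p h (v + w) = opeSeries p h v + opeSeries p h w := by
      unfold opeSeries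
      rw [← smul_add, ← shift_add]
      congr 2
      exact Subtype.ext (by simp [prodSeries_add, polyMul_add])
    rw [this]
    rfl
  map_smul' c w := by
    have : opeSeries p h (c • w) = algebraMap ℂ IterField c • opeSeries p h w := by
      unfold opeSeries
      rw [smul_smul, mul_comm, ← smul_smul, ← shift_smul]
      congr 2
      exact Subtype.ext (by simp [prodSeries_smul, polyMul_smul])
    rw [this, outerCoeff_algebraMap_smul]
    rfl

/-- A subspace is closed if it contains `a(x)_n b(x)` for all `a, b` in it and all `n`. -/
def IsClosedSubspace (U : Submodule ℂ (VertexOperator ℂ W)) : Prop :=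
  ∀ a ∈ U, ∀ b ∈ U, ∀ (p : MvPolynomial (Fin 2) ℂ) (_ : p ≠ 0) (h : Clears p a b) (n : ℤ),
    nthProd p h n ∈ U

/-- The closed quasi compatible subspaces of `Hom (W, W((x)))` that contain `S` and `1_W`. -/
def closedQuasiCompatible (S : Set (VertexOperator ℂ W)) :
    Set (Submodule ℂ (VertexOperator ℂ W)) :=
  {U | QuasiCompatible (U : Set (VertexOperator ℂ W)) ∧ IsClosedSubspace U ∧
    S ⊆ (U : Set (VertexOperator ℂ W)) ∧ idOp W ∈ U}

/-- `⟨S⟩`, the intersection of all closed quasi compatible subspaces that contain `S` and `1_W`. -/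
def generated (S : Set (VertexOperator ℂ W)) : Submodule ℂ (VertexOperator ℂ W) :=
  sInf (closedQuasiCompatible S)

/-! ### Pseudo-locality

In `ℂ((x₂))((x₁))` the inner variable is `x₂` and the outer variable is `x₁`. -/

/-- The inclusion of `ℂ[[x₁, x₂]] = ℂ[[x₂]][[x₁]]` in `ℂ((x₂))((x₁))`. -/
def powerSeriesEmb : PowerSeries (PowerSeries ℂ) →+* IterField :=
  (HahnSeries.ofPowerSeries ℤ (LaurentSeries ℂ)).comp
    (PowerSeries.map (HahnSeries.ofPowerSeries ℤ ℂ))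

/-- The image under `ι_{x₂,x₁}` in `ℂ((x₂))((x₁))` of
`ℂ_*(x₁, x₂) = {f / h | f ∈ ℂ[[x₁, x₂]], 0 ≠ h ∈ ℂ[x₁, x₂]}`. -/
def iotaStar : Set IterField :=
  {q | ∃ (f : PowerSeries (PowerSeries ℂ)) (h : MvPolynomial (Fin 2) ℂ), h ≠ 0 ∧
    q = powerSeriesEmb f / MvPolynomial.aeval ![out, inn] h}

/-- The image under `ι_{x₂,x₁}` in `ℂ((x₂))((x₁))` of
`ℂ_Γ(x₁, x₂) = ℂ[[x₁, x₂]][x₁⁻¹, x₂⁻¹, (x₁ - α x₂)⁻¹ | α ∈ Γ]`. -/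
def iotaGamma (Γ : Subgroup ℂˣ) : Subring IterField :=
  Subring.closure (Set.range powerSeriesEmb ∪ {out⁻¹, inn⁻¹} ∪
    {q | ∃ α ∈ Γ, q = (out - algebraMap ℂ IterField α * inn)⁻¹})

/-- `ℂ_Γ[x]`, the multiplicative monoid generated by the polynomials `x - α` with `α ∈ Γ`. -/
def gammaPoly (Γ : Subgroup ℂˣ) : Submonoid (Polynomial ℂ) :=
  Submonoid.closure {p | ∃ α ∈ Γ, p = Polynomial.X - Polynomial.C (α : ℂ)}

/-- `U` is pseudo-local: for `a, b ∈ U` there are a nonzero Laurent polynomial `p`, series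
`q_i ∈ ℂ_*(x₁, x₂)` and `u_i, v_i ∈ U` with
`p(x₁, x₂) a(x₁) b(x₂) = ∑ᵢ ι_{x₂,x₁}(q_i(x₁, x₂)) u_i(x₂) v_i(x₁)`. -/
def IsPseudoLocal (U : Set (VertexOperator ℂ W)) : Prop :=
  ∀ a ∈ U, ∀ b ∈ U, ∃ (r : ℕ) (p : LaurentPoly 2) (q : Fin r → IterField)
    (u v : Fin r → VertexOperator ℂ W),
    p ≠ 0 ∧ (∀ i, q i ∈ iotaStar) ∧ (∀ i, u i ∈ U) ∧ (∀ i, v i ∈ U) ∧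
    ∀ (w : W) (m₁ m₂ : ℤ), laurentMul p (prodSeries ![a, b] w) ![m₁, m₂] =
      ∑ i, coeff₂ (q i • comp₂ (u i) (v i) w) m₂ m₁

/-- `U` is pseudo `Γ`-local: for `a, b ∈ U` there are `0 ≠ p ∈ ℂ_Γ[x]`, series
`q_i ∈ ℂ_Γ(x₁, x₂)` and `u_i, v_i ∈ U` with
`p(x₁/x₂) a(x₁) b(x₂) = ∑ᵢ p(x₁/x₂) ι_{x₂,x₁}(q_i(x₁, x₂)) u_i(x₂) v_i(x₁)`. -/
def IsPseudoGammaLocal (Γ : Subgroup ℂˣ) (U : Set (VertexOperator ℂ W)) : Prop :=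
  ∀ a ∈ U, ∀ b ∈ U, ∃ (r : ℕ) (p : Polynomial ℂ) (q : Fin r → IterField)
    (u v : Fin r → VertexOperator ℂ W),
    p ≠ 0 ∧ p ∈ gammaPoly Γ ∧ (∀ i, q i ∈ iotaGamma Γ) ∧ (∀ i, u i ∈ U) ∧ (∀ i, v i ∈ U) ∧
    ∀ (w : W) (m₁ m₂ : ℤ), laurentMul (ratioToLaurent p) (prodSeries ![a, b] w) ![m₁, m₂] =
      ∑ i, coeff₂ (((Polynomial.aeval (out / inn : IterField) p) * q i) •
        comp₂ (u i) (v i) w) m₂ m₁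

end

/-! ### Nonlocal vertex algebras and quasi modules -/

section

variable {V W : Type*} [AddCommGroup V] [Module ℂ V] [AddCommGroup W] [Module ℂ W]

/-- The series `Y_W(u, x₀ + x₂) Y_W(v, x₂) w` in `x₀, x₂`, where
`(x₀ + x₂)^n = ∑_{j ≥ 0} C(n, j) x₀^{n-j} x₂^j`. -/
def assocLeft (YW : V →ₗ[ℂ] VertexOperator ℂ W) (u v : V) (w : W) : Formal 2 W :=
  fun m => ∑ᶠ j : ℕ, (Ring.choose (m 0 + j) j : ℤ) •
    HVertexOperator.coeff (YW u) (m 0 + j) (HVertexOperator.coeff (YW v) (m 1 - j) w)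

/-- The series `Y_W(Y(u, x₀) v, x₂) w` in `x₀, x₂`. -/
def assocRight (Y : V →ₗ[ℂ] VertexOperator ℂ V) (YW : V →ₗ[ℂ] VertexOperator ℂ W)
    (u v : V) (w : W) : Formal 2 W :=
  fun m => HVertexOperator.coeff (YW (HVertexOperator.coeff (Y u) (m 0) v)) (m 1) w

/-- `(V, Y, 𝟏)` is a nonlocal vertex algebra. -/
structure IsNonlocalVertexAlgebra (Y : V →ₗ[ℂ] VertexOperator ℂ V) (one : V) : Prop where
  /-- `Y(𝟏, x) v = v`. -/
  vacuum : Y one = idOp V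
  /-- `Y(v, x) 𝟏 ∈ V[[x]]`. -/
  creation_regular : ∀ (v : V) (n : ℤ), n < 0 → HVertexOperator.coeff (Y v) n one = 0
  /-- The constant term of `Y(v, x) 𝟏` is `v`. -/
  creation : ∀ v : V, HVertexOperator.coeff (Y v) 0 one = v
  /-- Weak associativity: `(x₀ + x₂)^l Y(u, x₀ + x₂) Y(v, x₂) w = (x₀ + x₂)^l Y(Y(u, x₀) v, x₂) w`. -/
  weak_assoc : ∀ u v w : V, ∃ l : ℕ,
    polyMul ((MvPolynomial.X 0 + MvPolynomial.X 1) ^ l) (assocLeft Y u v w) =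
      polyMul ((MvPolynomial.X 0 + MvPolynomial.X 1) ^ l) (assocRight Y Y u v w)

/-- `(W, Y_W)` is a quasi module for the nonlocal vertex algebra `(V, Y, 𝟏)`. -/
structure IsQuasiModule (Y : V →ₗ[ℂ] VertexOperator ℂ V) (one : V)
    (YW : V →ₗ[ℂ] VertexOperator ℂ W) : Prop where
  /-- `(V, Y, 𝟏)` is a nonlocal vertex algebra. -/
  algebra : IsNonlocalVertexAlgebra Y one
  /-- `Y_W(𝟏, x) = 1_W`. -/
  vacuum : YW one = idOp W
  /-- `f(x₀ + x₂, x₂) Y_W(u, x₀ + x₂) Y_W(v, x₂) w = f(x₀ + x₂, x₂) Y_W(Y(u, x₀) v, x₂) w`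
  for some nonzero polynomial `f(x₁, x₂)`. -/
  quasi_assoc : ∀ (u v : V) (w : W), ∃ f : MvPolynomial (Fin 2) ℂ, f ≠ 0 ∧
    polyMul (MvPolynomial.aeval ![MvPolynomial.X 0 + MvPolynomial.X 1, MvPolynomial.X 1] f)
        (assocLeft YW u v w) =
      polyMul (MvPolynomial.aeval ![MvPolynomial.X 0 + MvPolynomial.X 1, MvPolynomial.X 1] f)
        (assocRight Y YW u v w)

/-- A pseudo-local quasi module: `{Y_W(v, x) | v ∈ V}` is pseudo-local. -/
structure IsPseudoLocalQuasiModule (Y : V →ₗ[ℂ] VertexOperator ℂ V) (one : V)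
    (YW : V →ₗ[ℂ] VertexOperator ℂ W) : Prop extends IsQuasiModule Y one YW where
  pseudo_local : IsPseudoLocal (Set.range YW)

/-- A pseudo `Γ`-local quasi module: `{Y_W(v, x) | v ∈ V}` is pseudo `Γ`-local. -/
structure IsPseudoGammaLocalQuasiModule (Γ : Subgroup ℂˣ) (Y : V →ₗ[ℂ] VertexOperator ℂ V)
    (one : V) (YW : V →ₗ[ℂ] VertexOperator ℂ W) : Prop extends IsQuasiModule Y one YW where
  pseudo_gamma_local : IsPseudoGammaLocal Γ (Set.range YW)

end

end NonlocalVA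

end

open NonlocalVA

set_option linter.unusedSectionVars false
set_option linter.unusedSimpArgs false

noncomputable section

namespace NonlocalVA

/-! ### The action of polynomials on formal series -/

section Action

variable {σ τ : Type*} {W : Type*} [AddCommGroup W] [Module ℂ W]

/-! Series are functions on exponent vectors; polynomials act on them through `act`, and `x_s ↦ x_s
+ x_t` through `subst`. Two facts carry the calculus. Substitution is compatible with polynomial
multiplication (`subst_act`); this uses only Pascal's rule, so it covers both expansions of `(x +
y)^n`. And nonzero polynomials can be cancelled: once a power of one variable is split off, the
lowest coefficient is a nonzero polynomial in a single variable, which acts injectively on series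
bounded below (`act_cancel₂`, `act_cancel₃`). Hence `Y_𝓔` is the unique solution of `p(x + x₀, x)
Y_𝓔(a(x), x₀) b(x) = (p a b)|_{x₁ = x + x₀}` for any clearing `p`. Independence of `p`, bilinearity
and the vacuum axioms follow by comparing such equations.

For weak associativity, both iterated products of three operators become, after multiplication by
one polynomial, the same threefold substitution of the cleared series `a(x₁) b(x₂) c(x₃) w`
(`act_ope_ope_left`, `act_ope_ope_right`, `subst_subst_subst`). That polynomial is `x₀^l x₁^l (x₀ +
x₁)^l P` with `P` cancellable, and everything except `(x₀ + x₁)^l` can be removed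
(`act_add_pow_cancel`).

The subspace `⟨S⟩` is what is obtained from `S ∪ {1_W}` by linear combinations and the products `a_n
b`. To see that it is quasi compatible, take first a word in `S ∪ {1_W}`: the exchange relations
move any letter to the right end, where its variable is bounded below (`exists_varBdd_word`). A
letter `a_n b` is then treated by replacing it with two letters `a, b` in separate variables and
extracting a coefficient in `x₀` of the substituted series; the lowest coefficient in `x₀` of the
clearing polynomial does the clearing (`tameWord_ope`).

Pseudo-locality passes to `⟨S⟩` by moving `c` past `b` and past `a`, and then substituting `x₁ = x_s
+ x₀`. The Leibniz rule (`slice_subst_conv_none`) shows that coefficients stay in `ℂ((x₁, x₂))`.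
Setting `x₀ = 0` turns the exchange polynomials into products of polynomials of the given
multiplicative monoid, and the remaining polynomial in one variable is invertible in `ℂ((x))`. Thus
the monoid never has to be enlarged: all nonzero polynomials give pseudo-locality, products of the
forms `x₁ - α x₂` the `Γ`-version (`exchange_generated`). -/

variable (σ W) in
/-- Translations of the exponents. -/
def translate : Multiplicative (σ → ℤ) →* Module.End ℂ ((σ → ℤ) → W) where
  toFun d := LinearMap.funLeft ℂ W fun m => m - d.toAdd
  map_one' := by ext; simp
  map_mul' a b := by
    ext F m
    simp only [LinearMap.funLeft_apply, Module.End.mul_apply, toAdd_mul]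
    congr 1; abel

variable (σ W) in
/-- The action of Laurent polynomials on formal series. -/
def lau : AddMonoidAlgebra ℂ (σ → ℤ) →ₐ[ℂ] Module.End ℂ ((σ → ℤ) → W) :=
  AddMonoidAlgebra.lift ℂ _ (σ → ℤ) (translate σ W)

theorem lau_apply (p : AddMonoidAlgebra ℂ (σ → ℤ)) (F : (σ → ℤ) → W) (m : σ → ℤ) :
    lau σ W p F m = p.coeff.sum fun d c => c • F (m - d) := by
  simp [lau, AddMonoidAlgebra.lift_apply, Finsupp.sum, translate, LinearMap.funLeft_apply]

theorem laurentMul_eq_lau {r : ℕ} (p : LaurentPoly r) (F : Formal r W) :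
    laurentMul p F = lau (Fin r) W p F := by
  funext m; rw [lau_apply]; rfl

variable [DecidableEq σ] [DecidableEq τ]

variable (σ W) in
/-- The action of polynomials on formal series. -/
def act : MvPolynomial σ ℂ →ₐ[ℂ] Module.End ℂ ((σ → ℤ) → W) :=
  (lau σ W).comp (MvPolynomial.aeval fun i => AddMonoidAlgebra.single (Pi.single i (1 : ℤ)) (1 : ℂ))

theorem polyMul_eq_act {r : ℕ} (p : MvPolynomial (Fin r) ℂ) (F : Formal r W) :
    polyMul p F = act (Fin r) W p F :=
  laurentMul_eq_lau _ _

theorem act_X (s : σ) (F : (σ → ℤ) → W) (m : σ → ℤ) :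
    act σ W (MvPolynomial.X s) F m = F (m - Pi.single s 1) := by
  simp [act, lau_apply]

theorem act_C (c : ℂ) (F : (σ → ℤ) → W) : act σ W (MvPolynomial.C c) F = c • F := by
  rw [← MvPolynomial.algebraMap_eq, AlgHom.commutes]; rfl

theorem act_X_pow (s : σ) (n : ℕ) (F : (σ → ℤ) → W) (m : σ → ℤ) :
    act σ W (MvPolynomial.X s ^ n) F m = F (m - Pi.single s (n : ℤ)) := by
  induction n generalizing m with
  | zero => simp
  | succ n ih =>
    rw [pow_succ', map_mul, Module.End.mul_apply, act_X, ih, sub_sub, ← Pi.single_add]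
    push_cast; rw [add_comm]

theorem act_mul (p q : MvPolynomial σ ℂ) (F : (σ → ℤ) → W) :
    act σ W (p * q) F = act σ W p (act σ W q F) := by
  rw [map_mul]; rfl

theorem act_add (p q : MvPolynomial σ ℂ) (F : (σ → ℤ) → W) :
    act σ W (p + q) F = act σ W p F + act σ W q F := by
  rw [map_add]; rfl

theorem act_one (F : (σ → ℤ) → W) : act σ W 1 F = F := by
  rw [map_one]; rfl

theorem act_comm (p q : MvPolynomial σ ℂ) (F : (σ → ℤ) → W) :
    act σ W p (act σ W q F) = act σ W q (act σ W p F) := by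
  rw [← act_mul, mul_comm, act_mul]

/-- The set `D` is stable under lowering the exponents. -/
def IsDown (D : Set (σ → ℤ)) : Prop := ∀ m ∈ D, ∀ s, m - Pi.single s 1 ∈ D

/-- A polynomial has nonnegative exponents, so a coefficient of the product depends only on
coefficients of `F` at lowered exponents. The boundedness statements for products use this with a
suitable `D`. -/
theorem IsDown.act_eq_zero {D : Set (σ → ℤ)} (hD : IsDown D) (p : MvPolynomial σ ℂ)
    {F : (σ → ℤ) → W} (hF : ∀ m ∈ D, F m = 0) : ∀ m ∈ D, act σ W p F m = 0 := by
  induction p using MvPolynomial.induction_on with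
  | C c => intro m hm; simp [hF m hm]
  | add p q hp hq => intro m hm; simp [hp m hm, hq m hm]
  | mul_X p s hp =>
    intro m hm
    rw [mul_comm, act_mul, act_X]
    exact hp _ (hD m hm s)

/-- A property of formal series that is stable under linear combinations and multiplication by
variables is stable under multiplication by polynomials. -/
theorem act_induction {P : ((σ → ℤ) → W) → Prop} (hadd : ∀ F G, P F → P G → P (F + G))
    (hsmul : ∀ (c : ℂ) F, P F → P (c • F))
    (hX : ∀ s F, P F → P (fun m => F (m - Pi.single s 1)))
    (p : MvPolynomial σ ℂ) {F : (σ → ℤ) → W} (hF : P F) : P (act σ W p F) := by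
  induction p using MvPolynomial.induction_on with
  | C c => rw [act_C]; exact hsmul c F hF
  | add p q hp hq => rw [act_add]; exact hadd _ _ hp hq
  | mul_X p s hp =>
    rw [mul_comm, act_mul]
    have : act σ W (MvPolynomial.X s) (act σ W p F) =
      fun m => act σ W p F (m - Pi.single s 1) := funext fun m => act_X _ _ _
    rw [this]
    exact hX _ _ hp

/-- Postcomposition with linear maps commutes with the action. -/
theorem act_map {W' : Type*} [AddCommGroup W'] [Module ℂ W'] (T : W →ₗ[ℂ] W')
    (p : MvPolynomial σ ℂ) (F : (σ → ℤ) → W) :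
    act σ W' p (fun m => T (F m)) = fun m => T (act σ W p F m) := by
  funext m
  simp [act, lau_apply, Finsupp.sum]

/-- Restriction of a series to the variables in the image of `e`, with fixed exponents of the other
variables. -/
def restrict (e : τ → σ) (m : σ → ℤ) (G : (σ → ℤ) → W) : (τ → ℤ) → W :=
  fun d => G (Function.extend e d m)

theorem extend_comp_self (e : τ → σ) (he : Function.Injective e) (m : σ → ℤ) :
    Function.extend e (m ∘ e) m = m := by
  funext s
  by_cases h : ∃ t, e t = s
  · obtain ⟨t, rfl⟩ := h; rw [he.extend_apply]; rfl
  · rw [Function.extend_apply' _ _ _ h]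

theorem restrict_self (e : τ → σ) (he : Function.Injective e) (m : σ → ℤ) (G : (σ → ℤ) → W) :
    restrict e m G (m ∘ e) = G m := by
  rw [restrict, extend_comp_self e he]

theorem extend_sub_single (e : τ → σ) (he : Function.Injective e) (m : σ → ℤ) (d : τ → ℤ) (t : τ)
    (k : ℤ) : Function.extend e (d - Pi.single t k) m =
      Function.extend e d m - Pi.single (e t) k := by
  funext s
  by_cases h : ∃ t, e t = s
  · obtain ⟨t', rfl⟩ := h
    simp only [Pi.sub_apply, he.extend_apply, Pi.single_apply, he.eq_iff]
  · simp only [Pi.sub_apply, Function.extend_apply' _ _ _ h, Pi.single_apply]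
    rw [if_neg, sub_zero]
    rintro rfl; exact h ⟨t, rfl⟩

/-- The spectator variables are untouched, so the action may be computed slice by slice; together
with `eq_of_restrict` this reduces identities to the variables in the image of `e`. -/
theorem restrict_act (e : τ → σ) (he : Function.Injective e) (m : σ → ℤ)
    (p : MvPolynomial τ ℂ) (G : (σ → ℤ) → W) :
    restrict e m (act σ W (MvPolynomial.rename e p) G) = act τ W p (restrict e m G) := by
  induction p using MvPolynomial.induction_on generalizing m with
  | C c => simp only [MvPolynomial.rename_C, act_C]; rfl
  | add p q hp hq => rw [map_add, act_add, act_add, ← hp, ← hq]; rfl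
  | mul_X p s hp =>
    rw [map_mul, MvPolynomial.rename_X, mul_comm, mul_comm p, act_mul, act_mul, ← hp]
    funext d
    rw [act_X]
    simp only [restrict]
    rw [act_X, extend_sub_single e he]

theorem eq_of_restrict (e : τ → σ) (he : Function.Injective e) {F G : (σ → ℤ) → W}
    (h : ∀ m, restrict e m F = restrict e m G) : F = G := by
  funext m
  rw [← restrict_self e he m F, h, restrict_self e he]

end Action

/-! ### Substitutions `x_s ↦ x_s + x_t` -/

section Substitution

/-- The coefficient of `x^a y^{n-a}` in `(x + y)^n`, expanded in nonnegative powers of `x`. -/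
def binomLeft (n a : ℤ) : ℤ := if 0 ≤ a then Ring.choose n a.toNat else 0

/-- The coefficient of `x^a y^{n-a}` in `(x + y)^n`, expanded in nonnegative powers of `y`. -/
def binomRight (n a : ℤ) : ℤ := if a ≤ n then Ring.choose n (n - a).toNat else 0

/-- Pascal's rule for binomial coefficients with integral lower entry. -/
def IsPascal (c : ℤ → ℤ → ℤ) : Prop := ∀ n a, c (n + 1) a = c n a + c n (a - 1)

theorem isPascal_binomLeft : IsPascal binomLeft := by
  intro n a
  unfold binomLeft
  rcases lt_trichotomy a 0 with h | rfl | h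
  · rw [if_neg (by omega), if_neg (by omega), if_neg (by omega), add_zero]
  · simp [Ring.choose_zero_right]
  · obtain ⟨k, rfl⟩ : ∃ k : ℕ, a = k + 1 := ⟨(a - 1).toNat, by omega⟩
    rw [if_pos (by omega), if_pos (by omega), if_pos (by omega),
      show ((k : ℤ) + 1).toNat = k + 1 by omega, show ((k : ℤ) + 1 - 1).toNat = k by omega,
      Ring.choose_succ_succ, add_comm]

theorem isPascal_binomRight : IsPascal binomRight := by
  intro n a
  unfold binomRight
  rcases lt_trichotomy a (n + 1) with h | rfl | h
  · obtain ⟨k, hk⟩ : ∃ k : ℕ, n - a = k := ⟨(n - a).toNat, by omega⟩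
    rw [if_pos (by omega), if_pos (by omega), if_pos (by omega),
      show (n + 1 - a).toNat = k + 1 by omega, show (n - a).toNat = k by omega,
      show (n - (a - 1)).toNat = k + 1 by omega, Ring.choose_succ_succ]
  · simp [Ring.choose_zero_right]
  · rw [if_neg (by omega), if_neg (by omega), if_neg (by omega), add_zero]

theorem choose_eq_zero_of_lt {n : ℤ} {k : ℕ} (hn : 0 ≤ n) (h : n < k) : Ring.choose n k = 0 := by
  lift n to ℕ using hn
  rw [Ring.choose_natCast, Nat.choose_eq_zero_of_lt (by exact_mod_cast h)]; rfl

theorem binomLeft_eq_binomRight {n : ℤ} (hn : 0 ≤ n) (a : ℤ) : binomLeft n a = binomRight n a := by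
  unfold binomLeft binomRight
  split_ifs with h1 h2 h2
  · lift n to ℕ using hn
    lift a to ℕ using h1
    rw [Ring.choose_natCast, Ring.choose_natCast, Int.toNat_natCast,
      show ((n : ℤ) - a).toNat = n - a by omega, Nat.choose_symm (by exact_mod_cast h2)]
  · exact choose_eq_zero_of_lt hn (by omega)
  · exact (choose_eq_zero_of_lt hn (by omega)).symm
  · rfl

variable {σ : Type*} [DecidableEq σ] {W : Type*} [AddCommGroup W] [Module ℂ W]

/-- The exponent vector obtained from `m` by replacing `m_s, m_t` by `n, m_s + m_t - n`. -/
def moved (s t : σ) (m : σ → ℤ) (n : ℤ) : σ → ℤ :=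
  Function.update (Function.update m s n) t (m t + m s - n)

theorem moved_t (s t : σ) (m : σ → ℤ) (n : ℤ) : moved s t m n t = m t + m s - n := by
  simp [moved]

theorem moved_s {s t : σ} (hst : s ≠ t) (m : σ → ℤ) (n : ℤ) : moved s t m n s = n := by
  simp [moved, hst]

theorem moved_ne {s t u : σ} (hs : u ≠ s) (ht : u ≠ t) (m : σ → ℤ) (n : ℤ) :
    moved s t m n u = m u := by
  simp [moved, hs, ht]

theorem moved_sub_single {s t u : σ} (hst : s ≠ t) (hu : u ≠ s) (m : σ → ℤ) (n k : ℤ) :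
    moved s t (m - Pi.single u k) n = moved s t m n - Pi.single u k := by
  funext v
  simp only [moved, Function.update_apply, Pi.sub_apply, Pi.single_apply]
  split_ifs <;> grind

theorem moved_sub_single_s {s t : σ} (hst : s ≠ t) (m : σ → ℤ) (n : ℤ) :
    moved s t m n - Pi.single s 1 = moved s t (m - Pi.single t 1) (n - 1) := by
  funext v
  simp only [moved, Function.update_apply, Pi.sub_apply, Pi.single_apply]
  split_ifs <;> grind

theorem moved_sub_single_s' {s t : σ} (hst : s ≠ t) (m : σ → ℤ) (n : ℤ) :
    moved s t (m - Pi.single t 1) n = moved s t (m - Pi.single s 1) n := by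
  funext v
  simp only [moved, Function.update_apply, Pi.sub_apply, Pi.single_apply]
  split_ifs <;> grind

/-- The substitution `x_s ↦ x_s + x_t`, with binomial coefficients `c`. -/
def subst (c : ℤ → ℤ → ℤ) (s t : σ) (G : (σ → ℤ) → W) : (σ → ℤ) → W :=
  fun m => ∑ᶠ n : ℤ, c n (m s) • G (moved s t m n)

/-- The sums that define `subst c s t G` are finite. -/
def Substitutable (c : ℤ → ℤ → ℤ) (s t : σ) (G : (σ → ℤ) → W) : Prop :=
  ∀ m, {n | c n (m s) ≠ 0 ∧ G (moved s t m n) ≠ 0}.Finite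

theorem Substitutable.support_finite {c : ℤ → ℤ → ℤ} {s t : σ} {G : (σ → ℤ) → W}
    (h : Substitutable c s t G) (m : σ → ℤ) :
    (Function.support fun n : ℤ => c n (m s) • G (moved s t m n)).Finite :=
  (h m).subset fun n hn => ⟨fun h0 => hn (by simp [h0]), fun h0 => hn (by simp [h0])⟩

theorem Substitutable.add {c : ℤ → ℤ → ℤ} {s t : σ} {F G : (σ → ℤ) → W}
    (hF : Substitutable c s t F) (hG : Substitutable c s t G) : Substitutable c s t (F + G) :=
  fun m => ((hF m).union (hG m)).subset fun n hn => by
    by_cases h : F (moved s t m n) = 0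
    · refine Or.inr ⟨hn.1, fun h' => hn.2 ?_⟩
      simp [h, h']
    · exact Or.inl ⟨hn.1, h⟩

theorem Substitutable.smul {c : ℤ → ℤ → ℤ} {s t : σ} {F : (σ → ℤ) → W}
    (hF : Substitutable c s t F) (a : ℂ) : Substitutable c s t (a • F) :=
  fun m => (hF m).subset fun n hn => ⟨hn.1, fun h' => hn.2 (by simp [h'])⟩

theorem substitutable_zero {c : ℤ → ℤ → ℤ} {s t : σ} :
    Substitutable c s t (0 : (σ → ℤ) → W) := fun m => by simp

/-- Multiplication by `x_s` shifts the summation index by one, and Pascal's rule splits the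
coefficient `c n (m s)` into two entries of row `n - 1`; each is controlled by the finiteness for
`F` at a neighbouring exponent. -/
theorem Substitutable.X {c : ℤ → ℤ → ℤ} (hc : IsPascal c) {s t : σ} (hst : s ≠ t)
    {F : (σ → ℤ) → W} (hF : Substitutable c s t F) (u : σ) :
    Substitutable c s t (fun m => F (m - Pi.single u 1)) := by
  intro m
  by_cases hu : u = s
  · subst hu
    refine (((hF (m - Pi.single t 1)).union (hF (m - Pi.single u 1))).image (· + 1)).subset ?_
    rintro n ⟨h1, h2⟩
    refine ⟨n - 1, ?_, by simp⟩
    change F (moved u t m n - Pi.single u 1) ≠ 0 at h2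
    rw [moved_sub_single_s hst] at h2
    have := hc (n - 1) (m u)
    rw [sub_add_cancel] at this
    by_cases h : c (n - 1) (m u) = 0
    · right
      refine ⟨?_, by rwa [moved_sub_single_s' hst] at h2⟩
      simp only [Pi.sub_apply, Pi.single_eq_same]
      intro h'; exact h1 (by rw [this, h, h', add_zero])
    · left
      refine ⟨?_, h2⟩
      simpa [Pi.single_apply, hst] using h
  · refine (hF (m - Pi.single u 1)).subset ?_
    rintro n ⟨h1, h2⟩
    rw [Set.mem_ofPred_eq, moved_sub_single hst hu]
    refine ⟨?_, h2⟩
    simpa [Pi.single_apply, Ne.symm hu] using h1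

theorem Substitutable.act {c : ℤ → ℤ → ℤ} (hc : IsPascal c) {s t : σ} (hst : s ≠ t)
    {F : (σ → ℤ) → W} (hF : Substitutable c s t F) (p : MvPolynomial σ ℂ) :
    Substitutable c s t (act σ W p F) :=
  act_induction (fun _ _ => .add) (fun a _ h => h.smul a) (fun u _ h => h.X hc hst u) p hF

theorem subst_add {c : ℤ → ℤ → ℤ} {s t : σ} {F G : (σ → ℤ) → W} (hF : Substitutable c s t F)
    (hG : Substitutable c s t G) :
    subst c s t (F + G) = subst c s t F + subst c s t G := by
  funext m
  simp only [subst, Pi.add_apply, smul_add]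
  exact finsum_add_distrib (hF.support_finite m) (hG.support_finite m)

theorem subst_smul {c : ℤ → ℤ → ℤ} {s t : σ} {F : (σ → ℤ) → W} (hF : Substitutable c s t F)
    (a : ℂ) : subst c s t (a • F) = a • subst c s t F := by
  funext m
  simp only [subst, Pi.smul_apply]
  rw [smul_finsum' _ (hF.support_finite m)]
  exact finsum_congr fun n => smul_comm _ _ _

theorem subst_zero {c : ℤ → ℤ → ℤ} {s t : σ} : subst c s t (0 : (σ → ℤ) → W) = 0 := by
  funext m; simp [subst]

theorem subst_sum {c : ℤ → ℤ → ℤ} {s t : σ} {ι : Type*} (I : Finset ι) (F : ι → (σ → ℤ) → W)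
    (hF : ∀ i ∈ I, Substitutable c s t (F i)) :
    Substitutable c s t (∑ i ∈ I, F i) ∧
      subst c s t (∑ i ∈ I, F i) = ∑ i ∈ I, subst c s t (F i) := by
  classical
  induction I using Finset.induction_on with
  | empty => simp [substitutable_zero, subst_zero]
  | insert i I hi ih =>
    have h1 := hF i (Finset.mem_insert_self _ _)
    obtain ⟨h2, h3⟩ := ih fun j hj => hF j (Finset.mem_insert_of_mem hj)
    rw [Finset.sum_insert hi, Finset.sum_insert hi, subst_add h1 h2, h3]
    exact ⟨h1.add h2, rfl⟩

/-- The algebra endomorphism `x_s ↦ x_s + x_t`. -/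
def substAlg (s t : σ) : MvPolynomial σ ℂ →ₐ[ℂ] MvPolynomial σ ℂ :=
  MvPolynomial.aeval (Function.update MvPolynomial.X s (MvPolynomial.X s + MvPolynomial.X t))

theorem substAlg_X_self (s t : σ) :
    substAlg s t (MvPolynomial.X s) = MvPolynomial.X s + MvPolynomial.X t := by
  simp [substAlg]

theorem substAlg_X_ne {s u : σ} (h : u ≠ s) (t : σ) :
    substAlg s t (MvPolynomial.X u) = MvPolynomial.X u := by
  simp [substAlg, h]

/-- For `u = s` this is `(x_s + x_t)^{n+1} = (x_s + x_t)(x_s + x_t)^n`, that is, Pascal's rule after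
reindexing `n ↦ n + 1`. -/
theorem subst_X {c : ℤ → ℤ → ℤ} (hc : IsPascal c) {s t : σ} (hst : s ≠ t) {F : (σ → ℤ) → W}
    (hF : Substitutable c s t F) (u : σ) :
    subst c s t (act σ W (MvPolynomial.X u) F) =
      act σ W (substAlg s t (MvPolynomial.X u)) (subst c s t F) := by
  funext m
  by_cases hu : u = s
  · subst hu
    rw [substAlg_X_self, act_add, Pi.add_apply, act_X, act_X]
    simp only [subst, act_X]
    have h1 := hF.support_finite (m - Pi.single u 1)
    have h2 := hF.support_finite (m - Pi.single t 1)
    rw [← finsum_add_distrib h1 h2, ← finsum_comp_equiv (Equiv.addRight (1 : ℤ))]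
    refine finsum_congr fun n => ?_
    rw [Equiv.coe_addRight, moved_sub_single_s hst, add_sub_cancel_right, ← moved_sub_single_s' hst,
      hc, add_smul, add_comm]
    simp [Pi.single_apply, hst]
  · rw [substAlg_X_ne hu, act_X]
    simp only [subst, act_X]
    refine finsum_congr fun n => ?_
    rw [moved_sub_single hst hu]
    simp [Pi.single_apply, Ne.symm hu]

theorem subst_act {c : ℤ → ℤ → ℤ} (hc : IsPascal c) {s t : σ} (hst : s ≠ t) {F : (σ → ℤ) → W}
    (hF : Substitutable c s t F) (p : MvPolynomial σ ℂ) :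
    subst c s t (act σ W p F) = act σ W (substAlg s t p) (subst c s t F) := by
  induction p using MvPolynomial.induction_on with
  | C a =>
    rw [show substAlg s t (MvPolynomial.C a) = MvPolynomial.C a from AlgHom.commutes _ _, act_C,
      act_C, subst_smul hF]
  | add p q hp hq =>
    rw [act_add, subst_add (hF.act hc hst p) (hF.act hc hst q), hp, hq, map_add, act_add]
  | mul_X p u hp =>
    rw [mul_comm, act_mul, subst_X hc hst (hF.act hc hst p), hp, ← act_mul, ← map_mul (substAlg s t)]

/-- The two expansions of `(x_s + x_t)^n` differ only for `n < 0`. This is the bridge between the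
expansion in `Y(u, x₀ + x₂)` and the one in the definition of `Y_𝓔`. -/
theorem subst_binomRight_eq {s t : σ} (hst : s ≠ t) {F : (σ → ℤ) → W}
    (hF : ∀ m, m s < 0 → F m = 0) : subst binomRight s t F = subst binomLeft s t F := by
  funext m
  refine finsum_congr fun n => ?_
  by_cases hn : 0 ≤ n
  · rw [binomLeft_eq_binomRight hn]
  · rw [hF _ (by rw [moved_s hst]; omega), smul_zero, smul_zero]

theorem subst_binomLeft_of_neg {s t : σ} {F : (σ → ℤ) → W} {m : σ → ℤ} (hm : m s < 0) :
    subst binomLeft s t F m = 0 := by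
  have : ∀ n, binomLeft n (m s) = 0 := fun n => if_neg (by omega)
  simp [subst, this]

/-- Expansion in nonnegative powers of `x_t` forces `n ≥ m s`, while the lower bound for `x_t` in
`F` bounds `n` from above. No bound in `x_s` is needed. -/
theorem substitutable_binomRight {s t : σ} {F : (σ → ℤ) → W} {N : ℤ}
    (hF : ∀ m, m t < N → F m = 0) : Substitutable binomRight s t F := by
  intro m
  refine (Set.finite_Icc (m s) (m t + m s - N)).subset ?_
  rintro n ⟨h1, h2⟩
  constructor
  · by_contra h
    exact h1 (if_neg h)
  · by_contra h
    exact h2 (hF _ (by rw [moved_t]; omega))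

theorem substitutable_of_bddBelow {s t : σ} (hst : s ≠ t) {F : (σ → ℤ) → W} {N : ℤ}
    (hF : ∀ m, m s < N ∨ m t < N → F m = 0) (c : ℤ → ℤ → ℤ) : Substitutable c s t F := by
  intro m
  refine (Set.finite_Icc N (m t + m s - N)).subset ?_
  rintro n ⟨-, h2⟩
  constructor
  · by_contra h
    exact h2 (hF _ (Or.inl (by rw [moved_s hst]; omega)))
  · by_contra h
    exact h2 (hF _ (Or.inr (by rw [moved_t]; omega)))

/-- Postcomposition with linear maps commutes with substitutions. -/
theorem subst_map {c : ℤ → ℤ → ℤ} {s t : σ} {W' : Type*} [AddCommGroup W'] [Module ℂ W']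
    (T : W →ₗ[ℂ] W') {F : (σ → ℤ) → W} (hF : Substitutable c s t F) :
    subst c s t (fun m => T (F m)) = fun m => T (subst c s t F m) := by
  funext m
  have := (T.toAddMonoidHom.map_finsum (hF.support_finite m))
  simp only [subst]
  rw [LinearMap.toAddMonoidHom_coe] at this
  rw [this]
  exact finsum_congr fun n => (map_zsmul T _ _).symm

theorem moved_extend {τ : Type*} [DecidableEq τ] (e : τ → σ) (he : Function.Injective e)
    (s t : τ) (m : σ → ℤ) (d : τ → ℤ) (n : ℤ) :
    moved (e s) (e t) (Function.extend e d m) n = Function.extend e (moved s t d n) m := by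
  funext v
  by_cases h : ∃ t, e t = v
  · obtain ⟨v, rfl⟩ := h
    simp only [moved, Function.update_apply, he.extend_apply, he.eq_iff]
  · have h1 : v ≠ e s := fun h' => h ⟨s, h'.symm⟩
    have h2 : v ≠ e t := fun h' => h ⟨t, h'.symm⟩
    rw [moved_ne h1 h2, Function.extend_apply' _ _ _ h, Function.extend_apply' _ _ _ h]

theorem restrict_subst {τ : Type*} [DecidableEq τ] (c : ℤ → ℤ → ℤ) (e : τ → σ)
    (he : Function.Injective e) (m : σ → ℤ) (s t : τ) (G : (σ → ℤ) → W) :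
    restrict e m (subst c (e s) (e t) G) = subst c s t (restrict e m G) := by
  funext d
  simp only [restrict, subst]
  refine finsum_congr fun n => ?_
  rw [moved_extend e he, he.extend_apply]

theorem rename_substAlg {τ : Type*} [DecidableEq τ] (e : τ → σ) (he : Function.Injective e)
    (s t : τ) (p : MvPolynomial τ ℂ) :
    MvPolynomial.rename e (substAlg s t p) = substAlg (e s) (e t) (MvPolynomial.rename e p) := by
  induction p using MvPolynomial.induction_on with
  | C a => simp [substAlg]
  | add p q hp hq => rw [map_add, map_add, map_add, map_add, hp, hq]
  | mul_X p u hp =>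
    rw [map_mul, map_mul, map_mul, map_mul, hp, MvPolynomial.rename_X]
    congr 1
    by_cases hu : u = s
    · subst hu; rw [substAlg_X_self, substAlg_X_self, map_add, MvPolynomial.rename_X,
        MvPolynomial.rename_X]
    · rw [substAlg_X_ne hu, substAlg_X_ne (he.ne hu), MvPolynomial.rename_X]

/-- The inverse substitution is `x_s ↦ x_s - x_t`. It guarantees that `p(x + x₀, x) ≠ 0`, so that
this polynomial may be cancelled. -/
theorem substAlg_injective {s t : σ} (hst : s ≠ t) : Function.Injective (substAlg s t) := by
  have h : Function.LeftInverse (MvPolynomial.aeval (Function.update MvPolynomial.X s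
      (MvPolynomial.X s - MvPolynomial.X t)) : MvPolynomial σ ℂ →ₐ[ℂ] MvPolynomial σ ℂ)
      (substAlg s t) := by
    intro p
    rw [← AlgHom.comp_apply]
    refine DFunLike.congr_fun (g := AlgHom.id ℂ _) (MvPolynomial.algHom_ext fun u => ?_) p
    rw [AlgHom.comp_apply, AlgHom.id_apply]
    by_cases hu : u = s
    · subst hu; rw [substAlg_X_self, map_add]; simp [hst.symm]
    · rw [substAlg_X_ne hu]; simp [hu]
  exact h.injective

end Substitution

/-! ### Cancellation of polynomials -/

section Cancellation

open MvPolynomial (aeval X C rename)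

variable {σ : Type*} [DecidableEq σ] {W : Type*} [AddCommGroup W] [Module ℂ W]

/-- The evaluation `x_s = 0`. -/
def setZero (s : σ) : MvPolynomial σ ℂ →ₐ[ℂ] MvPolynomial σ ℂ :=
  aeval (Function.update X s 0)

theorem setZero_X_self (s : σ) : setZero s (X s) = 0 := by simp [setZero]

theorem setZero_X_ne {s u : σ} (h : u ≠ s) : setZero s (X u) = X u := by simp [setZero, h]

theorem eq_setZero_add (s : σ) (p : MvPolynomial σ ℂ) : ∃ h, p = setZero s p + X s * h := by
  induction p using MvPolynomial.induction_on with
  | C a => exact ⟨0, by simp [setZero]⟩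
  | add p q hp hq =>
    obtain ⟨h1, e1⟩ := hp
    obtain ⟨h2, e2⟩ := hq
    refine ⟨h1 + h2, ?_⟩
    conv_lhs => rw [e1, e2]
    rw [map_add]; ring
  | mul_X p u hp =>
    obtain ⟨h1, e1⟩ := hp
    by_cases hu : u = s
    · subst hu; exact ⟨p, by rw [map_mul, setZero_X_self]; ring⟩
    · refine ⟨h1 * X u, ?_⟩
      rw [map_mul, setZero_X_ne hu]
      conv_lhs => rw [e1]
      ring

/-- If `p` vanishes at `x_s = 0`, division by `x_s` lowers the total degree, so the process stops.
-/
theorem exists_eq_X_pow_mul (s : σ) (p : MvPolynomial σ ℂ) (hp : p ≠ 0) :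
    ∃ (l : ℕ) (g : MvPolynomial σ ℂ), p = X s ^ l * g ∧ setZero s g ≠ 0 := by
  induction hn : p.totalDegree using Nat.strong_induction_on generalizing p with
  | _ n ih =>
    by_cases h0 : setZero s p = 0
    · obtain ⟨h, e⟩ := eq_setZero_add s p
      rw [h0, zero_add] at e
      have hh : h ≠ 0 := by rintro rfl; exact hp (by rw [e, mul_zero])
      have hd : p.totalDegree = 1 + h.totalDegree := by
        rw [e, MvPolynomial.totalDegree_mul_of_isDomain (MvPolynomial.X_ne_zero s) hh,
          MvPolynomial.totalDegree_X]
      obtain ⟨l, g, e', hg⟩ := ih h.totalDegree (by omega) h hh rfl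
      exact ⟨l + 1, g, by rw [e, e']; ring, hg⟩
    · exact ⟨0, p, by simp, h0⟩

theorem act_aeval_X (u : σ) (g : Polynomial ℂ) (F : (σ → ℤ) → W) (m : σ → ℤ) :
    act σ W (Polynomial.aeval (X u) g) F m =
      g.sum fun i c => c • F (m - Pi.single u (i : ℤ)) := by
  rw [Polynomial.aeval_eq_sum_range, Polynomial.sum_over_range _ (by simp), map_sum,
    LinearMap.sum_apply, Finset.sum_apply]
  refine Finset.sum_congr rfl fun i _ => ?_
  rw [map_smul, LinearMap.smul_apply, Pi.smul_apply, act_X_pow]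

/-- A nonzero polynomial in one variable acts injectively on series that are bounded below in this
variable. -/
theorem eq_zero_of_act_aeval_X {u : σ} {g : Polynomial ℂ} (hg : g ≠ 0) {F : (σ → ℤ) → W}
    {m : σ → ℤ} (hF : ∃ N : ℤ, ∀ k < N, F (Function.update m u k) = 0)
    (h : ∀ k, act σ W (Polynomial.aeval (X u) g) F (Function.update m u k) = 0) (k : ℤ) :
    F (Function.update m u k) = 0 := by
  by_contra hk
  obtain ⟨N, hN⟩ := hF
  obtain ⟨k₀, hk₀, hmin⟩ := Int.exists_least_of_bdd
    (P := fun k => F (Function.update m u k) ≠ 0)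
    ⟨N, fun z hz => by by_contra h'; exact hz (hN z (by omega))⟩ ⟨k, hk⟩
  -- At this exponent the lowest coefficient of `F` meets the trailing coefficient of `g`, and
  -- nothing else contributes.
  have h1 := h (k₀ + g.natTrailingDegree)
  have hu : ∀ i : ℤ, Function.update m u (k₀ + g.natTrailingDegree) - Pi.single u i =
      Function.update m u (k₀ + g.natTrailingDegree - i) := by
    intro i; funext v
    simp only [Function.update_apply, Pi.sub_apply, Pi.single_apply]
    split_ifs <;> simp
  rw [act_aeval_X, Polynomial.sum_def, Finset.sum_eq_single g.natTrailingDegree] at h1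
  · rw [hu, add_sub_cancel_right] at h1
    exact (smul_ne_zero (by rwa [← Polynomial.trailingCoeff, ne_eq,
      Polynomial.trailingCoeff_eq_zero]) hk₀) h1
  · intro i hi hne
    rw [hu]
    have : g.natTrailingDegree ≤ i := Polynomial.natTrailingDegree_le_of_mem_supp i hi
    by_contra h'
    have := hmin _ (fun h0 => h' (by rw [h0, smul_zero]))
    omega
  · intro h0
    exact absurd (Polynomial.natTrailingDegree_mem_support_of_nonzero hg) h0

/-- The series is bounded below in the variable `x_u`, for fixed exponents of the other
variables. -/
def LineBdd (u : σ) (F : (σ → ℤ) → W) : Prop :=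
  ∀ m, ∃ N : ℤ, ∀ k < N, F (Function.update m u k) = 0

theorem LineBdd.add {u : σ} {F G : (σ → ℤ) → W} (hF : LineBdd u F) (hG : LineBdd u G) :
    LineBdd u (F + G) := by
  intro m
  obtain ⟨N, hN⟩ := hF m
  obtain ⟨M, hM⟩ := hG m
  refine ⟨min N M, fun k hk => ?_⟩
  rw [Pi.add_apply, hN k (by omega), hM k (by omega), add_zero]

theorem LineBdd.smul {u : σ} {F : (σ → ℤ) → W} (hF : LineBdd u F) (c : ℂ) :
    LineBdd u (c • F) := by
  intro m
  obtain ⟨N, hN⟩ := hF m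
  exact ⟨N, fun k hk => by rw [Pi.smul_apply, hN k hk, smul_zero]⟩

theorem LineBdd.sub {u : σ} {F G : (σ → ℤ) → W} (hF : LineBdd u F) (hG : LineBdd u G) :
    LineBdd u (F - G) := by
  rw [sub_eq_add_neg, ← neg_one_smul ℂ G]; exact hF.add (hG.smul _)

theorem LineBdd.act {u : σ} {F : (σ → ℤ) → W} (hF : LineBdd u F) (p : MvPolynomial σ ℂ) :
    LineBdd u (act σ W p F) := by
  refine act_induction (fun _ _ => LineBdd.add) (fun c _ h => h.smul c) (fun s F hF m => ?_) p hF
  obtain ⟨N, hN⟩ := hF (m - Pi.single s 1)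
  refine ⟨N, fun k hk => ?_⟩
  by_cases hs : s = u
  · subst hs
    rw [← hN (k - 1) (by omega)]
    refine congrArg F (funext fun v => ?_)
    simp only [Function.update_apply, Pi.sub_apply, Pi.single_apply]
    split_ifs <;> simp
  · rw [← hN k hk]
    refine congrArg F (funext fun v => ?_)
    simp only [Function.update_apply, Pi.sub_apply, Pi.single_apply]
    split_ifs with h1 h2 <;> simp_all

/-- `E` is the region where `F` is already known to vanish. The terms of `g` divisible by `x_s` or
`x_t` read `F` only there, so along the line in direction `x_u` the action of `g` is that of
`g₀(x_u)`, which is injective. -/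
theorem act_cancel_step {s t u : σ} {g h₁ h₂ : MvPolynomial σ ℂ}
    {g₀ : Polynomial ℂ} (hg₀ : g₀ ≠ 0)
    (hg : g = Polynomial.aeval (X u) g₀ + X s * h₁ + X t * h₂) {F : (σ → ℤ) → W}
    {E : Set (σ → ℤ)} (hE : IsDown E) (hFE : ∀ m ∈ E, F m = 0) {m : σ → ℤ}
    (hms : ∀ k, Function.update m u k - Pi.single s 1 ∈ E)
    (hmt : ∀ k, Function.update m u k - Pi.single t 1 ∈ E)
    (hF : LineBdd u F) (h : ∀ k, act σ W g F (Function.update m u k) = 0) : F m = 0 := by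
  rw [← Function.update_eq_self u m]
  refine eq_zero_of_act_aeval_X hg₀ (hF m) (fun k => ?_) _
  have := h k
  rw [hg, act_add, act_add, Pi.add_apply, Pi.add_apply, act_mul, act_X, act_mul, act_X,
    hE.act_eq_zero h₁ hFE _ (hms k), hE.act_eq_zero h₂ hFE _ (hmt k), add_zero, add_zero] at this
  exact this

/-- If `g` has a nonzero constant term `g₀(x_u)` with respect to `x_s` and `g F` vanishes in the
degrees below `K` with respect to `x_s`, then so does `F`. -/
theorem act_cancel₂ {s u : σ} (hs : s ≠ u) {g : MvPolynomial σ ℂ} {g₀ : Polynomial ℂ}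
    (hg₀ : g₀ ≠ 0) (hg : setZero s g = Polynomial.aeval (X u) g₀) {F : (σ → ℤ) → W}
    (hF : ∃ N : ℤ, ∀ m, m s < N → F m = 0) (hFu : LineBdd u F) {K : ℤ}
    (h : ∀ m, m s < K → act σ W g F m = 0) : ∀ m, m s < K → F m = 0 := by
  obtain ⟨N, hN⟩ := hF
  obtain ⟨h₁, e⟩ := eq_setZero_add s g
  -- Induction on the exponent of `x_s`, upwards from the bound `N` below which `F` vanishes.
  have key : ∀ n : ℤ, N ≤ n → ∀ m, m s < n → m s < K → F m = 0 := by
    intro n hn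
    induction n, hn using Int.leInduction with
    | base => exact fun m hm _ => hN m hm
    | succ n _ ih =>
      intro m hm hK
      refine act_cancel_step (E := {m | m s < n ∧ m s < K}) hg₀
        (by rw [← hg]; simpa using e : g = _ + X s * h₁ + X s * 0) ?_ (fun m hm => ih m hm.1 hm.2)
        ?_ ?_ hFu ?_
      · rintro m ⟨h1, h2⟩ v
        have : (m - Pi.single v 1 : σ → ℤ) s ≤ m s := by
          simp only [Pi.sub_apply, Pi.single_apply]; split_ifs <;> omega
        exact ⟨by omega, by omega⟩
      · intro k; constructor <;> simp [hs] <;> omega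
      · intro k; constructor <;> simp [hs] <;> omega
      · intro k; exact h _ (by simpa [hs] using hK)
  intro m hm
  exact key (max N (m s + 1)) (le_max_left _ _) m (by omega) hm

/-- Here the lower bound in `x_s` depends on the exponent of `x_t`, as in `W((x_s))((x_t))`. A
double induction is therefore used: on the exponent of `x_t`, and inside it on that of `x_s`. -/
theorem act_cancel₃ {s t u : σ} (hst : s ≠ t) (hs : s ≠ u) (ht : t ≠ u) {g : MvPolynomial σ ℂ}
    {g₀ : Polynomial ℂ} (hg₀ : g₀ ≠ 0) (hg : setZero s (setZero t g) = Polynomial.aeval (X u) g₀)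
    {F : (σ → ℤ) → W} (hF : ∃ N : ℤ, ∀ m, m t < N → F m = 0)
    (hF' : ∀ k : ℤ, ∃ N : ℤ, ∀ m, m t ≤ k → m s < N → F m = 0) (hFu : LineBdd u F) {K : ℤ}
    (h : ∀ m, m s < K → act σ W g F m = 0) : ∀ m, m s < K → F m = 0 := by
  obtain ⟨N, hN⟩ := hF
  obtain ⟨h₂, e₂⟩ := eq_setZero_add t g
  obtain ⟨h₁, e₁⟩ := eq_setZero_add s (setZero t g)
  have key : ∀ n : ℤ, N ≤ n → ∀ m, m t < n → m s < K → F m = 0 := by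
    intro n hn
    induction n, hn using Int.leInduction with
    | base => exact fun m hm _ => hN m hm
    | succ n _ ih =>
      obtain ⟨M, hM⟩ := hF' n
      have key' : ∀ a : ℤ, M ≤ a → ∀ m, m t < n + 1 → m s < a → m s < K → F m = 0 := by
        intro a ha
        induction a, ha using Int.leInduction with
        | base => exact fun m h1 h2 _ => hM m (by omega) h2
        | succ a _ ih' =>
          intro m hmt hms hK
          -- The region is an initial segment for the lexicographic order with `x_t` first, cut off
          -- at `K` in the direction of `x_s`.
          refine act_cancel_step
            (E := {m | m s < K ∧ (m t < n ∨ (m t < n + 1 ∧ m s < a))}) hg₀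
            (by rw [← hg, ← e₁]; exact e₂ : g = _ + X s * h₁ + X t * h₂) ?_ ?_
            ?_ ?_ hFu ?_
          · intro m hm v
            have h1 : (m - Pi.single v 1 : σ → ℤ) s ≤ m s := by
              simp only [Pi.sub_apply, Pi.single_apply]; split_ifs <;> omega
            have h2 : (m - Pi.single v 1 : σ → ℤ) t ≤ m t := by
              simp only [Pi.sub_apply, Pi.single_apply]; split_ifs <;> omega
            simp only [Set.mem_ofPred_eq] at hm ⊢
            omega
          · rintro m ⟨h1, h2 | h2⟩
            · exact ih m h2 h1
            · exact ih' m h2.1 h2.2 h1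
          · intro k
            simp [hs, ht, hst, Pi.single_apply, hst.symm]
            omega
          · intro k
            simp [hs, ht, hst, Pi.single_apply, hst.symm]
            omega
          · intro k; exact h _ (by simpa [hs] using hK)
      intro m hmt hK
      exact key' (max M (m s + 1)) (le_max_left _ _) m hmt (by omega) hK
  intro m hm
  exact key (max N (m t + 1)) (le_max_left _ _) m (by omega) hm

theorem setZero_fin_two (p : MvPolynomial (Fin 2) ℂ) (i j : Fin 2) (hij : i ≠ j) :
    ∃ g₀ : Polynomial ℂ, setZero i p = Polynomial.aeval (X j) g₀ := by
  refine ⟨aeval (Function.update (fun _ => Polynomial.X) i 0) p, ?_⟩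
  rw [← AlgHom.comp_apply]
  refine DFunLike.congr_fun (MvPolynomial.algHom_ext fun u => ?_) p
  by_cases hu : u = i
  · subst hu; simp [setZero]
  · have : u = j := by omega
    subst this
    simp [setZero, hu]

/-- A nonzero polynomial in two variables is `x₁^l (g₀(x₂) + x₁ h)` with `g₀ ≠ 0`. -/
theorem exists_eq_X_pow_mul_fin_two (p : MvPolynomial (Fin 2) ℂ) (hp : p ≠ 0) :
    ∃ (l : ℕ) (g : MvPolynomial (Fin 2) ℂ) (g₀ : Polynomial ℂ), p = X 0 ^ l * g ∧ g₀ ≠ 0 ∧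
      setZero 0 g = Polynomial.aeval (X 1) g₀ := by
  obtain ⟨l, g, e, hg⟩ := exists_eq_X_pow_mul 0 p hp
  obtain ⟨g₀, h⟩ := setZero_fin_two g 0 1 (by decide)
  exact ⟨l, g, g₀, e, by rintro rfl; exact hg (by rw [h, map_zero]), h⟩

/-- A nonzero polynomial acts injectively on `W((x₂))((x₁))`. -/
theorem eq_zero_of_act_eq_zero {p : MvPolynomial (Fin 2) ℂ} (hp : p ≠ 0)
    {F : (Fin 2 → ℤ) → W} (hF : ∃ N : ℤ, ∀ m, m 0 < N → F m = 0) (hF₁ : LineBdd 1 F)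
    (h : act (Fin 2) W p F = 0) : F = 0 := by
  obtain ⟨l, g, g₀, rfl, hg₀, hg⟩ := exists_eq_X_pow_mul_fin_two p hp
  funext m
  refine act_cancel₂ (by decide) hg₀ hg hF hF₁ (K := m 0 + 1) (fun m _ => ?_) m (by omega)
  -- The factor `x₁^l` is invertible: it only shifts exponents.
  have := congrFun h (m + Pi.single 0 (l : ℤ))
  rwa [act_mul, act_X_pow, add_sub_cancel_right] at this

end Cancellation

/-! ### Iterated Laurent series as formal series -/

section Iter

open MvPolynomial (aeval X C rename)

variable {W : Type*} [AddCommGroup W] [Module ℂ W]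

/-- The coefficients of a series in `W((x₂))((x₁))`, as a formal series in `x₁, x₂`. -/
def toFormal (F : IterModule W) : Formal 2 W := fun m => coeff₂ F (m 1) (m 0)

theorem toFormal_add (F G : IterModule W) : toFormal (F + G) = toFormal F + toFormal G := rfl

theorem toFormal_zero : toFormal (0 : IterModule W) = 0 := rfl

theorem toFormal_algebraMap_smul (c : ℂ) (F : IterModule W) :
    toFormal (algebraMap ℂ IterField c • F) = c • toFormal F := by
  funext m
  simp only [toFormal, coeff₂, outerCoeff_algebraMap_smul]
  rfl

theorem outerCoeff_out_smul (F : IterModule W) (n : ℤ) :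
    outerCoeff (out • F) n = outerCoeff F (n - 1) := by
  have h : outerCoeff (out • F) (1 + (n - 1)) = (1 : LaurentSeries ℂ) • outerCoeff F (n - 1) :=
    HahnModule.coeff_single_smul_vadd (Γ := ℤ) (Γ' := ℤ) (R := LaurentSeries ℂ)
      (V := HahnModule ℤ ℂ W) (r := 1) (x := F) (a := n - 1) (b := 1)
  rwa [add_sub_cancel, one_smul] at h

theorem outerCoeff_C_smul (c : LaurentSeries ℂ) (F : IterModule W) (n : ℤ) :
    outerCoeff ((show IterField from (HahnSeries.C c : LaurentSeries (LaurentSeries ℂ))) • F) n =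
      c • outerCoeff F n := by
  have h : outerCoeff ((show IterField from
        (HahnSeries.C c : LaurentSeries (LaurentSeries ℂ))) • F) (0 + n) = c • outerCoeff F n :=
    HahnModule.coeff_single_smul_vadd (Γ := ℤ) (Γ' := ℤ) (R := LaurentSeries ℂ)
      (V := HahnModule ℤ ℂ W) (r := c) (x := F) (a := n) (b := 0)
  rwa [zero_add] at h

theorem coeff₂_inn_smul (F : IterModule W) (m n : ℤ) :
    coeff₂ (inn • F) m n = coeff₂ F (m - 1) n := by
  have h1 : outerCoeff (inn • F) n = (HahnSeries.single (1 : ℤ) (1 : ℂ)) • outerCoeff F n :=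
    outerCoeff_C_smul _ F n
  have h : ((HahnModule.of ℂ).symm ((HahnSeries.single (1 : ℤ) (1 : ℂ)) •
      outerCoeff F n)).coeff (1 + (m - 1)) = (1 : ℂ) • coeff₂ F (m - 1) n :=
    HahnModule.coeff_single_smul_vadd (Γ := ℤ) (Γ' := ℤ) (R := ℂ)
      (V := W) (r := 1) (x := outerCoeff F n) (a := m - 1) (b := 1)
  rw [add_sub_cancel, one_smul] at h
  rw [← h, ← h1]; rfl

/-- The embedding of polynomials in `ℂ((x₂))((x₁))`. -/
def polyEmb : MvPolynomial (Fin 2) ℂ →ₐ[ℂ] IterField := aeval ![out, inn]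

theorem toFormal_polyEmb_smul (p : MvPolynomial (Fin 2) ℂ) (F : IterModule W) :
    toFormal (polyEmb p • F) = act (Fin 2) W p (toFormal F) := by
  induction p using MvPolynomial.induction_on with
  | C a =>
    rw [← MvPolynomial.algebraMap_eq, AlgHom.commutes, toFormal_algebraMap_smul,
      MvPolynomial.algebraMap_eq, act_C]
  | add p q hp hq => rw [map_add, add_smul, toFormal_add, hp, hq, act_add]
  | mul_X p s hp =>
    rw [map_mul, mul_comm, mul_smul, mul_comm p, act_mul, ← hp]
    funext m
    rw [act_X]
    fin_cases s
    · simp only [polyEmb, MvPolynomial.aeval_X, toFormal, coeff₂]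
      simp [outerCoeff_out_smul]
    · simp only [polyEmb, MvPolynomial.aeval_X, toFormal]
      simp [coeff₂_inn_smul]

theorem toFormal_bddBelow (F : IterModule W) : ∃ N : ℤ, ∀ m, m 0 < N → toFormal F m = 0 := by
  refine ⟨((HahnModule.of (LaurentSeries ℂ)).symm F).order, fun m hm => ?_⟩
  have : outerCoeff F (m 0) = 0 := HahnSeries.coeff_eq_zero_of_lt_order hm
  simp [toFormal, coeff₂, this]

theorem hahnModule_bddBelow (F : HahnModule ℤ ℂ W) :
    ∃ N : ℤ, ∀ k < N, ((HahnModule.of ℂ).symm F).coeff k = 0 :=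
  ⟨((HahnModule.of ℂ).symm F).order, fun _ hm => HahnSeries.coeff_eq_zero_of_lt_order hm⟩

theorem coeff_bddBelow (a : VertexOperator ℂ W) (w : W) :
    ∃ N : ℤ, ∀ k < N, HVertexOperator.coeff a k w = 0 :=
  hahnModule_bddBelow (a w)

theorem toFormal_lineBdd (F : IterModule W) : LineBdd 1 (toFormal F) := by
  intro m
  obtain ⟨N, hN⟩ := hahnModule_bddBelow (outerCoeff F (m 0))
  exact ⟨N, fun k hk => by simpa [toFormal, coeff₂] using hN k hk⟩

/-- It is enough to let `p` act on the constant series `1` with coefficients in `ℂ`, where the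
cancellation principle applies. -/
theorem polyEmb_ne_zero {p : MvPolynomial (Fin 2) ℂ} (hp : p ≠ 0) : polyEmb p ≠ 0 := by
  intro h
  let F : IterModule ℂ := HahnModule.of (LaurentSeries ℂ)
    (HahnSeries.single 0 (HahnModule.of ℂ (HahnSeries.single 0 1)))
  have h1 : toFormal F = 0 := eq_zero_of_act_eq_zero hp (toFormal_bddBelow F) (toFormal_lineBdd F)
    (by rw [← toFormal_polyEmb_smul, h, zero_smul, toFormal_zero])
  have h2 := congrFun h1 0
  simp [F, toFormal, coeff₂, outerCoeff] at h2

theorem toFormal_comp₂ (u v : VertexOperator ℂ W) (w : W) (m : Fin 2 → ℤ) :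
    toFormal (comp₂ u v w) m =
      HVertexOperator.coeff u (m 1) (HVertexOperator.coeff v (m 0) w) := rfl

end Iter

/-! ### Products of two operators -/

section Pair

open MvPolynomial (aeval X C rename)

variable {W : Type*} [AddCommGroup W] [Module ℂ W]

/-- The series `a(x₁) b(x₂) w`. -/
def pair (a b : VertexOperator ℂ W) (w : W) : (Fin 2 → ℤ) → W :=
  fun m => HVertexOperator.coeff a (m 0) (HVertexOperator.coeff b (m 1) w)

theorem prodSeries_pair (a b : VertexOperator ℂ W) (w : W) :
    prodSeries ![a, b] w = pair a b w := by
  funext m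
  simp [prodSeries, pair]

/-- The series is bounded below in all variables. -/
def LowerTrunc {σ : Type*} (F : (σ → ℤ) → W) : Prop := ∃ N : ℤ, ∀ m, (∃ i, m i < N) → F m = 0

theorem clears_iff {p : MvPolynomial (Fin 2) ℂ} {a b : VertexOperator ℂ W} :
    Clears p a b ↔ ∀ w, LowerTrunc (act (Fin 2) W p (pair a b w)) := by
  unfold Clears
  simp only [prodSeries_pair, polyMul_eq_act]
  rfl

section
variable {σ : Type*}

theorem LowerTrunc.add {F G : (σ → ℤ) → W} (hF : LowerTrunc F) (hG : LowerTrunc G) :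
    LowerTrunc (F + G) := by
  obtain ⟨N, hN⟩ := hF
  obtain ⟨M, hM⟩ := hG
  refine ⟨min N M, fun m ⟨i, hi⟩ => ?_⟩
  rw [Pi.add_apply, hN m ⟨i, by omega⟩, hM m ⟨i, by omega⟩, add_zero]

theorem LowerTrunc.smul {F : (σ → ℤ) → W} (hF : LowerTrunc F) (c : ℂ) :
    LowerTrunc (c • F) := by
  obtain ⟨N, hN⟩ := hF
  exact ⟨N, fun m hm => by rw [Pi.smul_apply, hN m hm, smul_zero]⟩

theorem lowerTrunc_zero : LowerTrunc (0 : (σ → ℤ) → W) := ⟨0, fun _ _ => rfl⟩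

theorem LowerTrunc.act [DecidableEq σ] {F : (σ → ℤ) → W} (hF : LowerTrunc F)
    (p : MvPolynomial σ ℂ) : LowerTrunc (act σ W p F) := by
  obtain ⟨N, hN⟩ := hF
  refine ⟨N, IsDown.act_eq_zero (D := {m | ∃ i, m i < N}) ?_ p hN⟩
  rintro m ⟨i, hi⟩ s
  refine ⟨i, lt_of_le_of_lt ?_ hi⟩
  simp only [Pi.sub_apply, Pi.single_apply]; split_ifs <;> omega

theorem LowerTrunc.substitutable [DecidableEq σ] {F : (σ → ℤ) → W} (hF : LowerTrunc F) {s t : σ}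
    (hst : s ≠ t) (c : ℤ → ℤ → ℤ) : Substitutable c s t F := by
  obtain ⟨N, hN⟩ := hF
  exact substitutable_of_bddBelow hst (N := N) (fun m hm => hN m (hm.elim (⟨s, ·⟩) (⟨t, ·⟩))) c

end

theorem Clears.mul {p : MvPolynomial (Fin 2) ℂ} {a b : VertexOperator ℂ W} (h : Clears p a b)
    (q : MvPolynomial (Fin 2) ℂ) : Clears (q * p) a b := by
  rw [clears_iff] at h ⊢
  intro w
  rw [act_mul]
  exact (h w).act q

theorem Clears.dvd {p q : MvPolynomial (Fin 2) ℂ} {a b : VertexOperator ℂ W} (h : Clears p a b)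
    (hpq : p ∣ q) : Clears q a b := by
  obtain ⟨r, rfl⟩ := hpq
  rw [mul_comm]; exact h.mul r

/-- In `toFormal` the index `0` is the outer variable `x₀` and the index `1` is `x`, so the
expansion in nonnegative powers of `x₀` is the one with `binomLeft`. -/
theorem toFormal_shift (G : lowerTrunc W 2) : toFormal (shift G) = subst binomLeft 0 1 G.1 := by
  funext m
  rw [toFormal, coeff₂_shift]
  split_ifs with h
  · simp only [shiftCoeff, subst]
    refine finsum_congr fun n => ?_
    rw [binomLeft, if_pos h, Int.toNat_of_nonneg h]
    refine congrArg (_ • G.1 ·) (funext fun i => ?_)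
    fin_cases i <;> simp [moved]
  · rw [subst_binomLeft_of_neg (by omega)]

theorem polyEmb_substAlg (p : MvPolynomial (Fin 2) ℂ) :
    polyEmb (substAlg 0 1 p) = aeval ![inn + out, inn] p := by
  rw [← AlgHom.comp_apply]
  refine DFunLike.congr_fun (MvPolynomial.algHom_ext fun u => ?_) p
  fin_cases u
  · simp [substAlg_X_self, polyEmb, add_comm]
  · simp [substAlg_X_ne, polyEmb]

/-- The defining property of `Y_𝓔(a(x), x₀) b(x) w`. -/
theorem act_opeSeries {p : MvPolynomial (Fin 2) ℂ} (hp : p ≠ 0) {a b : VertexOperator ℂ W}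
    (h : Clears p a b) (w : W) :
    act (Fin 2) W (substAlg 0 1 p) (toFormal (opeSeries p h w)) =
      subst binomLeft 0 1 (act (Fin 2) W p (pair a b w)) := by
  have hne : polyEmb (substAlg 0 1 p) ≠ 0 :=
    polyEmb_ne_zero ((map_ne_zero_iff _ (substAlg_injective (by decide))).2 hp)
  rw [← toFormal_polyEmb_smul, opeSeries, ← polyEmb_substAlg, smul_smul, mul_inv_cancel₀ hne,
    one_smul, toFormal_shift]
  simp only [prodSeries_pair, polyMul_eq_act]

theorem coeff_nthProd {p : MvPolynomial (Fin 2) ℂ} {a b : VertexOperator ℂ W}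
    (h : Clears p a b) (w : W) (m : Fin 2 → ℤ) :
    HVertexOperator.coeff (nthProd p h (-m 0 - 1)) (m 1) w = toFormal (opeSeries p h w) m := by
  change coeff₂ (opeSeries p h w) (m 1) (-(-m 0 - 1) - 1) = _
  rw [toFormal]; congr 1; ring

/-- The pair `a, b` is quasi compatible. -/
def Compat (a b : VertexOperator ℂ W) : Prop :=
  ∃ p : MvPolynomial (Fin 2) ℂ, p ≠ 0 ∧ Clears p a b

open Classical in
/-- The coefficient of `x₀^k` in `Y_𝓔(a(x), x₀) b(x)` (zero if no polynomial clears `a, b`). -/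
def ope (a b : VertexOperator ℂ W) (k : ℤ) : VertexOperator ℂ W :=
  if h : Compat a b then
    nthProd h.choose h.choose_spec.2 (-k - 1) else 0

/-- `Y_𝓔(a(x₂), x₁) b(x₂) w`. -/
def opeFormal (a b : VertexOperator ℂ W) (w : W) : (Fin 2 → ℤ) → W :=
  fun m => HVertexOperator.coeff (ope a b (m 0)) (m 1) w

theorem opeFormal_lineBdd (a b : VertexOperator ℂ W) (w : W) : LineBdd 1 (opeFormal a b w) := by
  intro m
  obtain ⟨N, hN⟩ := coeff_bddBelow (ope a b (m 0)) w
  exact ⟨N, fun k hk => by simpa [opeFormal] using hN k hk⟩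

theorem Compat.opeFormal_eq {a b : VertexOperator ℂ W} (h : Compat a b) (w : W) :
    opeFormal a b w = toFormal (opeSeries h.choose h.choose_spec.2 w) := by
  funext m
  rw [← coeff_nthProd, opeFormal, ope, dif_pos h]

theorem Compat.exists_ope {a b : VertexOperator ℂ W} (h : Compat a b) :
    ∃ p : MvPolynomial (Fin 2) ℂ, p ≠ 0 ∧ Clears p a b ∧ ∀ w,
      act (Fin 2) W (substAlg 0 1 p) (opeFormal a b w) =
        subst binomLeft 0 1 (act (Fin 2) W p (pair a b w)) :=
  ⟨_, h.choose_spec.1, h.choose_spec.2, fun w => by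
    rw [h.opeFormal_eq, act_opeSeries h.choose_spec.1]⟩

theorem opeFormal_bddBelow (a b : VertexOperator ℂ W) (w : W) :
    ∃ N : ℤ, ∀ m, m 0 < N → opeFormal a b w m = 0 := by
  by_cases h : Compat a b
  · rw [h.opeFormal_eq]; exact toFormal_bddBelow _
  · refine ⟨0, fun m _ => ?_⟩
    rw [opeFormal, ope, dif_neg h]; simp

/-- The pole order of `Y_𝓔(a(x), x₀) b(x)` at `x₀ = 0` is bounded. -/
theorem exists_ope_eq_zero (a b : VertexOperator ℂ W) : ∃ N : ℤ, ∀ k < N, ope a b k = 0 := by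
  by_cases h : Compat a b
  · obtain ⟨p, hp, -, e⟩ := h.exists_ope
    obtain ⟨l, g, g₀, e', hg₀, hg⟩ := exists_eq_X_pow_mul_fin_two (substAlg 0 1 p)
      ((map_ne_zero_iff _ (substAlg_injective (by decide))).2 hp)
    -- The substituted series has no negative powers of `x₀`, so a pole can only come from the
    -- factor `x₀^l` of `p(x + x₀, x)`. This bound does not depend on `w`.
    refine ⟨-l, fun k hk => ?_⟩
    refine HVertexOperator.coeff_inj (funext fun n => LinearMap.ext fun w => ?_)
    have := act_cancel₂ (by decide) hg₀ hg (opeFormal_bddBelow a b w) (opeFormal_lineBdd a b w)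
      (K := -l) (fun m hm => ?_) ![k, n] (by simpa using hk)
    · simpa [opeFormal] using this
    · have h1 := congrFun (e w) (m + Pi.single 0 (l : ℤ))
      rwa [e', act_mul, act_X_pow, add_sub_cancel_right,
        subst_binomLeft_of_neg (by simp; omega)] at h1
  · exact ⟨0, fun k _ => by rw [ope, dif_neg h]⟩

theorem eq_of_act_eq {p : MvPolynomial (Fin 2) ℂ} (hp : p ≠ 0) {F G : (Fin 2 → ℤ) → W}
    (hF : ∃ N : ℤ, ∀ m, m 0 < N → F m = 0) (hF₁ : LineBdd 1 F)
    (hG : ∃ N : ℤ, ∀ m, m 0 < N → G m = 0) (hG₁ : LineBdd 1 G)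
    (h : act (Fin 2) W p F = act (Fin 2) W p G) : F = G := by
  obtain ⟨N, hN⟩ := hF
  obtain ⟨M, hM⟩ := hG
  refine sub_eq_zero.1 (eq_zero_of_act_eq_zero hp ⟨min N M, fun m hm => ?_⟩ (hF₁.sub hG₁) ?_)
  · rw [Pi.sub_apply, hN m (by omega), hM m (by omega), sub_zero]
  · rw [map_sub, h, sub_self]

theorem LowerTrunc.subst_lineBdd {F : (Fin 2 → ℤ) → W} (hF : LowerTrunc F) :
    LineBdd 1 (subst binomLeft 0 1 F) := by
  rw [← toFormal_shift ⟨F, hF⟩]; exact toFormal_lineBdd _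

theorem subst_bddBelow (F : (Fin 2 → ℤ) → W) :
    ∃ N : ℤ, ∀ m, m 0 < N → subst binomLeft 0 1 F m = 0 :=
  ⟨0, fun _ hm => subst_binomLeft_of_neg hm⟩

/-- If `∑ hᵢ(x₁, x₂) aᵢ(x₁) bᵢ(x₂) w` lies in `W((x₁, x₂))`, then
`∑ hᵢ(x + x₀, x) Y_𝓔(aᵢ(x), x₀) bᵢ(x) w` is obtained from it by the substitution
`x₁ = x + x₀`. -/
theorem sum_act_opeFormal {ι : Type*} (I : Finset ι) (a b : ι → VertexOperator ℂ W)
    (hab : ∀ i ∈ I, Compat (a i) (b i)) (q : ι → MvPolynomial (Fin 2) ℂ) (w : W)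
    (hH : LowerTrunc (∑ i ∈ I, act (Fin 2) W (q i) (pair (a i) (b i) w))) :
    ∑ i ∈ I, act (Fin 2) W (substAlg 0 1 (q i)) (opeFormal (a i) (b i) w) =
      subst binomLeft 0 1 (∑ i ∈ I, act (Fin 2) W (q i) (pair (a i) (b i) w)) := by
  classical
  choose! p hp hc e using fun i hi => (hab i hi).exists_ope
  have h01 : (0 : Fin 2) ≠ 1 := by decide
  have hP : substAlg (0 : Fin 2) 1 (∏ i ∈ I, p i) ≠ 0 :=
    (map_ne_zero_iff _ (substAlg_injective h01)).2 (Finset.prod_ne_zero_iff.2 hp)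
  have hb : (∃ N : ℤ, ∀ m, m 0 < N → (∑ i ∈ I, act (Fin 2) W (substAlg 0 1 (q i))
      (opeFormal (a i) (b i) w)) m = 0) := by
    refine Finset.sum_induction _ (fun F : (Fin 2 → ℤ) → W => ∃ N : ℤ, ∀ m, m 0 < N → F m = 0)
      ?_ ⟨0, fun _ _ => rfl⟩ fun i hi => ?_
    · rintro F G ⟨N, hN⟩ ⟨M, hM⟩
      refine ⟨min N M, fun m hm => ?_⟩
      rw [Pi.add_apply, hN m (by omega), hM m (by omega), add_zero]
    · obtain ⟨N, hN⟩ := opeFormal_bddBelow (a i) (b i) w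
      refine ⟨N, IsDown.act_eq_zero (D := {m | m 0 < N}) ?_ _ hN⟩
      intro m hm s
      have : (m - Pi.single s 1 : Fin 2 → ℤ) 0 ≤ m 0 := by
        simp only [Pi.sub_apply, Pi.single_apply]; split_ifs <;> omega
      exact lt_of_le_of_lt this hm
  have hl : LineBdd 1 (∑ i ∈ I, act (Fin 2) W (substAlg 0 1 (q i))
      (opeFormal (a i) (b i) w)) :=
    Finset.sum_induction _ (LineBdd 1) (fun _ _ => .add) (fun m => ⟨0, fun _ _ => rfl⟩)
      fun i _ => (opeFormal_lineBdd _ _ _).act _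
  refine eq_of_act_eq hP hb hl (subst_bddBelow _) hH.subst_lineBdd ?_
  rw [← subst_act isPascal_binomLeft h01 (hH.substitutable h01 _), map_sum, map_sum]
  have key : ∀ i ∈ I, Substitutable binomLeft 0 1
        (act (Fin 2) W (∏ i ∈ I, p i) (act (Fin 2) W (q i) (pair (a i) (b i) w))) ∧
      act (Fin 2) W (substAlg 0 1 (∏ i ∈ I, p i))
        (act (Fin 2) W (substAlg 0 1 (q i)) (opeFormal (a i) (b i) w)) =
      subst binomLeft 0 1
        (act (Fin 2) W (∏ i ∈ I, p i) (act (Fin 2) W (q i) (pair (a i) (b i) w))) := by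
    intro i hi
    have hs : Substitutable binomLeft 0 1 (act (Fin 2) W (p i) (pair (a i) (b i) w)) :=
      (clears_iff.1 (hc i hi) w).substitutable h01 _
    have hd : (∏ i ∈ I, p i) * q i = ((∏ j ∈ I.erase i, p j) * q i) * p i := by
      rw [← Finset.mul_prod_erase I p hi]; ring
    rw [← act_mul, ← act_mul, ← map_mul, hd, act_mul]
    refine ⟨hs.act isPascal_binomLeft h01 _, ?_⟩
    rw [subst_act isPascal_binomLeft h01 hs, map_mul, act_mul, e i hi]
  rw [Finset.sum_congr rfl fun i hi => (key i hi).2]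
  exact ((subst_sum I _ fun i hi => (key i hi).1).2).symm

theorem act_opeFormal {a b : VertexOperator ℂ W} (hab : Compat a b)
    (q : MvPolynomial (Fin 2) ℂ) (w : W) (hH : LowerTrunc (act (Fin 2) W q (pair a b w))) :
    act (Fin 2) W (substAlg 0 1 q) (opeFormal a b w) =
      subst binomLeft 0 1 (act (Fin 2) W q (pair a b w)) := by
  have := sum_act_opeFormal {()} (fun _ => a) (fun _ => b) (fun _ _ => hab) (fun _ => q) w
    (by simpa using hH)
  simpa using this

/-- Independence of the clearing polynomial: both series give the same result after multiplication
by `p(x + x₀, x)`, and this nonzero polynomial can be cancelled. -/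
theorem nthProd_eq_ope {p : MvPolynomial (Fin 2) ℂ} (hp : p ≠ 0) {a b : VertexOperator ℂ W}
    (h : Clears p a b) (n : ℤ) : nthProd p h n = ope a b (-n - 1) := by
  refine HVertexOperator.coeff_inj (funext fun k => LinearMap.ext fun w => ?_)
  have h01 : (0 : Fin 2) ≠ 1 := by decide
  have key : toFormal (opeSeries p h w) = opeFormal a b w := by
    refine eq_of_act_eq ((map_ne_zero_iff _ (substAlg_injective h01)).2 hp) (toFormal_bddBelow _)
      (toFormal_lineBdd _) (opeFormal_bddBelow _ _ _) (opeFormal_lineBdd _ _ _) ?_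
    rw [act_opeSeries hp, act_opeFormal ⟨p, hp, h⟩ _ _ (clears_iff.1 h w)]
  have h1 := coeff_nthProd h w ![-n - 1, k]
  have h2 := congrFun key ![-n - 1, k]
  simp only [opeFormal, Matrix.cons_val_zero, Matrix.cons_val_one] at h1 h2
  rw [show -(-n - 1) - 1 = n by ring] at h1
  rw [h1, ← h2]

end Pair

/-! ### Series with spectator variables -/

section Spread

open MvPolynomial (aeval X C rename)

variable {σ τ : Type*} [DecidableEq σ] [DecidableEq τ] {W : Type*} [AddCommGroup W] [Module ℂ W]

/-- The series `A · X(x_e) · B · w`, where the operators `A` and `B` involve the remaining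
variables. -/
def spread (e : τ → σ) (A B : (σ → ℤ) → Module.End ℂ W) (Φ : W → (τ → ℤ) → W) (w : W) :
    (σ → ℤ) → W := fun m => A m (Φ (B m w) (m ∘ e))

/-- The operator does not involve the variables in the image of `e`. -/
def IndepOf (e : τ → σ) (A : (σ → ℤ) → Module.End ℂ W) : Prop :=
  ∀ m d, A (Function.extend e d m) = A m

theorem indepOf_one (e : τ → σ) : IndepOf e (1 : (σ → ℤ) → Module.End ℂ W) := fun _ _ => rfl

theorem indepOf_coeff {e : τ → σ} {s : σ} (hs : ∀ t, e t ≠ s) (a : ℤ → VertexOperator ℂ W)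
    {s' : σ} (hs' : ∀ t, e t ≠ s') :
    IndepOf e (fun m : σ → ℤ => (HVertexOperator.coeff (a (m s')) (m s) : Module.End ℂ W)) := by
  intro m d
  simp only
  rw [Function.extend_apply' _ _ _ (by rintro ⟨t, ht⟩; exact hs' t ht),
    Function.extend_apply' _ _ _ (by rintro ⟨t, ht⟩; exact hs t ht)]

variable {e : τ → σ} (he : Function.Injective e) {A B : (σ → ℤ) → Module.End ℂ W}
  (hA : IndepOf e A) (hB : IndepOf e B)
include he hA hB

theorem restrict_spread (Φ : W → (τ → ℤ) → W) (w : W) (m : σ → ℤ) :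
    restrict e m (spread e A B Φ w) = fun d => A m (Φ (B m w) d) := by
  funext d
  simp only [restrict, spread, hA m d, hB m d]
  congr 2
  funext t
  exact he.extend_apply d m t

theorem act_spread (p : MvPolynomial τ ℂ) (Φ : W → (τ → ℤ) → W) (w : W) :
    act σ W (rename e p) (spread e A B Φ w) = spread e A B (fun w => act τ W p (Φ w)) w := by
  refine eq_of_restrict e he fun m => ?_
  rw [restrict_act e he, restrict_spread he hA hB, restrict_spread he hA hB, act_map]

theorem substitutable_spread {c : ℤ → ℤ → ℤ} {s t : τ} {Φ : W → (τ → ℤ) → W}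
    (hΦ : ∀ w, Substitutable c s t (Φ w)) (w : W) :
    Substitutable c (e s) (e t) (spread e A B Φ w) := by
  intro m
  refine (hΦ (B m w) (m ∘ e)).subset ?_
  rintro n ⟨h1, h2⟩
  refine ⟨h1, fun h => h2 ?_⟩
  have h3 : moved (e s) (e t) m n = Function.extend e (moved s t (m ∘ e) n) m := by
    rw [← moved_extend e he, extend_comp_self e he]
  have h4 := congrFun (restrict_spread he hA hB Φ w m) (moved s t (m ∘ e) n)
  rw [h3, show spread e A B Φ w (Function.extend e (moved s t (m ∘ e) n) m) = _ from h4, h, map_zero]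

theorem subst_spread {c : ℤ → ℤ → ℤ} {s t : τ} {Φ : W → (τ → ℤ) → W}
    (hΦ : ∀ w, Substitutable c s t (Φ w)) (w : W) :
    subst c (e s) (e t) (spread e A B Φ w) = spread e A B (fun w => subst c s t (Φ w)) w := by
  refine eq_of_restrict e he fun m => ?_
  rw [restrict_subst c e he, restrict_spread he hA hB, restrict_spread he hA hB,
    subst_map (A m) (hΦ _)]

end Spread

/-! ### Products inside words, families of operators, and composition of substitutions. -/

section ThreeVariables

open MvPolynomial (aeval X C rename)

variable {W : Type*} [AddCommGroup W] [Module ℂ W]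

/-- The relation defining `ope a b` persists when operators in other variables stand on both sides.
This requires a `p` that clears the pair for all vectors at once, since the vector on which `b` acts
is `B m w`. -/
theorem spread_ope {σ : Type*} [DecidableEq σ] {e : Fin 2 → σ} (he : Function.Injective e)
    {A B : (σ → ℤ) → Module.End ℂ W} (hA : IndepOf e A) (hB : IndepOf e B)
    {a b : VertexOperator ℂ W} {p : MvPolynomial (Fin 2) ℂ} (hp : p ≠ 0) (h : Clears p a b)
    (q : MvPolynomial σ ℂ) (w : W) :
    Substitutable binomLeft (e 0) (e 1) (act σ W (q * rename e p) (spread e A B (pair a b) w)) ∧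
    act σ W (substAlg (e 0) (e 1) (q * rename e p)) (spread e A B (opeFormal a b) w) =
      subst binomLeft (e 0) (e 1) (act σ W (q * rename e p) (spread e A B (pair a b) w)) := by
  have h01 : (0 : Fin 2) ≠ 1 := by decide
  have h1 : ∀ w, LowerTrunc (act (Fin 2) W p (pair a b w)) := clears_iff.1 h
  have h2 : ∀ w, Substitutable binomLeft 0 1 (act (Fin 2) W p (pair a b w)) :=
    fun w => (h1 w).substitutable h01 _
  have h3 := substitutable_spread he hA hB h2 w
  rw [act_mul, act_spread he hA hB]
  refine ⟨h3.act isPascal_binomLeft (he.ne h01) q, ?_⟩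
  rw [subst_act isPascal_binomLeft (he.ne h01) h3, map_mul, act_mul, ← rename_substAlg e he,
    act_spread he hA hB, subst_spread he hA hB h2]
  congr 2
  funext w
  exact act_opeFormal ⟨p, hp, h⟩ p w (h1 w)

theorem exists_eq_sum {σ τ : Type*} (s : σ) (e : τ → σ) (hcover : ∀ v, v = s ∨ ∃ t, e t = v)
    (P : MvPolynomial σ ℂ) :
    ∃ Q : Polynomial (MvPolynomial τ ℂ), P = ∑ i ∈ Q.support, X s ^ i * rename e (Q.coeff i) := by
  have : ∃ Q : Polynomial (MvPolynomial τ ℂ), P = Q.eval₂ (rename e : _ →ₐ[ℂ] _).toRingHom (X s) := by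
    induction P using MvPolynomial.induction_on with
    | C a => exact ⟨Polynomial.C (C a), by simp⟩
    | add p q hp hq =>
      obtain ⟨Q, rfl⟩ := hp
      obtain ⟨R, rfl⟩ := hq
      exact ⟨Q + R, by rw [Polynomial.eval₂_add]⟩
    | mul_X p u hp =>
      obtain ⟨Q, rfl⟩ := hp
      obtain rfl | ⟨t, rfl⟩ := hcover u
      · exact ⟨Q * Polynomial.X, by rw [Polynomial.eval₂_mul, Polynomial.eval₂_X]⟩
      · exact ⟨Q * Polynomial.C (X t), by rw [Polynomial.eval₂_mul, Polynomial.eval₂_C]; simp⟩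
  obtain ⟨Q, rfl⟩ := this
  refine ⟨Q, ?_⟩
  rw [Polynomial.eval₂_eq_sum, Polynomial.sum_def]
  exact Finset.sum_congr rfl fun i _ => mul_comm _ _

theorem restrict_act_sum {σ τ : Type*} [DecidableEq σ] [DecidableEq τ] {s : σ} {e : τ → σ}
    (hs : ∀ t, e t ≠ s) (he : Function.Injective e) (I : Finset ℕ)
    (q : ℕ → MvPolynomial τ ℂ) (F : (σ → ℤ) → W) (m : σ → ℤ) :
    restrict e m (act σ W (∑ i ∈ I, X s ^ i * rename e (q i)) F) =
      ∑ i ∈ I, act τ W (q i) (restrict e (m - Pi.single s (i : ℤ)) F) := by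
  funext d
  simp only [restrict, map_sum, LinearMap.sum_apply, Finset.sum_apply]
  refine Finset.sum_congr rfl fun i _ => ?_
  rw [act_mul, act_X_pow]
  have : Function.extend e d m - Pi.single s (i : ℤ) =
      Function.extend e d (m - Pi.single s (i : ℤ)) := by
    funext v
    by_cases hv : ∃ t, e t = v
    · obtain ⟨t, rfl⟩ := hv; simp [he.extend_apply, hs t]
    · rw [Pi.sub_apply, Function.extend_apply' _ _ _ hv, Function.extend_apply' _ _ _ hv,
        Pi.sub_apply]
  rw [this]
  exact congrFun (restrict_act e he _ _ F) d

/-- A family of series in the variables `x_e`, indexed by the exponent of `x_s`. -/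
def family {σ τ : Type*} (s : σ) (e : τ → σ) (f : ℤ → (τ → ℤ) → W) : (σ → ℤ) → W :=
  fun m => f (m s) (m ∘ e)

theorem restrict_family {σ τ : Type*} {s : σ} {e : τ → σ} (hs : ∀ t, e t ≠ s)
    (he : Function.Injective e) (f : ℤ → (τ → ℤ) → W) (m : σ → ℤ) :
    restrict e m (family s e f) = f (m s) := by
  funext d
  simp only [restrict, family]
  rw [Function.extend_apply' _ _ _ (by rintro ⟨t, ht⟩; exact hs t ht)]
  congr 1
  funext t
  exact he.extend_apply d m t

/-- The defining property of `Y_𝓔`, for families of operators with a further formal variable. -/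
theorem family_ope {σ : Type*} [DecidableEq σ] {s : σ} {e : Fin 2 → σ} (hs : ∀ t, e t ≠ s)
    (hcover : ∀ v, v = s ∨ ∃ t, e t = v) (he : Function.Injective e)
    {a b : ℤ → VertexOperator ℂ W} (hab : ∀ k, Compat (a k) (b k)) (w : W)
    (P : MvPolynomial σ ℂ)
    (hP : ∀ m, LowerTrunc (restrict e m (act σ W P (family s e fun k => pair (a k) (b k) w)))) :
    act σ W (substAlg (e 0) (e 1) P) (family s e fun k => opeFormal (a k) (b k) w) =
      subst binomLeft (e 0) (e 1) (act σ W P (family s e fun k => pair (a k) (b k) w)) := by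
  obtain ⟨Q, rfl⟩ := exists_eq_sum s e hcover P
  have h1 : substAlg (e 0) (e 1) (∑ i ∈ Q.support, X s ^ i * rename e (Q.coeff i)) =
      ∑ i ∈ Q.support, X s ^ i * rename e (substAlg 0 1 (Q.coeff i)) := by
    rw [map_sum]
    refine Finset.sum_congr rfl fun i _ => ?_
    rw [map_mul, map_pow, substAlg_X_ne (hs 0).symm, rename_substAlg e he]
  refine eq_of_restrict e he fun m => ?_
  have h4 := hP m
  rw [restrict_subst _ e he]
  rw [restrict_act_sum hs he] at h4 ⊢
  simp only [restrict_family hs he, Pi.sub_apply, Pi.single_eq_same] at h4 ⊢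
  -- The coefficient at a fixed power of `x_s` mixes finitely many members of the family, and only
  -- their sum is known to be bounded below. This is why the version for sums is needed.
  have h5 := sum_act_opeFormal Q.support (fun i => a (m s - i))
    (fun i => b (m s - i)) (fun i _ => hab _) (fun i => Q.coeff i) w h4
  refine Eq.trans ?_ h5
  rw [h1, restrict_act_sum hs he]
  simp only [restrict_family hs he, Pi.sub_apply, Pi.single_eq_same]

/-- The substituted series is not bounded below jointly in all variables, but its coefficient at
each fixed power of `x_s` is. -/
theorem LowerTrunc.restrict_subst {σ τ : Type*} [DecidableEq σ] {F : (σ → ℤ) → W}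
    (hF : LowerTrunc F) {s t : σ} (c : ℤ → ℤ → ℤ) (hst : s ≠ t) {e : τ → σ}
    (hs : ∀ i, e i ≠ s) (he : Function.Injective e) (m : σ → ℤ) :
    LowerTrunc (restrict e m (subst c s t F)) := by
  obtain ⟨N, hN⟩ := hF
  -- A nonzero term has `n ≥ N` and `d_t + m s - n ≥ N`, hence `d_t ≥ 2 * N - m s`; the other
  -- variables keep the bound `N`.
  refine ⟨min N (2 * N - m s), ?_⟩
  rintro d ⟨i, hi⟩
  have h0 : ∀ n, F (moved s t (Function.extend e d m) n) = 0 := by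
    intro n
    by_cases hn : n < N
    · exact hN _ ⟨s, by rwa [moved_s hst]⟩
    by_cases hi' : e i = t
    · refine hN _ ⟨t, ?_⟩
      rw [moved_t, ← hi', he.extend_apply,
        Function.extend_apply' _ _ _ (by rintro ⟨j, hj⟩; exact hs j hj)]
      omega
    · refine hN _ ⟨e i, ?_⟩
      rw [moved_ne (hs i) hi', he.extend_apply]
      omega
  simp [restrict, subst, h0]

/-- Write `n = k + i`. Then `C(a, n) C(n, k) = C(a, k) C(a - k, i)`, and the sum over `i` is the
Chu–Vandermonde identity for `(a - k) + b`. -/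
theorem sum_binomLeft (a b k j : ℤ) :
    ∑ n ∈ Finset.Icc 0 (k + j), binomLeft n k * binomLeft a n * binomLeft b (j + k - n) =
      binomLeft a k * binomLeft (a + b - k) j := by
  by_cases hk : 0 ≤ k
  swap
  · have : ∀ n, binomLeft n k = 0 := fun n => if_neg hk
    simp [this]
  by_cases hj : 0 ≤ j
  swap
  · have : binomLeft (a + b - k) j = 0 := if_neg hj
    rw [this, mul_zero]
    refine Finset.sum_eq_zero fun n hn => ?_
    rw [Finset.mem_Icc] at hn
    rw [binomLeft_eq_binomRight hn.1 k, binomRight, if_neg (by omega), zero_mul, zero_mul]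
  lift k to ℕ using hk
  lift j to ℕ using hj
  have h1 : binomLeft (a + b - k) j = ∑ ij ∈ Finset.HasAntidiagonal.antidiagonal j,
      Ring.choose (a - k) ij.1 * Ring.choose b ij.2 := by
    rw [binomLeft, if_pos (by omega), Int.toNat_natCast, ← Ring.add_choose_eq _ (Commute.all _ _)]
    congr 1; ring
  rw [h1, Finset.mul_sum]
  symm
  refine Finset.sum_of_injOn (fun ij : ℕ × ℕ => (k + ij.1 : ℤ)) ?_ ?_ ?_ ?_
  · rintro ⟨i, i'⟩ hi ⟨l, l'⟩ hl h
    simp only [Finset.mem_coe, Finset.HasAntidiagonal.mem_antidiagonal] at hi hl h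
    ext <;> simp only <;> omega
  · rintro ⟨i, i'⟩ hi
    simp only [Finset.mem_coe, Finset.HasAntidiagonal.mem_antidiagonal, Finset.mem_Icc] at hi ⊢
    omega
  · intro n hn hn'
    rw [Finset.mem_Icc] at hn
    have : n < k := by
      by_contra h
      refine hn' ⟨((n - k).toNat, (k + j - n).toNat), ?_, ?_⟩
      · simp only [Finset.mem_coe, Finset.HasAntidiagonal.mem_antidiagonal]; omega
      · simp only; omega
    rw [binomLeft_eq_binomRight hn.1 k, binomRight, if_neg (by omega), zero_mul, zero_mul]
  · rintro ⟨i, i'⟩ hi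
    rw [Finset.HasAntidiagonal.mem_antidiagonal] at hi
    simp only at hi ⊢
    have h2 := Ring.choose_add_smul_choose (a - k) i k
    rw [binomLeft, if_pos (by omega), binomLeft, if_pos (by omega), binomLeft, if_pos (by omega),
      binomLeft, if_pos (by omega)]
    rw [Int.toNat_natCast, show ((k : ℤ) + i).toNat = k + i by omega,
      show ((j : ℤ) + k - (k + i)).toNat = i' by omega, ← mul_assoc]
    congr 1
    have h3 := Ring.choose_smul_choose a (Nat.le_add_right k i)
    rw [Nat.add_sub_cancel_left, nsmul_eq_mul] at h3
    rw [← h3, ← Ring.choose_natCast]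
    push_cast; rfl

/-- Both sides are `F(x₀ + x₁ + x₂, x₁ + x₂, x₂)`. Since `F` is bounded below in all variables, each
coefficient is a finite sum, and the coefficients agree by `sum_binomLeft`. -/
theorem subst_subst_subst {F : (Fin 3 → ℤ) → W} (hF : LowerTrunc F) :
    subst binomLeft 0 1 (subst binomLeft 0 2 (subst binomLeft 1 2 F)) =
      subst binomLeft 1 2 (subst binomLeft 0 1 F) := by
  obtain ⟨N, hN⟩ := hF
  funext m
  set M := m 0 + m 1 + m 2 with hM
  -- The substitutions preserve the total degree `M`, so two exponents determine the third, and the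
  -- lower bounds confine both to the interval `I`.
  set f : ℤ → ℤ → W := fun a b => F ![a, b, M - a - b] with hf
  have hfa : ∀ a b, f a b ≠ 0 → a ∈ Finset.Icc N (M - 2 * N) ∧ b ∈ Finset.Icc N (M - 2 * N) := by
    intro a b h
    have h0 : N ≤ a := by
      by_contra h'; exact h (hN _ ⟨0, by simpa using h'⟩)
    have h1 : N ≤ b := by
      by_contra h'; exact h (hN _ ⟨1, by simpa using h'⟩)
    have h2 : N ≤ M - a - b := by
      by_contra h'; exact h (hN _ ⟨2, by simpa using h'⟩)
    simp only [Finset.mem_Icc]; omega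
  set I := Finset.Icc N (M - 2 * N) with hI
  have hL : subst binomLeft 0 1 (subst binomLeft 0 2 (subst binomLeft 1 2 F)) m =
      ∑ᶠ n : ℤ, ∑ a ∈ I, ∑ b ∈ I,
        (binomLeft n (m 0) * binomLeft a n * binomLeft b (m 1 + m 0 - n)) • f a b := by
    simp only [subst]
    refine finsum_congr fun n => ?_
    have h1 : ∀ a, moved 0 2 (moved 0 1 m n) a = ![a, m 1 + m 0 - n, m 2 + n - a] := by
      intro a; funext i; fin_cases i <;> simp [moved]
    have h2 : ∀ a b, moved 1 2 (moved 0 2 (moved 0 1 m n) a) b = ![a, b, M - a - b] := by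
      intro a b; rw [h1]; funext i; fin_cases i <;> simp [moved]; omega
    have h3 : moved (0 : Fin 3) 1 m n 0 = n := by simp [moved]
    have h4 : ∀ a, (∑ᶠ b : ℤ, binomLeft b (moved 0 2 (moved 0 1 m n) a 1) •
        F (moved 1 2 (moved 0 2 (moved 0 1 m n) a) b)) =
        ∑ b ∈ I, binomLeft b (m 1 + m 0 - n) • f a b := by
      intro a
      simp only [h2]
      rw [h1]
      refine finsum_eq_sum_of_support_subset _ fun b hb => (hfa a b fun h => hb ?_).2
      simp only [hf] at h; simp [h]
    simp only [h4, h3]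
    rw [finsum_eq_sum_of_support_subset (s := I)]
    · rw [Finset.smul_sum]
      refine Finset.sum_congr rfl fun a _ => ?_
      rw [Finset.smul_sum, Finset.smul_sum]
      refine Finset.sum_congr rfl fun b _ => ?_
      rw [smul_smul, smul_smul, mul_assoc]
    · intro a ha
      by_contra h
      refine ha ?_
      simp only
      rw [Finset.sum_eq_zero, smul_zero]
      intro b _
      by_cases hab : f a b = 0
      · rw [hab, smul_zero]
      · exact absurd (hfa a b hab).1 h
  have hR : subst binomLeft 1 2 (subst binomLeft 0 1 F) m =
      ∑ a ∈ I, ∑ b ∈ I, (binomLeft a (m 0) * binomLeft (a + b - m 0) (m 1)) • f a b := by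
    simp only [subst]
    have h1 : ∀ n a, moved 0 1 (moved 1 2 m n) a = ![a, n + m 0 - a, M - a - (n + m 0 - a)] := by
      intro n a; funext i; fin_cases i <;> simp [moved]; omega
    have h2 : ∀ n, moved 1 2 m n 0 = m 0 := by intro n; simp [moved]
    have h3 : ∀ n, (∑ᶠ a : ℤ, binomLeft a (moved 1 2 m n 0) • F (moved 0 1 (moved 1 2 m n) a)) =
        ∑ a ∈ I, binomLeft a (m 0) • f a (n + m 0 - a) := by
      intro n
      simp only [h1, h2]
      refine finsum_eq_sum_of_support_subset _ fun a ha => (hfa a (n + m 0 - a) fun h => ha ?_).1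
      simp only [hf] at h; simp only [h, smul_zero]
    simp only [h3, Finset.smul_sum]
    rw [finsum_sum_comm]
    · refine Finset.sum_congr rfl fun a _ => ?_
      rw [← finsum_comp_equiv (Equiv.addRight (a - m 0))]
      have h4 : ∀ b, binomLeft (Equiv.addRight (a - m 0) b) (m 1) • binomLeft a (m 0) •
          f a (Equiv.addRight (a - m 0) b + m 0 - a) =
          (binomLeft a (m 0) * binomLeft (a + b - m 0) (m 1)) • f a b := by
        intro b
        rw [smul_smul, mul_comm, Equiv.coe_addRight]
        simp only
        rw [ show b + (a - m 0) + m 0 - a = b by ring,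
          show b + (a - m 0) = a + b - m 0 by ring]
      simp only [h4]
      refine finsum_eq_sum_of_support_subset _ fun b hb => (hfa a b fun h => hb ?_).2
      simp [h]
    · intro a _
      refine (I.finite_toSet.image (· - m 0 + a)).subset fun n hn => ?_
      have := (hfa a (n + m 0 - a) fun h => hn (by simp [h])).2
      exact ⟨n + m 0 - a, this, by simp only; ring⟩
  rw [hL, hR, finsum_eq_sum_of_support_subset (s := Finset.Icc 0 (m 0 + m 1))]
  · rw [Finset.sum_comm]
    refine Finset.sum_congr rfl fun a _ => ?_
    rw [Finset.sum_comm]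
    refine Finset.sum_congr rfl fun b _ => ?_
    rw [← Finset.sum_smul, sum_binomLeft]
  · intro n hn
    by_contra h
    refine hn (Finset.sum_eq_zero fun a _ => Finset.sum_eq_zero fun b _ => ?_)
    rw [Finset.coe_Icc, Set.mem_Icc, not_and_or] at h
    rcases h with h | h
    · rw [show binomLeft a n = 0 from if_neg h, mul_zero, zero_mul, zero_smul]
    · rw [show binomLeft b (m 1 + m 0 - n) = 0 from if_neg (by omega), mul_zero, zero_smul]

end ThreeVariables

/-! ### The vertex operator map on closed quasi compatible subspaces -/

section Assoc

open MvPolynomial (aeval X C rename)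

variable {V W : Type*} [AddCommGroup V] [Module ℂ V] [AddCommGroup W] [Module ℂ W]

/-- With `n = m 0 + j` the sum runs over exponents `n ≥ m 0`; the terms with `n < m 0` have
coefficient zero in `binomRight`. -/
theorem assocLeft_eq (YW : V →ₗ[ℂ] VertexOperator ℂ W) (u v : V) (w : W) :
    assocLeft YW u v w = subst binomRight 0 1 (pair (YW u) (YW v) w) := by
  funext m
  simp only [assocLeft, subst]
  have hinj : Function.Injective fun j : ℕ => m 0 + (j : ℤ) := fun i j h => by
    simpa using h
  set f : ℤ → W := fun n => binomRight n (m 0) • pair (YW u) (YW v) w (moved 0 1 m n) with hf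
  have h1 : ∀ j : ℕ, (Ring.choose (m 0 + j) j : ℤ) • HVertexOperator.coeff (YW u) (m 0 + j)
      (HVertexOperator.coeff (YW v) (m 1 - j) w) = f (m 0 + j) := by
    intro j
    simp only [hf, binomRight]
    rw [if_pos (by omega), show (m 0 + (j : ℤ) - m 0).toNat = j by omega]
    simp only [pair, moved_t, moved_s (show (0 : Fin 2) ≠ 1 by decide)]
    rw [show m 1 + m 0 - (m 0 + (j : ℤ)) = m 1 - j by ring]
  rw [finsum_congr h1, ← finsum_mem_range hinj, ← finsum_mem_univ f]
  refine finsum_mem_inter_support_eq' _ _ _ fun n hn => ?_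
  refine ⟨fun _ => Set.mem_univ _, fun _ => ?_⟩
  have : m 0 ≤ n := by
    by_contra h
    exact hn (by simp only [hf, binomRight, if_neg h, zero_smul])
  exact ⟨(n - m 0).toNat, by simp only; omega⟩

/-- The series lies in `W((x_s))((x_t))`, as far as the variables `x_s` and `x_t` are concerned. -/
def Nested {σ : Type*} (s t : σ) (F : (σ → ℤ) → W) : Prop :=
  (∃ N : ℤ, ∀ m, m t < N → F m = 0) ∧ ∀ k : ℤ, ∃ N : ℤ, ∀ m, m t ≤ k → m s < N → F m = 0

theorem Nested.act {σ : Type*} [DecidableEq σ] {s t : σ} {F : (σ → ℤ) → W} (hF : Nested s t F)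
    (p : MvPolynomial σ ℂ) : Nested s t (act σ W p F) := by
  have hle : ∀ (m : σ → ℤ) (u v : σ), (m - Pi.single v 1 : σ → ℤ) u ≤ m u := by
    intro m u v
    simp only [Pi.sub_apply, Pi.single_apply]; split_ifs <;> omega
  obtain ⟨⟨N, hN⟩, h⟩ := hF
  refine ⟨⟨N, IsDown.act_eq_zero (D := {m | m t < N})
    (fun m hm v => lt_of_le_of_lt (hle m t v) hm) p hN⟩, fun k => ?_⟩
  obtain ⟨M, hM⟩ := h k
  refine ⟨M, fun m h1 h2 => IsDown.act_eq_zero (D := {m | m t ≤ k ∧ m s < M})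
    (fun m hm v => ⟨(hle m t v).trans hm.1, lt_of_le_of_lt (hle m s v) hm.2⟩) p
    (fun m hm => hM m hm.1 hm.2) m ⟨h1, h2⟩⟩

theorem Nested.sub {σ : Type*} {s t : σ} {F G : (σ → ℤ) → W} (hF : Nested s t F)
    (hG : Nested s t G) : Nested s t (F - G) := by
  obtain ⟨⟨N, hN⟩, h⟩ := hF
  obtain ⟨⟨N', hN'⟩, h'⟩ := hG
  refine ⟨⟨min N N', fun m hm => ?_⟩, fun k => ?_⟩
  · rw [Pi.sub_apply, hN m (by omega), hN' m (by omega), sub_zero]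
  · obtain ⟨M, hM⟩ := h k
    obtain ⟨M', hM'⟩ := h' k
    exact ⟨min M M', fun m h1 h2 => by
      rw [Pi.sub_apply, hM m h1 (by omega), hM' m h1 (by omega), sub_zero]⟩

theorem nested_pair (a b : VertexOperator ℂ W) (w : W) : Nested 0 1 (pair a b w) := by
  obtain ⟨N, hN⟩ := coeff_bddBelow b w
  refine ⟨⟨N, fun m hm => by rw [pair, hN _ hm, map_zero]⟩, fun k => ?_⟩
  choose M hM using fun q => coeff_bddBelow a (HVertexOperator.coeff b q w)
  obtain ⟨M', hM'⟩ := ((Finset.Icc N k).image M).bddBelow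
  refine ⟨M', fun m h1 h2 => ?_⟩
  by_cases h : m 1 < N
  · rw [pair, hN _ h, map_zero]
  · exact hM _ _ (lt_of_lt_of_le h2 (hM' (Finset.mem_coe.2 (Finset.mem_image_of_mem _
      (Finset.mem_Icc.2 ⟨by omega, h1⟩)))))

theorem Nested.subst_binomRight {F : (Fin 2 → ℤ) → W} (hF : Nested 0 1 F) :
    Nested 0 1 (subst binomRight 0 1 F) := by
  have h01 : (0 : Fin 2) ≠ 1 := by decide
  obtain ⟨⟨N, hN⟩, h⟩ := hF
  refine ⟨⟨N, fun m hm => ?_⟩, fun k => ?_⟩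
  · have : ∀ n, binomRight n (m 0) • F (moved 0 1 m n) = 0 := by
      intro n
      by_cases hn : m 0 ≤ n
      · rw [hN _ (by rw [moved_t]; omega), smul_zero]
      · rw [binomRight, if_neg hn, zero_smul]
    simp [subst, this]
  · obtain ⟨M, hM⟩ := h k
    refine ⟨M - (k - N), fun m h1 h2 => ?_⟩
    have : ∀ n, binomRight n (m 0) • F (moved 0 1 m n) = 0 := by
      intro n
      by_cases hn : m 0 ≤ n
      · by_cases hn' : m 1 + m 0 - n < N
        · rw [hN _ (by rw [moved_t]; omega), smul_zero]
        · rw [hM _ (by rw [moved_t]; omega) (by rw [moved_s h01]; omega), smul_zero]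
      · rw [binomRight, if_neg hn, zero_smul]
    simp [subst, this]

theorem nested_assocLeft (YW : V →ₗ[ℂ] VertexOperator ℂ W) (u v : V) (w : W) :
    Nested 0 1 (assocLeft YW u v w) := by
  rw [assocLeft_eq]; exact (nested_pair _ _ _).subst_binomRight

theorem nested_assocRight (Y : V →ₗ[ℂ] VertexOperator ℂ V) (YW : V →ₗ[ℂ] VertexOperator ℂ W)
    (u v : V) (w : W) : Nested 1 0 (assocRight Y YW u v w) := by
  obtain ⟨N, hN⟩ := coeff_bddBelow (Y u) v
  refine ⟨⟨N, fun m hm => by rw [assocRight, hN _ hm]; simp⟩, fun k => ?_⟩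
  choose M hM using fun q => coeff_bddBelow (YW (HVertexOperator.coeff (Y u) q v)) w
  obtain ⟨M', hM'⟩ := ((Finset.Icc N k).image M).bddBelow
  refine ⟨M', fun m h1 h2 => ?_⟩
  by_cases h : m 0 < N
  · rw [assocRight, hN _ h]; simp
  · exact hM _ _ (lt_of_lt_of_le h2 (hM' (Finset.mem_coe.2 (Finset.mem_image_of_mem _
      (Finset.mem_Icc.2 ⟨by omega, h1⟩)))))

/-- The multiplier is invertible up to `(x₀ + x₁)^l` in both domains, because `P` has lowest
coefficient `g₀(x₂) ≠ 0` in `x₀, x₁`. But `L` lies in `W((x₀))((x₁))` and `R` in `W((x₁))((x₀))`, as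
far as `x₀, x₁` are concerned, so `P` can be cancelled from the difference only after both have been
placed in one domain. This is achieved by the bounds on `G`. -/
theorem act_add_pow_cancel {l : ℕ} {P : MvPolynomial (Fin 3) ℂ} {g₀ : Polynomial ℂ}
    (hg₀ : g₀ ≠ 0) (hP : setZero 0 (setZero 1 P) = Polynomial.aeval (X 2) g₀)
    {L R G : (Fin 3 → ℤ) → W} (hL : Nested 0 1 L) (hL₂ : LineBdd 2 L) (hR : Nested 1 0 R)
    (hR₂ : LineBdd 2 R) (hG : ∀ m, m 0 < 0 ∨ m 1 < 0 → G m = 0)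
    (eL : act (Fin 3) W (X 0 ^ l * X 1 ^ l * P * (X 0 + X 1) ^ l) L = G)
    (eR : act (Fin 3) W (X 0 ^ l * X 1 ^ l * P * (X 0 + X 1) ^ l) R = G) :
    act (Fin 3) W ((X 0 + X 1) ^ l) L = act (Fin 3) W ((X 0 + X 1) ^ l) R := by
  have h01 : (0 : Fin 3) ≠ 1 := by decide
  have h02 : (0 : Fin 3) ≠ 2 := by decide
  have h12 : (1 : Fin 3) ≠ 2 := by decide
  have hP' : setZero 1 (setZero 0 P) = Polynomial.aeval (X 2) g₀ := by
    rw [← hP, ← AlgHom.comp_apply, ← AlgHom.comp_apply]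
    refine DFunLike.congr_fun (MvPolynomial.algHom_ext fun u => ?_) P
    fin_cases u <;> simp [setZero]
  set L' := act (Fin 3) W ((X 0 + X 1) ^ l) L with hL'
  set R' := act (Fin 3) W ((X 0 + X 1) ^ l) R with hR'
  have key : ∀ {F : (Fin 3 → ℤ) → W}, act (Fin 3) W (X 0 ^ l * X 1 ^ l * P) F = G →
      ∀ m, act (Fin 3) W P F m = G (m + Pi.single 0 (l : ℤ) + Pi.single 1 (l : ℤ)) := by
    intro F hF m
    rw [← hF, act_mul, act_mul, act_X_pow, act_X_pow]
    rw [add_sub_right_comm, add_sub_cancel_right, add_sub_cancel_right]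
  have eL' := key (F := L') (by rw [hL', ← act_mul, eL])
  have eR' := key (F := R') (by rw [hR', ← act_mul, eR])
  have hLn : Nested 0 1 L' := hL.act _
  have hRn : Nested 1 0 R' := hR.act _
  have hL0 : ∀ m, m 0 < -(l : ℤ) → L' m = 0 :=
    act_cancel₃ h01 h02 h12 hg₀ hP hLn.1 hLn.2 (hL₂.act _) fun m hm => by
      rw [eL']; exact hG _ (Or.inl (by simp; omega))
  -- Cancelling `P` in the domain of `R'` transfers the bound in `x₁` from `G`. With the bound in
  -- `x₀` it already has, `R'` then also lies in the domain of `L'`.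
  have hR1 : ∀ m, m 1 < -(l : ℤ) → R' m = 0 :=
    act_cancel₃ h01.symm h12 h02 hg₀ hP' hRn.1 hRn.2 (hR₂.act _) fun m hm => by
      rw [eR']; exact hG _ (Or.inr (by simp; omega))
  have hR0 : Nested 0 1 R' := by
    obtain ⟨N, hN⟩ := hRn.1
    exact ⟨⟨_, hR1⟩, fun _ => ⟨N, fun m _ => hN m⟩⟩
  have hD := hLn.sub hR0
  funext m
  refine sub_eq_zero.1 (act_cancel₃ (F := L' - R') h01 h02 h12 hg₀ hP hD.1 hD.2
    ((hL₂.act _).sub (hR₂.act _)) (K := m 0 + 1) (fun m _ => ?_) m (by omega))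
  rw [map_sub, Pi.sub_apply, eL', eR', sub_self]

/-- The polynomial `p(x₁, x₂) p(x₁, x₃) p(x₂, x₃)`. -/
def triplePoly (p : MvPolynomial (Fin 2) ℂ) : MvPolynomial (Fin 3) ℂ :=
  rename ![0, 1] p * rename ![0, 2] p * rename ![1, 2] p

/-- The variables become `x₀ + x₁ + x₂`, `x₁ + x₂`, `x₂`, with pairwise differences `x₀`, `x₀ + x₁`,
`x₁`. Each factor contributes the `l`-th power of its difference times a copy of `g`, and at `x₀ =
x₁ = 0` each copy reduces to `g₀(x₂)`; hence the cube. -/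
theorem substAlg_triplePoly {p g : MvPolynomial (Fin 2) ℂ} {l : ℕ} {g₀ : Polynomial ℂ}
    (e : substAlg 0 1 p = X 0 ^ l * g) (hg : setZero 0 g = Polynomial.aeval (X 1) g₀) :
    ∃ P : MvPolynomial (Fin 3) ℂ, setZero 0 (setZero 1 P) = Polynomial.aeval (X 2) (g₀ ^ 3) ∧
      substAlg (1 : Fin 3) 2 (substAlg 0 1 (triplePoly p)) =
        X 0 ^ l * X 1 ^ l * P * (X 0 + X 1) ^ l := by
  have h1 : substAlg (1 : Fin 3) 2 (substAlg 0 1 (rename ![0, 1] p)) =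
      X 0 ^ l * aeval ![X 0, X 1 + X 2] g := by
    have : substAlg (1 : Fin 3) 2 (substAlg 0 1 (rename ![0, 1] p)) =
        aeval ![X 0, X 1 + X 2] (substAlg 0 1 p) := by
      simp only [← AlgHom.comp_apply]
      refine DFunLike.congr_fun (MvPolynomial.algHom_ext fun u => ?_) p
      fin_cases u <;> simp [substAlg]
    rw [this, e, map_mul, map_pow]; simp
  have h2 : substAlg (1 : Fin 3) 2 (substAlg 0 1 (rename ![0, 2] p)) =
      (X 0 + X 1) ^ l * aeval ![X 0 + X 1, X 2] g := by
    have : substAlg (1 : Fin 3) 2 (substAlg 0 1 (rename ![0, 2] p)) =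
        aeval ![X 0 + X 1, X 2] (substAlg 0 1 p) := by
      simp only [← AlgHom.comp_apply]
      refine DFunLike.congr_fun (MvPolynomial.algHom_ext fun u => ?_) p
      fin_cases u <;> simp [substAlg, add_assoc]
    rw [this, e, map_mul, map_pow]; simp
  have h3 : substAlg (1 : Fin 3) 2 (substAlg 0 1 (rename ![1, 2] p)) =
      X 1 ^ l * aeval ![X 1, X 2] g := by
    have : substAlg (1 : Fin 3) 2 (substAlg 0 1 (rename ![1, 2] p)) =
        aeval ![X 1, X 2] (substAlg 0 1 p) := by
      simp only [← AlgHom.comp_apply]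
      refine DFunLike.congr_fun (MvPolynomial.algHom_ext fun u => ?_) p
      fin_cases u <;> simp [substAlg]
    rw [this, e, map_mul, map_pow]; simp
  have h4 : ∀ f : Fin 2 → MvPolynomial (Fin 3) ℂ, setZero 0 (setZero 1 (f 0)) = 0 →
      setZero 0 (setZero 1 (f 1)) = X 2 →
      setZero 0 (setZero 1 (aeval f g)) = Polynomial.aeval (X 2) g₀ := by
    intro f hf0 hf1
    have h5 : setZero 0 (setZero 1 (aeval f g)) = aeval ![0, X 2] (setZero 0 g) := by
      simp only [← AlgHom.comp_apply]
      refine DFunLike.congr_fun (MvPolynomial.algHom_ext fun u => ?_) g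
      fin_cases u
      · simp [setZero_X_self, hf0]
      · simp [setZero_X_ne, hf1]
    rw [h5, hg, ← Polynomial.aeval_algHom_apply]
    simp
  refine ⟨aeval ![X 0, X 1 + X 2] g * aeval ![X 0 + X 1, X 2] g * aeval ![X 1, X 2] g, ?_, ?_⟩
  · rw [map_mul, map_mul, map_mul, map_mul, h4, h4, h4, map_pow]
    · ring
    all_goals simp [setZero_X_self, setZero_X_ne]
  · rw [triplePoly, map_mul, map_mul, map_mul, map_mul, h1, h2, h3]; ring

/-- The series `a(x₁) b(x₂) c(x₃) w`. -/
def triple (a b c : VertexOperator ℂ W) (w : W) : (Fin 3 → ℤ) → W := fun m =>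
  HVertexOperator.coeff a (m 0) (HVertexOperator.coeff b (m 1) (HVertexOperator.coeff c (m 2) w))

/-- The product of `a` and `b` is formed with `c` as a spectator. Its coefficients in `x₀` are then
a family of operators to be multiplied with `c`, to which `family_ope` applies. -/
theorem act_ope_ope_left {a b c : VertexOperator ℂ W} {p : MvPolynomial (Fin 2) ℂ} (hp : p ≠ 0)
    (hab : Clears p a b) (hc : ∀ k, Compat (ope a b k) c) (w : W)
    (hF : LowerTrunc (act (Fin 3) W (triplePoly p) (triple a b c w))) :
    act (Fin 3) W (substAlg 1 2 (substAlg 0 1 (triplePoly p)))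
        (fun m => HVertexOperator.coeff (ope (ope a b (m 0)) c (m 1)) (m 2) w) =
      subst binomLeft 1 2 (subst binomLeft 0 1 (act (Fin 3) W (triplePoly p) (triple a b c w))) := by
  have he : Function.Injective ![(0 : Fin 3), 1] := by decide
  have he' : Function.Injective ![(1 : Fin 3), 2] := by decide
  have h1 := (spread_ope he (indepOf_one _)
    (indepOf_coeff (s := 2) (s' := 2) (by decide) (fun _ => c) (by decide)) hp hab
    (rename ![0, 2] p * rename ![1, 2] p) w).2
  have hP : rename ![0, 2] p * rename ![1, 2] p * rename ![0, 1] p = triplePoly p := by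
    rw [triplePoly]; ring
  rw [hP] at h1
  have h2 := family_ope (s := 0) (by decide) (by decide) he' (a := ope a b) (b := fun _ => c) hc w
    (substAlg 0 1 (triplePoly p)) ?_
  · exact h2.trans (congrArg _ h1)
  · intro m
    refine (congrArg (fun F => LowerTrunc (restrict ![1, 2] m F)) h1).mpr ?_
    exact hF.restrict_subst _ (by decide) (by decide) he' m

/-- Mirror image of the preceding argument: `b` and `c` are multiplied with `a` as a spectator on
the left, and the exponent of `x₁` labels the family. -/
theorem act_ope_ope_right {a b c : VertexOperator ℂ W} {p : MvPolynomial (Fin 2) ℂ} (hp : p ≠ 0)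
    (hbc : Clears p b c) (ha : ∀ k, Compat a (ope b c k)) (w : W)
    (hF : LowerTrunc (act (Fin 3) W (triplePoly p) (triple a b c w))) :
    act (Fin 3) W (substAlg 0 2 (substAlg 1 2 (triplePoly p)))
        (fun m => HVertexOperator.coeff (ope a (ope b c (m 1)) (m 0)) (m 2) w) =
      subst binomLeft 0 2 (subst binomLeft 1 2 (act (Fin 3) W (triplePoly p) (triple a b c w))) := by
  have he : Function.Injective ![(1 : Fin 3), 2] := by decide
  have he' : Function.Injective ![(0 : Fin 3), 2] := by decide
  have h1 := (spread_ope he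
    (indepOf_coeff (s := 0) (s' := 0) (by decide) (fun _ => a) (by decide)) (indepOf_one _) hp hbc
    (rename ![0, 1] p * rename ![0, 2] p) w).2
  rw [show rename ![0, 1] p * rename ![0, 2] p * rename ![1, 2] p = triplePoly p from rfl] at h1
  have h2 := family_ope (s := 1) (by decide) (by decide) he' (a := fun _ => a) (b := ope b c) ha w
    (substAlg 1 2 (triplePoly p)) ?_
  · exact h2.trans (congrArg _ h1)
  · intro m
    refine (congrArg (fun F => LowerTrunc (restrict ![0, 2] m F)) h1).mpr ?_
    exact hF.restrict_subst _ (by decide) (by decide) he' m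

end Assoc

/-! ### The nonlocal vertex algebra structure and the quasi module. -/

section Structure

open MvPolynomial (aeval X C rename)

variable {V W : Type*} [AddCommGroup V] [Module ℂ V] [AddCommGroup W] [Module ℂ W]

/-- A common clearing polynomial `p₁ p₂` makes both sides solutions of one equation. Linearity in
the first and in the second operator are the two uses, since `pair` is bilinear. -/
theorem ope_linear {a a₁ a₂ b b₁ b₂ : VertexOperator ℂ W} (h : Compat a b) (h₁ : Compat a₁ b₁)
    (h₂ : Compat a₂ b₂) (c : ℂ) (e : ∀ w, pair a b w = c • pair a₁ b₁ w + pair a₂ b₂ w) (k : ℤ) :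
    ope a b k = c • ope a₁ b₁ k + ope a₂ b₂ k := by
  have h01 : (0 : Fin 2) ≠ 1 := by decide
  obtain ⟨p₁, hp₁, hc₁⟩ := h₁
  obtain ⟨p₂, hp₂, hc₂⟩ := h₂
  have hp : p₁ * p₂ ≠ 0 := mul_ne_zero hp₁ hp₂
  refine HVertexOperator.coeff_inj (funext fun n => LinearMap.ext fun w => ?_)
  have l₁ := clears_iff.1 (hc₁.dvd (Dvd.intro p₂ rfl)) w
  have l₂ := clears_iff.1 (hc₂.dvd (Dvd.intro_left p₁ rfl)) w
  have el : act (Fin 2) W (p₁ * p₂) (pair a b w) = c • act (Fin 2) W (p₁ * p₂) (pair a₁ b₁ w) +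
      act (Fin 2) W (p₁ * p₂) (pair a₂ b₂ w) := by rw [e, map_add, map_smul]
  have l : LowerTrunc (act (Fin 2) W (p₁ * p₂) (pair a b w)) := by
    rw [el]; exact (l₁.smul c).add l₂
  have key : opeFormal a b w = c • opeFormal a₁ b₁ w + opeFormal a₂ b₂ w := by
    obtain ⟨N₁, hN₁⟩ := opeFormal_bddBelow a₁ b₁ w
    obtain ⟨N₂, hN₂⟩ := opeFormal_bddBelow a₂ b₂ w
    refine eq_of_act_eq ((map_ne_zero_iff _ (substAlg_injective h01)).2 hp)
      (opeFormal_bddBelow _ _ _) (opeFormal_lineBdd _ _ _) ⟨min N₁ N₂, fun m hm => ?_⟩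
      (((opeFormal_lineBdd _ _ _).smul c).add (opeFormal_lineBdd _ _ _)) ?_
    · simp [hN₁ m (by omega), hN₂ m (by omega)]
    · rw [map_add, map_smul, act_opeFormal h _ _ l, act_opeFormal ⟨p₁, hp₁, hc₁⟩ _ _ l₁,
        act_opeFormal ⟨p₂, hp₂, hc₂⟩ _ _ l₂, el,
        subst_add ((l₁.smul c).substitutable h01 _) (l₂.substitutable h01 _),
        subst_smul (l₁.substitutable h01 _)]
  have := congrFun key ![k, n]
  simpa [opeFormal] using this

theorem ope_eq_zero {a b : VertexOperator ℂ W} (h : Compat a b) (e : ∀ w, pair a b w = 0) (k : ℤ) :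
    ope a b k = 0 := by
  -- With the scalar `-1` linearity reads `ope = -ope + ope`.
  simpa using ope_linear h h h (-1) (fun w => by simp [e]) k

theorem pair_idOp_left (b : VertexOperator ℂ W) (w : W) (m : Fin 2 → ℤ) :
    pair (idOp W) b w m = if m 0 = 0 then HVertexOperator.coeff b (m 1) w else 0 := by
  rw [pair, coeff_idOp]; split_ifs <;> simp

theorem pair_idOp_right (a : VertexOperator ℂ W) (w : W) (m : Fin 2 → ℤ) :
    pair a (idOp W) w m = if m 1 = 0 then HVertexOperator.coeff a (m 0) w else 0 := by
  rw [pair, coeff_idOp]; split_ifs <;> simp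

theorem lowerTrunc_pair_idOp_left (b : VertexOperator ℂ W) (w : W) :
    LowerTrunc (pair (idOp W) b w) := by
  obtain ⟨N, hN⟩ := coeff_bddBelow b w
  refine ⟨min N 0, fun m hm => ?_⟩
  rw [Fin.exists_fin_two] at hm
  rw [pair_idOp_left]
  split_ifs with h
  · exact hN _ (by omega)
  · rfl

theorem lowerTrunc_pair_idOp_right (a : VertexOperator ℂ W) (w : W) :
    LowerTrunc (pair a (idOp W) w) := by
  obtain ⟨N, hN⟩ := coeff_bddBelow a w
  refine ⟨min N 0, fun m hm => ?_⟩
  rw [Fin.exists_fin_two] at hm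
  rw [pair_idOp_right]
  split_ifs with h
  · exact hN _ (by omega)
  · rfl

theorem opeFormal_eq_of_lowerTrunc {a b : VertexOperator ℂ W} {w : W}
    (h : ∀ w, LowerTrunc (pair a b w)) :
    opeFormal a b w = subst binomLeft 0 1 (pair a b w) := by
  have hc : Compat a b := ⟨1, one_ne_zero, clears_iff.2 fun w => by rw [act_one]; exact h w⟩
  have := act_opeFormal hc 1 w (by rw [act_one]; exact h w)
  rwa [map_one, act_one, act_one] at this

theorem ope_idOp_left (b : VertexOperator ℂ W) (k : ℤ) :
    ope (idOp W) b k = if k = 0 then b else 0 := by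
  refine HVertexOperator.coeff_inj (funext fun n => LinearMap.ext fun w => ?_)
  have h := congrFun (opeFormal_eq_of_lowerTrunc (w := w) (lowerTrunc_pair_idOp_left b)) ![k, n]
  simp only [opeFormal, Matrix.cons_val_zero, Matrix.cons_val_one] at h
  rw [h, subst, finsum_eq_single _ 0]
  · rw [pair_idOp_left, moved_s (by decide), moved_t, if_pos rfl]
    simp only [Matrix.cons_val_zero, Matrix.cons_val_one]
    by_cases h0 : k = 0
    · subst h0; simp [binomLeft]
    · rw [if_neg h0]
      have hb : binomLeft 0 k = 0 := by
        rw [binomLeft]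
        split_ifs with h1
        · exact choose_eq_zero_of_lt le_rfl (by omega)
        · rfl
      rw [hb, zero_smul]; simp
  · intro i hi
    rw [pair_idOp_left, moved_s (by decide), if_neg hi, smul_zero]

/-- No polynomial is needed to clear the pair, so the product is `a(x + x₀)`: it has no negative
powers of `x₀`, and at `x₀ = 0` it is `a(x)`. -/
theorem ope_idOp_right (a : VertexOperator ℂ W) {k : ℤ} (hk : k ≤ 0) :
    ope a (idOp W) k = if k = 0 then a else 0 := by
  refine HVertexOperator.coeff_inj (funext fun n => LinearMap.ext fun w => ?_)
  have h := congrFun (opeFormal_eq_of_lowerTrunc (w := w) (lowerTrunc_pair_idOp_right a)) ![k, n]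
  simp only [opeFormal, Matrix.cons_val_zero, Matrix.cons_val_one] at h
  rw [h]
  split_ifs with h0
  · subst h0
    rw [subst, finsum_eq_single _ n]
    · rw [pair_idOp_right, moved_s (by decide), moved_t, if_pos (by simp)]
      simp [binomLeft]
    · intro i hi
      rw [pair_idOp_right, moved_t, if_neg (by simp; omega), smul_zero]
  · rw [subst_binomLeft_of_neg (by simp; omega)]; simp

/-! ### Closed quasi compatible subspaces -/

theorem QuasiCompatible.compat {U : Set (VertexOperator ℂ W)} (hU : QuasiCompatible U)
    {a b : VertexOperator ℂ W} (ha : a ∈ U) (hb : b ∈ U) : Compat a b := by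
  obtain ⟨p, hp, h⟩ := hU 2 ![a, b] (by intro i; fin_cases i <;> assumption)
  refine ⟨p, hp, fun w => ?_⟩
  have e : (∏ i : Fin 2, ∏ j ∈ Finset.Ioi i, rename ![i, j] p) = p := by
    rw [Fin.prod_univ_two, show Finset.Ioi (0 : Fin 2) = {1} by decide,
      show Finset.Ioi (1 : Fin 2) = ∅ by decide, Finset.prod_singleton, Finset.prod_empty, mul_one,
      show (![0, 1] : Fin 2 → Fin 2) = id by funext i; fin_cases i <;> rfl,
      MvPolynomial.rename_id_apply]
  rw [← e]
  exact h w

theorem lowerTrunc_of_mem {σ : ℕ} {F : Formal σ W} (h : F ∈ lowerTrunc W σ) : LowerTrunc F := h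

theorem QuasiCompatible.triple {U : Set (VertexOperator ℂ W)} (hU : QuasiCompatible U)
    {a b c : VertexOperator ℂ W} (ha : a ∈ U) (hb : b ∈ U) (hc : c ∈ U) :
    ∃ p : MvPolynomial (Fin 2) ℂ, p ≠ 0 ∧
      ∀ w, LowerTrunc (act (Fin 3) W (triplePoly p) (triple a b c w)) := by
  obtain ⟨p, hp, h⟩ := hU 3 ![a, b, c] (by intro i; fin_cases i <;> assumption)
  refine ⟨p, hp, fun w => ?_⟩
  have e : (∏ i : Fin 3, ∏ j ∈ Finset.Ioi i, rename ![i, j] p) = triplePoly p := by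
    rw [Fin.prod_univ_three, show Finset.Ioi (0 : Fin 3) = {1, 2} by decide,
      show Finset.Ioi (1 : Fin 3) = {2} by decide,
      show Finset.Ioi (2 : Fin 3) = ∅ by decide, Finset.prod_pair (by decide),
      Finset.prod_singleton, Finset.prod_empty, mul_one, triplePoly]
  have e' : prodSeries ![a, b, c] w = NonlocalVA.triple a b c w := by
    funext m
    simp [prodSeries, NonlocalVA.triple, List.ofFn_succ]
  have := lowerTrunc_of_mem (h w)
  rwa [e, e', polyMul_eq_act] at this

theorem ope_mem {U : Submodule ℂ (VertexOperator ℂ W)} (hU : QuasiCompatible (U : Set (VertexOperator ℂ W)))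
    (hc : IsClosedSubspace U) {a b : VertexOperator ℂ W} (ha : a ∈ U) (hb : b ∈ U) (k : ℤ) :
    ope a b k ∈ U := by
  obtain ⟨p, hp, h⟩ := hU.compat ha hb
  have := hc a ha b hb p hp h (-k - 1)
  rwa [nthProd_eq_ope hp, show -(-k - 1) - 1 = k by ring] at this

/-- The vertex operator map `Y_𝓔` on a closed quasi compatible subspace. -/
def vertexMap (U : Submodule ℂ (VertexOperator ℂ W)) (hU : QuasiCompatible (U : Set (VertexOperator ℂ W)))
    (hc : IsClosedSubspace U) : U →ₗ[ℂ] VertexOperator ℂ U where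
  toFun a := VertexOperator.of_coeff
    (fun k =>
      { toFun := fun b => ⟨ope a.1 b.1 k, ope_mem hU hc a.2 b.2 k⟩
        map_add' := fun b b' => Subtype.ext <| by
          simpa using ope_linear (hU.compat a.2 (b + b').2) (hU.compat a.2 b.2)
            (hU.compat a.2 b'.2) 1 (fun w => by funext m; simp [pair]) k
        map_smul' := fun c b => Subtype.ext <| by
          simpa using ope_linear (hU.compat a.2 (c • b).2) (hU.compat a.2 b.2)
            (hU.compat a.2 (0 : U).2) c (fun w => by funext m; simp [pair]) k |>.trans
            (congrArg _ (ope_eq_zero (hU.compat a.2 (0 : U).2)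
              (fun w => by funext m; simp [pair]) k)) })
    (fun b => by
      obtain ⟨N, hN⟩ := exists_ope_eq_zero a.1 b.1
      refine ⟨N, fun k hk => ?_⟩
      by_contra h
      exact hk (Subtype.ext (hN k (by omega))))
  map_add' a a' := HVertexOperator.coeff_inj <| funext fun k => LinearMap.ext fun b =>
    Subtype.ext <| by
      simpa using ope_linear (hU.compat (a + a').2 b.2) (hU.compat a.2 b.2)
            (hU.compat a'.2 b.2) 1 (fun w => by funext m; simp [pair]) k
  map_smul' c a := HVertexOperator.coeff_inj <| funext fun k => LinearMap.ext fun b =>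
    Subtype.ext <| by
      simpa using ope_linear (hU.compat (c • a).2 b.2) (hU.compat a.2 b.2)
            (hU.compat (0 : U).2 b.2) c (fun w => by funext m; simp [pair]) k |>.trans
            (congrArg _ (ope_eq_zero (hU.compat (0 : U).2 b.2)
              (fun w => by funext m; simp [pair]) k))

theorem coeff_vertexMap {U : Submodule ℂ (VertexOperator ℂ W)}
    (hU : QuasiCompatible (U : Set (VertexOperator ℂ W))) (hc : IsClosedSubspace U) (a b : U)
    (k : ℤ) : (HVertexOperator.coeff (vertexMap U hU hc a) k b : VertexOperator ℂ W) =
      ope a.1 b.1 k := rfl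

/-- The series `F(x₁, x₂)(x₃) w`, for `F` with coefficients in `U ⊂ Hom (W, W((x)))`. -/
def evalThird {U : Submodule ℂ (VertexOperator ℂ W)} (F : (Fin 2 → ℤ) → U) (w : W) :
    (Fin 3 → ℤ) → W :=
  fun m => HVertexOperator.coeff (F (m ∘ ![0, 1])).1 (m 2) w

section

variable {U : Submodule ℂ (VertexOperator ℂ W)}

theorem injective_fin_two_three : Function.Injective ![(0 : Fin 3), 1] := by decide

theorem restrict_evalThird (F : (Fin 2 → ℤ) → U) (w : W) (m : Fin 3 → ℤ) :
    restrict ![0, 1] m (evalThird F w) =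
      fun d => ((LinearMap.applyₗ w).comp ((LinearMap.proj (m 2)).comp
        ((HVertexOperator.coeff (Γ := ℤ) (R := ℂ) (V := W) (W := W)).comp U.subtype))) (F d) := by
  funext d
  have h1 : Function.extend ![(0 : Fin 3), 1] d m ∘ ![0, 1] = d := by
    funext i; exact injective_fin_two_three.extend_apply _ _ _
  have h2 : Function.extend ![(0 : Fin 3), 1] d m 2 = m 2 :=
    Function.extend_apply' _ _ _ (by decide)
  simp only [restrict, evalThird, h1, h2]
  rfl

theorem act_evalThird (q : MvPolynomial (Fin 2) ℂ) (F : (Fin 2 → ℤ) → U) (w : W) :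
    act (Fin 3) W (rename ![0, 1] q) (evalThird F w) = evalThird (act (Fin 2) U q F) w := by
  refine eq_of_restrict _ injective_fin_two_three fun m => ?_
  rw [restrict_act _ injective_fin_two_three, restrict_evalThird, restrict_evalThird]
  exact act_map _ q F

theorem subst_evalThird {c : ℤ → ℤ → ℤ} {F : (Fin 2 → ℤ) → U} (hF : Substitutable c 0 1 F)
    (w : W) : subst c 0 1 (evalThird F w) = evalThird (subst c 0 1 F) w := by
  refine eq_of_restrict _ injective_fin_two_three fun m => ?_
  have := restrict_subst c ![(0 : Fin 3), 1] injective_fin_two_three m 0 1 (evalThird F w)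
  simp only [Matrix.cons_val_zero, Matrix.cons_val_one] at this
  rw [this, restrict_evalThird, restrict_evalThird]
  exact subst_map _ hF

theorem evalThird_injective {F G : (Fin 2 → ℤ) → U} (h : ∀ w, evalThird F w = evalThird G w) :
    F = G := by
  funext d
  refine Subtype.ext (HVertexOperator.coeff_inj (funext fun n => LinearMap.ext fun w => ?_))
  have := congrFun (h w) ![d 0, d 1, n]
  have e : ![d 0, d 1, n] ∘ ![(0 : Fin 3), 1] = d := by
    funext i; fin_cases i <;> rfl
  simp only [evalThird, e] at this
  exact this

theorem Nested.evalThird_zero_one {F : (Fin 2 → ℤ) → U} (h : Nested 0 1 F) (w : W) :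
    Nested 0 1 (evalThird F w) := by
  obtain ⟨⟨N, hN⟩, h⟩ := h
  refine ⟨⟨N, fun m hm => by rw [evalThird, hN _ hm]; simp⟩, fun k => ?_⟩
  obtain ⟨M, hM⟩ := h k
  exact ⟨M, fun m h1 h2 => by rw [evalThird, hM _ h1 h2]; simp⟩

theorem Nested.evalThird_one_zero {F : (Fin 2 → ℤ) → U} (h : Nested 1 0 F) (w : W) :
    Nested 1 0 (evalThird F w) := by
  obtain ⟨⟨N, hN⟩, h⟩ := h
  refine ⟨⟨N, fun m hm => by rw [evalThird, hN _ hm]; simp⟩, fun k => ?_⟩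
  obtain ⟨M, hM⟩ := h k
  exact ⟨M, fun m h1 h2 => by rw [evalThird, hM _ h1 h2]; simp⟩

theorem lineBdd_evalThird (F : (Fin 2 → ℤ) → U) (w : W) : LineBdd 2 (evalThird F w) := by
  intro m
  obtain ⟨N, hN⟩ := coeff_bddBelow (F (m ∘ ![0, 1])).1 w
  refine ⟨N, fun k hk => ?_⟩
  have e : Function.update m 2 k ∘ ![(0 : Fin 3), 1] = m ∘ ![0, 1] := by
    funext i; fin_cases i <;> simp
  rw [evalThird, e, Function.update_self, hN k hk]

end

/-- The coefficients lie in `U`, so both sides are evaluated on a vector `w` in a third variable.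
After multiplication by the substituted `triplePoly p` they coincide, and `act_add_pow_cancel`
leaves the power of `x₀ + x₁`. -/
theorem vertexMap_weak_assoc {U : Submodule ℂ (VertexOperator ℂ W)}
    (hU : QuasiCompatible (U : Set (VertexOperator ℂ W))) (hc : IsClosedSubspace U) (u v z : U) :
    ∃ l : ℕ, act (Fin 2) U ((X 0 + X 1) ^ l) (assocLeft (vertexMap U hU hc) u v z) =
      act (Fin 2) U ((X 0 + X 1) ^ l)
        (assocRight (vertexMap U hU hc) (vertexMap U hU hc) u v z) := by
  have h01 : (0 : Fin 3) ≠ 1 := by decide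
  obtain ⟨p₁, hp₁, hc₁⟩ := hU.compat u.2 v.2
  obtain ⟨p₂, hp₂, hc₂⟩ := hU.compat v.2 z.2
  obtain ⟨p₃, hp₃, hc₃⟩ := hU.triple u.2 v.2 z.2
  obtain ⟨p, hp, d₁, d₂, d₃⟩ : ∃ p : MvPolynomial (Fin 2) ℂ, p ≠ 0 ∧ p₁ ∣ p ∧ p₂ ∣ p ∧ p₃ ∣ p :=
    ⟨p₁ * p₂ * p₃, mul_ne_zero (mul_ne_zero hp₁ hp₂) hp₃, ⟨p₂ * p₃, by ring⟩, ⟨p₁ * p₃, by ring⟩,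
      ⟨p₁ * p₂, by ring⟩⟩
  have hF : ∀ w, LowerTrunc (act (Fin 3) W (triplePoly p) (triple u.1 v.1 z.1 w)) := by
    intro w
    obtain ⟨q, rfl⟩ := d₃
    have : triplePoly (p₃ * q) = triplePoly q * triplePoly p₃ := by
      simp only [triplePoly, map_mul]; ring
    rw [this, act_mul]
    exact (hc₃ w).act _
  -- The exponent `l` is the vanishing order of `p` along the diagonal. It is fixed before `w` is
  -- introduced, as an identity in `U` requires.
  obtain ⟨l, g, g₀, e, hg₀, hg⟩ := exists_eq_X_pow_mul_fin_two (substAlg 0 1 p)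
    ((map_ne_zero_iff _ (substAlg_injective (by decide))).2 hp)
  obtain ⟨P, hP, eP⟩ := substAlg_triplePoly e hg
  refine ⟨l, evalThird_injective fun w => ?_⟩
  have er : (rename ![0, 1] ((X 0 + X 1) ^ l) : MvPolynomial (Fin 3) ℂ) = (X 0 + X 1) ^ l := by
    simp
  rw [← act_evalThird, ← act_evalThird, er]
  set L := evalThird (assocLeft (vertexMap U hU hc) u v z) w with hL
  set R := evalThird (assocRight (vertexMap U hU hc) (vertexMap U hU hc) u v z) w with hR
  set F := act (Fin 3) W (triplePoly p) (triple u.1 v.1 z.1 w) with hFdef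
  obtain ⟨N, hN⟩ := (nested_pair (vertexMap U hU hc u) (vertexMap U hU hc v) z).1
  have eL : act (Fin 3) W (substAlg 1 2 (substAlg 0 1 (triplePoly p))) L =
      subst binomLeft 1 2 (subst binomLeft 0 1 F) := by
    have h1 := act_ope_ope_right hp (hc₂.dvd d₂) (fun k => hU.compat u.2 (ope_mem hU hc v.2 z.2 k))
      w (hF w)
    have h2 : L = subst binomRight 0 1 (fun m : Fin 3 → ℤ =>
        HVertexOperator.coeff (ope u.1 (ope v.1 z.1 (m 1)) (m 0)) (m 2) w) := by
      rw [hL, assocLeft_eq, ← subst_evalThird (substitutable_binomRight hN)]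
      rfl
    have h3 : substAlg (1 : Fin 3) 2 (substAlg 0 1 (triplePoly p)) =
        substAlg 0 1 (substAlg 0 2 (substAlg 1 2 (triplePoly p))) := by
      simp only [← AlgHom.comp_apply]
      refine DFunLike.congr_fun (MvPolynomial.algHom_ext fun u => ?_) _
      fin_cases u <;> simp [substAlg, add_assoc, add_comm, add_left_comm]
    have hs : Substitutable binomRight 0 1 (fun m : Fin 3 → ℤ =>
        HVertexOperator.coeff (ope u.1 (ope v.1 z.1 (m 1)) (m 0)) (m 2) w) :=
      substitutable_binomRight (N := N) fun m hm => by
        have := congrArg (fun x : U => HVertexOperator.coeff x.1 (m 2) w) (hN (m ∘ ![0, 1]) hm)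
        simp only [ZeroMemClass.coe_zero, map_zero, Pi.zero_apply, LinearMap.zero_apply] at this
        exact this
    -- After multiplication by the polynomial the series has no negative powers of `x₀`, so the
    -- expansion may be changed from `binomRight` to `binomLeft`.
    rw [h2, h3, ← subst_act isPascal_binomRight h01 hs, h1, subst_binomRight_eq h01
      fun m hm => subst_binomLeft_of_neg hm, subst_subst_subst (hF w)]
  have eR : act (Fin 3) W (substAlg 1 2 (substAlg 0 1 (triplePoly p))) R =
      subst binomLeft 1 2 (subst binomLeft 0 1 F) :=
    act_ope_ope_left hp (hc₁.dvd d₁) (fun k => hU.compat (ope_mem hU hc u.2 v.2 k) z.2) w (hF w)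
  rw [eP] at eL eR
  refine act_add_pow_cancel (pow_ne_zero 3 hg₀) hP
    ((nested_assocLeft _ _ _ _).evalThird_zero_one w) (lineBdd_evalThird _ _)
    ((nested_assocRight _ _ _ _ _).evalThird_one_zero w) (lineBdd_evalThird _ _) (fun m hm => ?_)
    eL eR
  rcases hm with hm | hm
  · rw [subst]
    refine (finsum_congr fun n => ?_).trans finsum_zero
    rw [subst_binomLeft_of_neg, smul_zero]
    rwa [moved_ne (by decide) (by decide)]
  · exact subst_binomLeft_of_neg hm

theorem isNonlocalVertexAlgebra_vertexMap {U : Submodule ℂ (VertexOperator ℂ W)}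
    (hU : QuasiCompatible (U : Set (VertexOperator ℂ W))) (hc : IsClosedSubspace U)
    (h1 : idOp W ∈ U) : IsNonlocalVertexAlgebra (vertexMap U hU hc) ⟨idOp W, h1⟩ where
  vacuum := by
    refine HVertexOperator.coeff_inj (funext fun k => LinearMap.ext fun b => Subtype.ext ?_)
    rw [coeff_vertexMap, ope_idOp_left, coeff_idOp]
    split_ifs <;> rfl
  creation_regular v n hn := Subtype.ext <| by
    rw [coeff_vertexMap, ope_idOp_right _ hn.le, if_neg hn.ne]; rfl
  creation v := Subtype.ext <| by
    rw [coeff_vertexMap, ope_idOp_right _ le_rfl, if_pos rfl]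
  weak_assoc u v w := by
    obtain ⟨l, h⟩ := vertexMap_weak_assoc hU hc u v w
    exact ⟨l, by rwa [polyMul_eq_act, polyMul_eq_act]⟩

theorem isQuasiModule_vertexMap {U : Submodule ℂ (VertexOperator ℂ W)}
    (hU : QuasiCompatible (U : Set (VertexOperator ℂ W))) (hc : IsClosedSubspace U)
    (h1 : idOp W ∈ U) : IsQuasiModule (vertexMap U hU hc) ⟨idOp W, h1⟩ U.subtype where
  algebra := isNonlocalVertexAlgebra_vertexMap hU hc h1
  vacuum := rfl
  quasi_assoc u v w := by
    have h01 : (0 : Fin 2) ≠ 1 := by decide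
    obtain ⟨p, hp, h⟩ := hU.compat u.2 v.2
    have hp' := clears_iff.1 h w
    obtain ⟨N, hN⟩ := hp'
    have hf : LowerTrunc (act (Fin 2) W (X 0 ^ (-N).toNat * p) (pair u.1 v.1 w)) := by
      rw [act_mul]; exact LowerTrunc.act ⟨N, hN⟩ _
    -- The extra power of `x₁` removes the negative powers of `x₁` from `p(x₁, x₂) u(x₁) v(x₂) w`;
    -- the two expansions of `x₁ = x₀ + x₂` then agree. It depends on `w`, which a quasi module
    -- allows.
    refine ⟨X 0 ^ (-N).toNat * p, mul_ne_zero (pow_ne_zero _ (MvPolynomial.X_ne_zero _)) hp, ?_⟩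
    have e : (aeval ![X 0 + X 1, X 1] : MvPolynomial (Fin 2) ℂ →ₐ[ℂ] _) = substAlg 0 1 :=
      MvPolynomial.algHom_ext fun i => by fin_cases i <;> simp [substAlg]
    obtain ⟨M, hM⟩ := (nested_pair u.1 v.1 w).1
    rw [e, polyMul_eq_act, polyMul_eq_act, assocLeft_eq]
    have h2 := subst_act isPascal_binomRight h01 (substitutable_binomRight hM)
      (X 0 ^ (-N).toNat * p)
    refine h2.symm.trans ?_
    rw [subst_binomRight_eq h01, ← act_opeFormal ⟨p, hp, h⟩ _ _ hf]
    · rfl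
    · intro m hm
      rw [act_mul, act_X_pow]
      exact hN _ ⟨0, by simp; omega⟩

end Structure

/-! ### Multiplication by series in two of the variables -/

section Conv

open MvPolynomial (aeval X C rename)

variable {σ τ : Type*} [DecidableEq σ] [DecidableEq τ] {W : Type*} [AddCommGroup W] [Module ℂ W]

theorem sub_sub_sub_rotate {G : Type*} [AddCommGroup G] (m a b c : G) :
    m - a - b - c = m - c - a - b := by abel

/-- The coefficients of a series in `ℂ((x₁, x₂))`. -/
def IsLaurent (q : ℤ × ℤ → ℂ) : Prop := ∃ N : ℤ, ∀ d, d.1 < N ∨ d.2 < N → q d = 0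

/-- The product of the series `q(x_s, x_t)` and `F`. -/
def conv (q : ℤ × ℤ → ℂ) (s t : σ) (F : (σ → ℤ) → W) : (σ → ℤ) → W :=
  fun m => ∑ᶠ d : ℤ × ℤ, q d • F (m - Pi.single s d.1 - Pi.single t d.2)

/-- The product of `q(x_s, x_t)` and `F` exists. -/
def Convolvable (q : ℤ × ℤ → ℂ) (s t : σ) (F : (σ → ℤ) → W) : Prop :=
  ∀ m : σ → ℤ, {d : ℤ × ℤ | q d ≠ 0 ∧ F (m - Pi.single s d.1 - Pi.single t d.2) ≠ 0}.Finite

variable {q : ℤ × ℤ → ℂ} {s t : σ} {F G : (σ → ℤ) → W}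

theorem Convolvable.support_finite (hF : Convolvable q s t F) (m : σ → ℤ) :
    (Function.support fun d : ℤ × ℤ => q d • F (m - Pi.single s d.1 - Pi.single t d.2)).Finite :=
  (hF m).subset fun _ hd => ⟨left_ne_zero_of_smul hd, right_ne_zero_of_smul hd⟩

theorem Convolvable.add (hF : Convolvable q s t F) (hG : Convolvable q s t G) :
    Convolvable q s t (F + G) := fun m => by
  refine ((hF m).union (hG m)).subset ?_
  rintro d ⟨h1, h2⟩
  by_contra h
  simp only [Set.mem_union, Set.mem_ofPred_eq, not_or, not_and, not_not] at h
  exact h2 (by rw [Pi.add_apply, h.1 h1, h.2 h1, add_zero])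

theorem Convolvable.smul (hF : Convolvable q s t F) (a : ℂ) : Convolvable q s t (a • F) :=
  fun m => (hF m).subset fun _ hd => ⟨hd.1, right_ne_zero_of_smul hd.2⟩

theorem Convolvable.X (hF : Convolvable q s t F) (u : σ) :
    Convolvable q s t (fun m => F (m - Pi.single u 1)) := fun m => by
  refine (hF (m - Pi.single u 1)).subset fun d hd => ⟨hd.1, ?_⟩
  rw [← sub_sub_sub_rotate m]
  exact hd.2

theorem Convolvable.act (hF : Convolvable q s t F) (p : MvPolynomial σ ℂ) :
    Convolvable q s t (act σ W p F) :=
  act_induction (fun _ _ => .add) (fun a _ h => h.smul a) (fun u _ h => h.X u) p hF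

theorem conv_add (hF : Convolvable q s t F) (hG : Convolvable q s t G) :
    conv q s t (F + G) = conv q s t F + conv q s t G := by
  funext m
  simp only [conv, Pi.add_apply, smul_add]
  exact finsum_add_distrib (hF.support_finite m) (hG.support_finite m)

theorem conv_smul (hF : Convolvable q s t F) (a : ℂ) :
    conv q s t (a • F) = a • conv q s t F := by
  funext m
  simp only [conv, Pi.smul_apply]
  rw [smul_finsum' _ (hF.support_finite m)]
  exact finsum_congr fun n => smul_comm _ _ _

theorem conv_act (hF : Convolvable q s t F) (p : MvPolynomial σ ℂ) :
    conv q s t (act σ W p F) = act σ W p (conv q s t F) := by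
  induction p using MvPolynomial.induction_on with
  | C a => rw [act_C, act_C, conv_smul hF]
  | add p r hp hr => rw [act_add, act_add, conv_add (hF.act p) (hF.act r), hp, hr]
  | mul_X p u hp =>
    rw [mul_comm, act_mul, act_mul, ← hp]
    funext m
    rw [act_X]
    refine finsum_congr fun d => ?_
    rw [act_X, sub_sub_sub_rotate m]

theorem conv_map {W' : Type*} [AddCommGroup W'] [Module ℂ W'] (T : W →ₗ[ℂ] W')
    (hF : Convolvable q s t F) :
    conv q s t (fun m => T (F m)) = fun m => T (conv q s t F m) := by
  funext m
  refine ((T.toAddMonoidHom.map_finsum (hF.support_finite m)).trans ?_).symm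
  exact finsum_congr fun d => map_smul T _ _

theorem conv_swap : conv q s t F = conv (q ∘ Prod.swap) t s F := by
  funext m
  rw [conv, conv, ← finsum_comp_equiv (Equiv.prodComm ℤ ℤ)]
  refine finsum_congr fun d => ?_
  rw [sub_right_comm]
  rfl

theorem IsLaurent.swap (hq : IsLaurent q) : IsLaurent (q ∘ Prod.swap) := by
  obtain ⟨N, hN⟩ := hq
  exact ⟨N, fun d hd => hN _ hd.symm⟩

theorem restrict_conv (e : τ → σ) (he : Function.Injective e) (m : σ → ℤ) (s t : τ)
    (G : (σ → ℤ) → W) :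
    restrict e m (conv q (e s) (e t) G) = conv q s t (restrict e m G) := by
  funext d
  refine finsum_congr fun n => ?_
  rw [restrict, extend_sub_single e he, extend_sub_single e he]

theorem bddBelow_conv (hq : IsLaurent q) (hst : s ≠ t) (i : σ)
    (hF : ∃ N : ℤ, ∀ m, m i < N → F m = 0) : ∃ N : ℤ, ∀ m, m i < N → conv q s t F m = 0 := by
  obtain ⟨N, hN⟩ := hF
  obtain ⟨M, hM⟩ := hq
  refine ⟨min N (N + M), fun m hm => ?_⟩
  have : ∀ d : ℤ × ℤ, q d • F (m - Pi.single s d.1 - Pi.single t d.2) = 0 := by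
    intro d
    by_cases hd : d.1 < M ∨ d.2 < M
    · rw [hM d hd, zero_smul]
    · rw [hN, smul_zero]
      rw [Pi.sub_apply, Pi.sub_apply]
      rcases eq_or_ne i s with rfl | h1
      · rw [Pi.single_eq_same, Pi.single_eq_of_ne hst]; omega
      · rw [Pi.single_eq_of_ne h1]
        rcases eq_or_ne i t with rfl | h2
        · rw [Pi.single_eq_same]; omega
        · rw [Pi.single_eq_of_ne h2]; omega
  simp [conv, this]

section Spread

variable {e : τ → σ} (he : Function.Injective e) {A B : (σ → ℤ) → Module.End ℂ W}
  (hA : IndepOf e A) (hB : IndepOf e B) {i j : τ} {Φ : W → (τ → ℤ) → W}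
include he hA hB

theorem convolvable_spread (hΦ : ∀ w, Convolvable q i j (Φ w)) (w : W) :
    Convolvable q (e i) (e j) (spread e A B Φ w) := by
  intro m
  refine (hΦ (B m w) (m ∘ e)).subset ?_
  rintro d ⟨h1, h2⟩
  refine ⟨h1, fun h => h2 ?_⟩
  have h3 : m - Pi.single (e i) d.1 - Pi.single (e j) d.2 =
      Function.extend e (m ∘ e - Pi.single i d.1 - Pi.single j d.2) m := by
    rw [extend_sub_single e he, extend_sub_single e he, extend_comp_self e he]
  have h4 := congrFun (restrict_spread he hA hB Φ w m) (m ∘ e - Pi.single i d.1 - Pi.single j d.2)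
  rw [h3]
  exact (show _ = _ from h4).trans (by rw [h, map_zero])

theorem conv_spread (hΦ : ∀ w, Convolvable q i j (Φ w)) (w : W) :
    conv q (e i) (e j) (spread e A B Φ w) = spread e A B (fun w => conv q i j (Φ w)) w := by
  refine eq_of_restrict e he fun m => ?_
  rw [restrict_conv e he, restrict_spread he hA hB, restrict_spread he hA hB,
    conv_map (A m) (hΦ _)]

end Spread

/-! ### Sparse series -/

/-- The support of `F` meets the preimage under `h` of each negative orthant in a finite set. -/
def Sparse (h : (σ → ℤ) →+ (τ → ℤ)) (F : (σ → ℤ) → W) : Prop :=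
  ∀ K : ℤ, {m | (∀ i, h m i ≤ K) ∧ F m ≠ 0}.Finite

variable {h : (σ → ℤ) →+ (τ → ℤ)}

theorem sparse_zero : Sparse h (0 : (σ → ℤ) → W) := fun K => by simp

theorem Sparse.add (hF : Sparse h F) (hG : Sparse h G) : Sparse h (F + G) := fun K => by
  refine ((hF K).union (hG K)).subset ?_
  rintro d ⟨h1, h2⟩
  by_contra h
  simp only [Set.mem_union, Set.mem_ofPred_eq, not_or, not_and, not_not] at h
  exact h2 (by rw [Pi.add_apply, h.1 h1, h.2 h1, add_zero])

theorem Sparse.smul (hF : Sparse h F) (a : ℂ) : Sparse h (a • F) :=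
  fun K => (hF K).subset fun _ hd => ⟨hd.1, right_ne_zero_of_smul hd.2⟩

theorem Sparse.act (hF : Sparse h F) (hh : ∀ u i, 0 ≤ h (Pi.single u 1) i)
    (p : MvPolynomial σ ℂ) : Sparse h (act σ W p F) := by
  refine act_induction (fun _ _ => .add) (fun a _ h => h.smul a) (fun u F hF K => ?_) p hF
  refine ((hF K).image (· + Pi.single u 1)).subset ?_
  rintro m ⟨h1, h2⟩
  refine ⟨m - Pi.single u 1, ⟨fun i => ?_, h2⟩, sub_add_cancel _ _⟩
  rw [map_sub, Pi.sub_apply]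
  linarith [hh u i, h1 i]

section

variable {s' t' : τ} (hs : ∀ d, h (Pi.single s d) = Pi.single s' d)
  (ht : ∀ d, h (Pi.single t d) = Pi.single t' d) (hst' : s' ≠ t')
include hs ht hst'

/-- Exponents of `q` are bounded below, so an upper bound on `h` of the product exponent bounds `h`
of the exponent of `F`. Sparseness leaves finitely many of the latter, and for each of them finitely
many exponents of `q`. Later `h` is the identity or the identification of two variables. -/
theorem finite_conv_support (hF : Sparse h F) (hq : IsLaurent q) (K : ℤ) :
    {x : (σ → ℤ) × (ℤ × ℤ) | (∀ i, h x.1 i ≤ K) ∧ q x.2 ≠ 0 ∧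
      F (x.1 - Pi.single s x.2.1 - Pi.single t x.2.2) ≠ 0}.Finite := by
  obtain ⟨N, hN⟩ := hq
  refine ((hF (max K (K - N))).biUnion fun a _ =>
    (((Set.finite_Icc N (K - h a s')).prod (Set.finite_Icc N (K - h a t'))).image
      fun d : ℤ × ℤ => (a + Pi.single t d.2 + Pi.single s d.1, d))).subset ?_
  rintro ⟨m, d⟩ ⟨h1, h2, h3⟩
  have hd : N ≤ d.1 ∧ N ≤ d.2 := by
    by_contra hd
    exact h2 (hN d (by omega))
  have he : ∀ i, h (m - Pi.single s d.1 - Pi.single t d.2) i =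
      h m i - (Pi.single s' d.1 : τ → ℤ) i - (Pi.single t' d.2 : τ → ℤ) i := by
    intro i; rw [map_sub, map_sub, hs, ht]; rfl
  refine Set.mem_biUnion (x := m - Pi.single s d.1 - Pi.single t d.2) ⟨fun i => ?_, h3⟩
    ⟨d, ⟨⟨hd.1, ?_⟩, ⟨hd.2, ?_⟩⟩, ?_⟩
  · rw [he]
    have : h m i ≤ K := h1 i
    rcases eq_or_ne i s' with rfl | i1
    · rw [Pi.single_eq_same, Pi.single_eq_of_ne hst']; omega
    · rw [Pi.single_eq_of_ne i1]
      rcases eq_or_ne i t' with rfl | i2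
      · rw [Pi.single_eq_same]; omega
      · rw [Pi.single_eq_of_ne i2]; omega
  · rw [he]
    have := h1 s'
    simp only [Pi.single_eq_same, Pi.single_eq_of_ne hst']; linarith
  · rw [he]
    have := h1 t'
    simp only [Pi.single_eq_same, Pi.single_eq_of_ne hst'.symm]; linarith
  · simp

theorem Sparse.conv (hF : Sparse h F) (hq : IsLaurent q) : Sparse h (conv q s t F) := by
  intro K
  refine ((finite_conv_support hs ht hst' hF hq K).image Prod.fst).subset ?_
  rintro m ⟨h1, h2⟩
  obtain ⟨d, hd⟩ : ∃ d : ℤ × ℤ, q d • F (m - Pi.single s d.1 - Pi.single t d.2) ≠ 0 := by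
    by_contra! hd
    exact h2 (by simp [NonlocalVA.conv, hd])
  exact ⟨(m, d), ⟨h1, left_ne_zero_of_smul hd, right_ne_zero_of_smul hd⟩, rfl⟩

theorem Sparse.convolvable [Finite τ] (hF : Sparse h F) (hq : IsLaurent q) :
    Convolvable q s t F := by
  intro m
  obtain ⟨K, hK⟩ := (Set.finite_range (h m)).bddAbove
  refine ((finite_conv_support hs ht hst' hF hq K).image Prod.snd).subset ?_
  rintro d ⟨h1, h2⟩
  exact ⟨(m, d), ⟨fun i => hK ⟨i, rfl⟩, h1, h2⟩, rfl⟩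

end

end Conv

/-! ### Series in `ℂ((x₁, x₂))` inside `ℂ((x₂))((x₁))` -/

section Coefficients

open MvPolynomial (aeval X C rename)

variable {W : Type*} [AddCommGroup W] [Module ℂ W]

theorem hahnModule_coeff_smul {R M : Type*} [CommRing R] [AddCommGroup M] [Module R M]
    (x : HahnSeries ℤ R) (y : HahnModule ℤ R M) (n : ℤ) :
    (Function.support fun i : ℤ => x.coeff i • ((HahnModule.of R).symm y).coeff (n - i)).Finite ∧
    ((HahnModule.of R).symm (x • y)).coeff n =
      ∑ᶠ i : ℤ, x.coeff i • ((HahnModule.of R).symm y).coeff (n - i) := by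
  have hf := Set.VAddAntidiagonal.finite_of_isPWO x.isPWO_support
    ((HahnModule.of R).symm y).isPWO_support n
  have hsub : (Function.support fun i : ℤ => x.coeff i • ((HahnModule.of R).symm y).coeff (n - i)) ⊆
      (hf.toFinset.image Prod.fst : Finset ℤ) := by
    intro i hi
    have h1 : x.coeff i ≠ 0 := fun h => hi (by simp [h])
    have h2 : ((HahnModule.of R).symm y).coeff (n - i) ≠ 0 := fun h => hi (by simp [h])
    rw [Finset.coe_image]
    refine ⟨(i, n - i), ?_, rfl⟩
    rw [Finset.mem_coe, Set.Finite.mem_toFinset, Set.mem_vaddAntidiagonal]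
    exact ⟨h1, h2, by simp⟩
  refine ⟨(Finset.finite_toSet _).subset hsub, ?_⟩
  rw [HahnModule.coeff_smul, finsum_eq_sum_of_support_subset _ hsub, Finset.sum_image]
  · refine Finset.sum_congr rfl fun ij hij => ?_
    have : ij.1 + ij.2 = n := by
      have := (Set.mem_vaddAntidiagonal.1 ((Set.Finite.mem_toFinset hf).1 hij)).2.2
      simpa using this
    rw [← this, add_sub_cancel_left]
  · intro a ha b hb hab
    have ha := (Set.mem_vaddAntidiagonal.1 ((Set.Finite.mem_toFinset hf).1 ha)).2.2
    have hb := (Set.mem_vaddAntidiagonal.1 ((Set.Finite.mem_toFinset hf).1 hb)).2.2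
    rw [vadd_eq_add] at ha hb
    exact Prod.ext hab (by omega)

/-- The coefficient of `x₁^{d₁} x₂^{d₂}`. -/
def iterCoeff (q : IterField) (d : ℤ × ℤ) : ℂ :=
  ((show LaurentSeries (LaurentSeries ℂ) from q).coeff d.1).coeff d.2

theorem sparse_of_lineBdd {F : (Fin 2 → ℤ) → W} (h0 : ∃ N : ℤ, ∀ m, m 0 < N → F m = 0)
    (h1 : LineBdd 1 F) : Sparse (AddMonoidHom.id _) F := by
  intro K
  obtain ⟨N, hN⟩ := h0
  choose M hM using fun i : ℤ => h1 ![i, 0]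
  refine ((Set.finite_Icc N K).biUnion fun i _ =>
    (Set.finite_Icc (M i) K).image fun j => ![i, j]).subset ?_
  rintro m ⟨h2, h3⟩
  have h4 : m = ![m 0, m 1] := by funext i; fin_cases i <;> rfl
  refine Set.mem_biUnion (x := m 0) ⟨?_, h2 0⟩ ⟨m 1, ⟨?_, h2 1⟩, h4.symm⟩
  · by_contra h
    exact h3 (hN m (not_le.1 h))
  · by_contra h
    refine h3 ?_
    rw [h4, ← hM (m 0) (m 1) (not_le.1 h)]
    congr 1
    funext i; fin_cases i <;> simp

theorem sparse_toFormal (F : IterModule W) : Sparse (AddMonoidHom.id _) (toFormal F) :=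
  sparse_of_lineBdd (toFormal_bddBelow F) (toFormal_lineBdd F)

theorem toFormal_smul {q : IterField} (hq : IsLaurent (iterCoeff q)) (F : IterModule W) :
    toFormal (q • F) = conv (iterCoeff q) 0 1 (toFormal F) := by
  funext m
  have hc : Convolvable (iterCoeff q) 0 1 (toFormal F) :=
    (sparse_toFormal F).convolvable (s' := 0) (t' := 1) (fun _ => rfl) (fun _ => rfl)
      (by decide) hq
  rw [conv, finsum_curry _ (hc.support_finite m)]
  obtain ⟨hf, h⟩ := hahnModule_coeff_smul (show LaurentSeries (LaurentSeries ℂ) from q)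
    (show HahnModule ℤ (LaurentSeries ℂ) (HahnModule ℤ ℂ W) from F) (m 0)
  have h1 : toFormal (q • F) m = ((HahnModule.of ℂ).symm (∑ᶠ i : ℤ,
      (show LaurentSeries (LaurentSeries ℂ) from q).coeff i • outerCoeff F (m 0 - i))).coeff
        (m 1) := by
    exact congrArg (fun x => ((HahnModule.of ℂ).symm x).coeff (m 1)) h
  let T : HahnModule ℤ ℂ W →+ W :=
    { toFun := fun x => ((HahnModule.of ℂ).symm x).coeff (m 1)
      map_zero' := rfl
      map_add' := fun _ _ => rfl }
  rw [h1]
  refine (T.map_finsum hf).trans (finsum_congr fun i => ?_)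
  obtain ⟨-, h2⟩ := hahnModule_coeff_smul
    ((show LaurentSeries (LaurentSeries ℂ) from q).coeff i) (outerCoeff F (m 0 - i)) (m 1)
  refine h2.trans (finsum_congr fun j => ?_)
  simp only [toFormal, coeff₂, iterCoeff]
  congr 3 <;> simp

theorem powerSeriesEmb_apply (f : PowerSeries (PowerSeries ℂ)) :
    powerSeriesEmb f = (HahnSeries.ofPowerSeries ℤ (LaurentSeries ℂ)
      (PowerSeries.map (HahnSeries.ofPowerSeries ℤ ℂ) f) : LaurentSeries (LaurentSeries ℂ)) := rfl

theorem powerSeriesEmb_X : powerSeriesEmb PowerSeries.X = out := by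
  rw [powerSeriesEmb_apply, PowerSeries.map_X, HahnSeries.ofPowerSeries_X]; rfl

theorem powerSeriesEmb_C_X : powerSeriesEmb (PowerSeries.C PowerSeries.X) = inn := by
  rw [powerSeriesEmb_apply, PowerSeries.map_C, HahnSeries.ofPowerSeries_X,
    HahnSeries.ofPowerSeries_C]; rfl

theorem powerSeriesEmb_C_C (a : ℂ) :
    powerSeriesEmb (PowerSeries.C (PowerSeries.C a)) = algebraMap ℂ IterField a := by
  rw [powerSeriesEmb_apply, PowerSeries.map_C, HahnSeries.ofPowerSeries_C,
    HahnSeries.ofPowerSeries_C]; rfl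

theorem iterCoeff_powerSeriesEmb (f : PowerSeries (PowerSeries ℂ)) (i j : ℕ) :
    iterCoeff (powerSeriesEmb f) (i, j) = PowerSeries.coeff j (PowerSeries.coeff i f) := by
  change ((HahnSeries.ofPowerSeries ℤ (LaurentSeries ℂ)
    (PowerSeries.map (HahnSeries.ofPowerSeries ℤ ℂ) f)).coeff (i : ℤ)).coeff (j : ℤ) = _
  rw [HahnSeries.ofPowerSeries_apply_coeff, PowerSeries.coeff_map,
    HahnSeries.ofPowerSeries_apply_coeff]

theorem ofPowerSeries_coeff_of_neg {R : Type*} [CommSemiring R] (f : PowerSeries R) {n : ℤ}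
    (hn : n < 0) : (HahnSeries.ofPowerSeries ℤ R f).coeff n = 0 := by
  rw [HahnSeries.ofPowerSeries_apply]
  refine HahnSeries.embDomain_of_notMem_range ?_
  rintro ⟨k, hk⟩
  have : (k : ℤ) = n := hk
  omega

theorem iterCoeff_powerSeriesEmb_of_neg (f : PowerSeries (PowerSeries ℂ)) {d : ℤ × ℤ}
    (hd : d.1 < 0 ∨ d.2 < 0) : iterCoeff (powerSeriesEmb f) d = 0 := by
  change ((HahnSeries.ofPowerSeries ℤ (LaurentSeries ℂ)
    (PowerSeries.map (HahnSeries.ofPowerSeries ℤ ℂ) f)).coeff d.1).coeff d.2 = _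
  rcases lt_or_ge d.1 0 with h | h
  · rw [ofPowerSeries_coeff_of_neg _ h]; rfl
  · obtain ⟨n, hn⟩ := Int.eq_ofNat_of_zero_le h
    rw [hn, HahnSeries.ofPowerSeries_apply_coeff, PowerSeries.coeff_map,
      ofPowerSeries_coeff_of_neg _ (by omega)]

theorem iterCoeff_out_mul (q : IterField) (d : ℤ × ℤ) :
    iterCoeff (out * q) d = iterCoeff q (d.1 - 1, d.2) := by
  have h : (HahnSeries.single (1 : ℤ) (1 : LaurentSeries ℂ) *
      (show LaurentSeries (LaurentSeries ℂ) from q)).coeff (d.1 - 1 + 1) = 1 * _ :=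
    HahnSeries.coeff_single_mul_add
  rw [sub_add_cancel, one_mul] at h
  exact congrArg (fun x => x.coeff d.2) h

theorem iterCoeff_inn_mul (q : IterField) (d : ℤ × ℤ) :
    iterCoeff (inn * q) d = iterCoeff q (d.1, d.2 - 1) := by
  have h : (HahnSeries.C (HahnSeries.single (1 : ℤ) (1 : ℂ)) *
      (show LaurentSeries (LaurentSeries ℂ) from q)).coeff d.1 = _ * _ :=
    HahnSeries.coeff_single_zero_mul
  have h' : (HahnSeries.single (1 : ℤ) (1 : ℂ) *
      (show LaurentSeries (LaurentSeries ℂ) from q).coeff d.1).coeff (d.2 - 1 + 1) = 1 * _ :=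
    HahnSeries.coeff_single_mul_add
  rw [sub_add_cancel, one_mul] at h'
  exact (congrArg (fun x => x.coeff d.2) h).trans h'

theorem iterCoeff_pow_mul (q : IterField) (n : ℕ) (d : ℤ × ℤ) :
    iterCoeff ((out * inn) ^ n * q) d = iterCoeff q (d.1 - n, d.2 - n) := by
  induction n generalizing d with
  | zero => simp
  | succ n ih =>
    rw [pow_succ', mul_assoc, mul_assoc, iterCoeff_out_mul, iterCoeff_inn_mul, ih]
    congr 2 <;> push_cast <;> ring

theorem out_ne_zero : out ≠ 0 := by
  have := polyEmb_ne_zero (MvPolynomial.X_ne_zero (R := ℂ) (0 : Fin 2))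
  simpa [polyEmb] using this

theorem inn_ne_zero : inn ≠ 0 := by
  have := polyEmb_ne_zero (MvPolynomial.X_ne_zero (R := ℂ) (1 : Fin 2))
  simpa [polyEmb] using this

/-- The image of `ℂ((x₁, x₂))` in `ℂ((x₂))((x₁))`. -/
def laurentRing : Subring IterField where
  carrier := {q | ∃ (n : ℕ) (f : PowerSeries (PowerSeries ℂ)),
    (out * inn) ^ n * q = powerSeriesEmb f}
  mul_mem' := by
    rintro p q ⟨n, f, hf⟩ ⟨k, g, hg⟩
    exact ⟨n + k, f * g, by rw [map_mul, ← hf, ← hg]; ring⟩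
  one_mem' := ⟨0, 1, by simp⟩
  add_mem' := by
    rintro p q ⟨n, f, hf⟩ ⟨k, g, hg⟩
    obtain ⟨e, he⟩ : ∃ e, out * inn = powerSeriesEmb e :=
      ⟨PowerSeries.X * PowerSeries.C PowerSeries.X, by
        rw [map_mul, powerSeriesEmb_X, powerSeriesEmb_C_X]⟩
    refine ⟨n + k, e ^ k * f + e ^ n * g, ?_⟩
    rw [map_add, map_mul, map_mul, map_pow, map_pow, ← he, ← hf, ← hg]; ring
  zero_mem' := ⟨0, 0, by simp⟩
  neg_mem' := by
    rintro p ⟨n, f, hf⟩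
    exact ⟨n, -f, by rw [map_neg, ← hf, mul_neg]⟩

theorem powerSeriesEmb_mem (f : PowerSeries (PowerSeries ℂ)) : powerSeriesEmb f ∈ laurentRing :=
  ⟨0, f, by simp⟩

theorem exists_powerSeriesEmb_eq (p : MvPolynomial (Fin 2) ℂ) :
    ∃ f, polyEmb p = powerSeriesEmb f := by
  induction p using MvPolynomial.induction_on with
  | C a =>
    exact ⟨PowerSeries.C (PowerSeries.C a), by
      rw [← MvPolynomial.algebraMap_eq, AlgHom.commutes, powerSeriesEmb_C_C]⟩
  | add p q hp hq =>
    obtain ⟨f, hf⟩ := hp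
    obtain ⟨g, hg⟩ := hq
    exact ⟨f + g, by rw [map_add, map_add, hf, hg]⟩
  | mul_X p s hp =>
    obtain ⟨f, hf⟩ := hp
    obtain ⟨g, hg⟩ : ∃ g, ![out, inn] s = powerSeriesEmb g := by
      fin_cases s
      · exact ⟨_, powerSeriesEmb_X.symm⟩
      · exact ⟨_, powerSeriesEmb_C_X.symm⟩
    exact ⟨f * g, by rw [map_mul, map_mul, hf, ← hg, polyEmb, MvPolynomial.aeval_X]⟩

theorem polyEmb_mem (p : MvPolynomial (Fin 2) ℂ) : polyEmb p ∈ laurentRing := by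
  obtain ⟨f, hf⟩ := exists_powerSeriesEmb_eq p
  rw [hf]; exact powerSeriesEmb_mem f

theorem isLaurent_iterCoeff {q : IterField} (hq : q ∈ laurentRing) : IsLaurent (iterCoeff q) := by
  obtain ⟨n, f, hf⟩ := hq
  refine ⟨-n, fun d hd => ?_⟩
  have := iterCoeff_pow_mul q n (d.1 + n, d.2 + n)
  simp only [add_sub_cancel_right] at this
  rw [← show iterCoeff ((out * inn) ^ n * q) (d.1 + n, d.2 + n) = iterCoeff q d from this, hf,
    iterCoeff_powerSeriesEmb_of_neg _ (by simp only; omega)]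

theorem exists_iterCoeff_eq {q : ℤ × ℤ → ℂ} (hq : IsLaurent q) :
    ∃ Q ∈ laurentRing, iterCoeff Q = q := by
  obtain ⟨N, hN⟩ := hq
  set n : ℕ := (-N).toNat
  let f : PowerSeries (PowerSeries ℂ) :=
    PowerSeries.mk fun i => PowerSeries.mk fun j => q ((i : ℤ) - n, (j : ℤ) - n)
  have hne : (out * inn : IterField) ^ n ≠ 0 := pow_ne_zero _ (mul_ne_zero out_ne_zero inn_ne_zero)
  have e : (out * inn) ^ n * (((out * inn) ^ n)⁻¹ * powerSeriesEmb f) = powerSeriesEmb f :=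
    mul_inv_cancel_left₀ hne _
  refine ⟨((out * inn) ^ n)⁻¹ * powerSeriesEmb f, ⟨n, f, e⟩, funext fun d => ?_⟩
  have := iterCoeff_pow_mul (((out * inn) ^ n)⁻¹ * powerSeriesEmb f) n (d.1 + n, d.2 + n)
  simp only [add_sub_cancel_right] at this
  refine this.symm.trans ?_
  rw [e]
  by_cases hd : d.1 + n < 0 ∨ d.2 + n < 0
  · rw [iterCoeff_powerSeriesEmb_of_neg _ hd, hN]; omega
  · obtain ⟨i, hi⟩ := Int.eq_ofNat_of_zero_le (show 0 ≤ d.1 + n by omega)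
    obtain ⟨j, hj⟩ := Int.eq_ofNat_of_zero_le (show 0 ≤ d.2 + n by omega)
    rw [hi, hj]
    refine (iterCoeff_powerSeriesEmb f i j).trans ?_
    rw [PowerSeries.coeff_mk, PowerSeries.coeff_mk]
    congr 1
    ext <;> simp only <;> omega

end Coefficients

/-! ### Pseudo-locality relations -/

section Span

open MvPolynomial (aeval X C rename)

variable {σ : Type*} [DecidableEq σ] {W : Type*} [AddCommGroup W] [Module ℂ W]

/-- The families of series generated by `𝓑` under multiplication by series `q(x_s, x_t)` in
`ℂ((x_s, x_t))` with `R s t`. -/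
inductive ConvSpan (R : σ → σ → Prop) (𝓑 : Set (W → (σ → ℤ) → W)) : (W → (σ → ℤ) → W) → Prop
  | base {Φ : W → (σ → ℤ) → W} (h : Φ ∈ 𝓑) : ConvSpan R 𝓑 Φ
  | zero : ConvSpan R 𝓑 fun _ => 0
  | add {Φ Ψ : W → (σ → ℤ) → W} (hΦ : ConvSpan R 𝓑 Φ) (hΨ : ConvSpan R 𝓑 Ψ) :
      ConvSpan R 𝓑 fun w => Φ w + Ψ w
  | conv {s t : σ} {q : ℤ × ℤ → ℂ} {Φ : W → (σ → ℤ) → W} (h : R s t) (hq : IsLaurent q)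
      (hΦ : ConvSpan R 𝓑 Φ) : ConvSpan R 𝓑 fun w => NonlocalVA.conv q s t (Φ w)

variable {R : σ → σ → Prop} {𝓑 : Set (W → (σ → ℤ) → W)} {Φ : W → (σ → ℤ) → W}

theorem ConvSpan.conv_symm {s t : σ} {q : ℤ × ℤ → ℂ} (h : R s t) (hq : IsLaurent q)
    (hΦ : ConvSpan R 𝓑 Φ) : ConvSpan R 𝓑 fun w => NonlocalVA.conv q t s (Φ w) := by
  simp only [conv_swap (s := t)]
  exact hΦ.conv h hq.swap

theorem ConvSpan.sum {ι : Type*} (I : Finset ι) {Φ : ι → W → (σ → ℤ) → W}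
    (h : ∀ i ∈ I, ConvSpan R 𝓑 (Φ i)) : ConvSpan R 𝓑 fun w => ∑ i ∈ I, Φ i w := by
  classical
  induction I using Finset.induction_on with
  | empty => simpa using ConvSpan.zero
  | insert i I hi ih =>
    simp only [Finset.sum_insert hi]
    exact (h i (Finset.mem_insert_self _ _)).add
      (ih fun j hj => h j (Finset.mem_insert_of_mem hj))

/-- The coefficients of the monomial `c x₁^{d₁} x₂^{d₂}`. -/
def monomialCoeff (d : ℤ × ℤ) (c : ℂ) : ℤ × ℤ → ℂ := fun e => if e = d then c else 0

theorem isLaurent_monomialCoeff (d : ℤ × ℤ) (c : ℂ) : IsLaurent (monomialCoeff d c) := by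
  refine ⟨min d.1 d.2, fun e he => if_neg ?_⟩
  rintro rfl
  omega

theorem conv_monomialCoeff (d : ℤ × ℤ) (c : ℂ) (s t : σ) (F : (σ → ℤ) → W) (m : σ → ℤ) :
    conv (monomialCoeff d c) s t F m = c • F (m - Pi.single s d.1 - Pi.single t d.2) := by
  rw [conv, finsum_eq_single _ d]
  · simp [monomialCoeff]
  · intro e he
    simp [monomialCoeff, he]

/-- Constants and variables are themselves Laurent monomials in a pair of variables allowed by `R`.
-/
theorem ConvSpan.act (hR : ∀ u, ∃ v, R u v ∨ R v u) (hR' : ∃ s t, R s t) (hΦ : ConvSpan R 𝓑 Φ)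
    (p : MvPolynomial σ ℂ) : ConvSpan R 𝓑 fun w => act σ W p (Φ w) := by
  induction p using MvPolynomial.induction_on generalizing Φ with
  | C a =>
    obtain ⟨s, t, h⟩ := hR'
    have := hΦ.conv h (isLaurent_monomialCoeff 0 a)
    convert this using 2 with w
    funext m
    rw [conv_monomialCoeff, act_C]; simp
  | add p q hp hq =>
    simp only [act_add]; exact (hp hΦ).add (hq hΦ)
  | mul_X p u hp =>
    simp only [act_mul]
    refine hp ?_
    obtain ⟨v, h⟩ := hR u
    have h' : ConvSpan R 𝓑 fun w => NonlocalVA.conv (monomialCoeff (1, 0) 1) u v (Φ w) :=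
      h.elim (fun h => hΦ.conv h (isLaurent_monomialCoeff _ _))
        fun h => hΦ.conv_symm h (isLaurent_monomialCoeff _ _)
    convert h' using 2 with w
    funext m
    rw [conv_monomialCoeff, act_X]; simp

theorem ConvSpan.sparse {τ : Type*} [DecidableEq τ] {h : (σ → ℤ) →+ (τ → ℤ)}
    (hR : ∀ s t, R s t → ∃ s' t' : τ, s' ≠ t' ∧ (∀ d, h (Pi.single s d) = Pi.single s' d) ∧
      ∀ d, h (Pi.single t d) = Pi.single t' d)
    (h𝓑 : ∀ Φ ∈ 𝓑, ∀ w, Sparse h (Φ w)) (hΦ : ConvSpan R 𝓑 Φ) (w : W) : Sparse h (Φ w) := by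
  induction hΦ with
  | base hb => exact h𝓑 _ hb w
  | zero => exact sparse_zero
  | add _ _ h1 h2 => exact h1.add h2
  | conv hr hq _ ih =>
    obtain ⟨s', t', h1, h2, h3⟩ := hR _ _ hr
    exact Sparse.conv h2 h3 h1 ih hq

/-- The series `u(x₂) v(x₁) w`. -/
def opPair (u v : VertexOperator ℂ W) (w : W) : (Fin 2 → ℤ) → W := toFormal (comp₂ u v w)

/-- The finite sums of series `q(x₁, x₂) u(x₂) v(x₁) w` with `u ∈ T` and `v ∈ U`. -/
def SwapSpan (T U : Set (VertexOperator ℂ W)) : (W → (Fin 2 → ℤ) → W) → Prop :=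
  ConvSpan (fun s t => s = 0 ∧ t = 1) {Φ | ∃ u ∈ T, ∃ v ∈ U, Φ = opPair u v}

variable {T U : Set (VertexOperator ℂ W)} {Φ : W → (Fin 2 → ℤ) → W}

theorem SwapSpan.sparse (h : SwapSpan T U Φ) (w : W) : Sparse (AddMonoidHom.id _) (Φ w) := by
  refine ConvSpan.sparse (h := AddMonoidHom.id _) ?_ ?_ h w
  · rintro s t ⟨rfl, rfl⟩
    exact ⟨0, 1, by decide, fun _ => rfl, fun _ => rfl⟩
  · rintro _ ⟨u, -, v, -, rfl⟩ w
    exact sparse_toFormal _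

theorem SwapSpan.convolvable (h : SwapSpan T U Φ) {q : ℤ × ℤ → ℂ} (hq : IsLaurent q) (w : W) :
    Convolvable q 0 1 (Φ w) :=
  (h.sparse w).convolvable (s' := 0) (t' := 1) (fun _ => rfl) (fun _ => rfl) (by decide) hq

theorem SwapSpan.act (h : SwapSpan T U Φ) (p : MvPolynomial (Fin 2) ℂ) :
    SwapSpan T U fun w => act (Fin 2) W p (Φ w) :=
  ConvSpan.act (fun u => by fin_cases u; exacts [⟨1, by simp⟩, ⟨0, by simp⟩])
    ⟨0, 1, rfl, rfl⟩ h p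

theorem SwapSpan.mono {T' U' : Set (VertexOperator ℂ W)} (hT : T ⊆ T') (hU : U ⊆ U')
    (h : SwapSpan T U Φ) : SwapSpan T' U' Φ := by
  induction h with
  | base hb =>
    obtain ⟨u, hu, v, hv, rfl⟩ := hb
    exact .base ⟨u, hT hu, v, hU hv, rfl⟩
  | zero => exact .zero
  | add _ _ h1 h2 => exact ConvSpan.add h1 h2
  | conv hr hq _ ih => exact ConvSpan.conv hr hq ih

theorem toFormal_sum {ι : Type*} (I : Finset ι) (F : ι → IterModule W) :
    toFormal (∑ i ∈ I, F i) = ∑ i ∈ I, toFormal (F i) :=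
  map_sum (⟨⟨toFormal, toFormal_zero⟩, toFormal_add⟩ : IterModule W →+ Formal 2 W) F I

/-- This passes between the inductive description, convenient for substitutions, and the explicit
finite sums occurring in the definitions of pseudo-locality. -/
theorem swapSpan_iff : SwapSpan T U Φ ↔ ∃ (r : ℕ) (q : Fin r → IterField)
    (u v : Fin r → VertexOperator ℂ W), (∀ i, q i ∈ laurentRing) ∧ (∀ i, u i ∈ T) ∧
    (∀ i, v i ∈ U) ∧ ∀ w, Φ w = ∑ i, toFormal (q i • comp₂ (u i) (v i) w) := by
  constructor
  · intro h
    induction h with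
    | base hb =>
      obtain ⟨u, hu, v, hv, rfl⟩ := hb
      exact ⟨1, fun _ => 1, fun _ => u, fun _ => v, fun _ => one_mem _, fun _ => hu, fun _ => hv,
        fun w => by simp [opPair]⟩
    | zero => exact ⟨0, Fin.elim0, Fin.elim0, Fin.elim0, fun i => i.elim0, fun i => i.elim0,
        fun i => i.elim0, fun w => by simp⟩
    | add _ _ h1 h2 =>
      obtain ⟨r₁, q₁, u₁, v₁, hq₁, hu₁, hv₁, e₁⟩ := h1
      obtain ⟨r₂, q₂, u₂, v₂, hq₂, hu₂, hv₂, e₂⟩ := h2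
      refine ⟨r₁ + r₂, Fin.append q₁ q₂, Fin.append u₁ u₂, Fin.append v₁ v₂, ?_, ?_, ?_,
        fun w => ?_⟩
      · exact fun i => Fin.addCases (by simpa using hq₁) (by simpa using hq₂) i
      · exact fun i => Fin.addCases (by simpa using hu₁) (by simpa using hu₂) i
      · exact fun i => Fin.addCases (by simpa using hv₁) (by simpa using hv₂) i
      · simp only [e₁, e₂, Fin.sum_univ_add, Fin.append_left, Fin.append_right]
    | conv hr hq _ ih =>
      obtain ⟨rfl, rfl⟩ := hr
      obtain ⟨r, q', u, v, hq', hu, hv, e⟩ := ih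
      obtain ⟨Q, hQ, rfl⟩ := exists_iterCoeff_eq hq
      refine ⟨r, fun i => Q * q' i, u, v, fun i => mul_mem hQ (hq' i), hu, hv, fun w => ?_⟩
      simp only [e, ← toFormal_sum, ← toFormal_smul hq, Finset.smul_sum, mul_smul]
  · rintro ⟨r, q, u, v, hq, hu, hv, e⟩
    have : Φ = fun w => ∑ i, conv (iterCoeff (q i)) 0 1 (opPair (u i) (v i) w) := by
      funext w
      rw [e]
      exact Finset.sum_congr rfl fun i _ => toFormal_smul (isLaurent_iterCoeff (hq i)) _
    rw [this]
    exact ConvSpan.sum _ fun i _ => ConvSpan.conv ⟨rfl, rfl⟩ (isLaurent_iterCoeff (hq i))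
      (.base ⟨u i, hu i, v i, hv i, rfl⟩)

/-- `p(x₁, x₂) a(x₁) c(x₂)` is a sum of series `q(x₁, x₂) u(x₂) v(x₁)` with `u ∈ T`, `v ∈ U`, for
some `p ∈ M`. -/
def Exchange (M : Submonoid (MvPolynomial (Fin 2) ℂ)) (T U : Set (VertexOperator ℂ W))
    (a c : VertexOperator ℂ W) : Prop :=
  ∃ p ∈ M, SwapSpan T U fun w => NonlocalVA.act (Fin 2) W p (pair a c w)

/-- The denominators of all `q i` are moved into the polynomial on the left, after which the
coefficients lie in `ℂ((x₁, x₂))`. -/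
theorem exchange_of_eq_sum {M : Submonoid (MvPolynomial (Fin 2) ℂ)} {a c : VertexOperator ℂ W}
    {p : MvPolynomial (Fin 2) ℂ} (hp : p ∈ M) {r : ℕ} {q : Fin r → IterField}
    {u v : Fin r → VertexOperator ℂ W} (hq : ∀ i, ∃ P ∈ M, polyEmb P * q i ∈ laurentRing)
    (hu : ∀ i, u i ∈ T) (hv : ∀ i, v i ∈ U)
    (h : ∀ w, NonlocalVA.act (Fin 2) W p (pair a c w) =
      ∑ i, toFormal (q i • comp₂ (u i) (v i) w)) : Exchange M T U a c := by
  choose P hP hq using hq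
  refine ⟨(∏ i, P i) * p, mul_mem (prod_mem fun i _ => hP i) hp, swapSpan_iff.2
    ⟨r, fun i => polyEmb (∏ i, P i) * q i, u, v, fun i => ?_, hu, hv, fun w => ?_⟩⟩
  · simp only
    rw [← Finset.prod_erase_mul _ _ (Finset.mem_univ i), map_mul, mul_assoc]
    exact mul_mem (polyEmb_mem _) (hq i)
  · rw [act_mul, h, map_sum]
    exact Finset.sum_congr rfl fun i _ => by rw [mul_smul, toFormal_polyEmb_smul]

end Span

/-! ### Laurent polynomials -/

section Laurent

open MvPolynomial (aeval X C rename)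

variable {W : Type*} [AddCommGroup W] [Module ℂ W] {U : Set (VertexOperator ℂ W)}

theorem lau_mul (p q : LaurentPoly 2) (F : (Fin 2 → ℤ) → W) :
    lau (Fin 2) W (p * q) F = lau (Fin 2) W p (lau (Fin 2) W q F) := by
  rw [map_mul]; rfl

theorem lau_polyToLaurent (p : MvPolynomial (Fin 2) ℂ) (F : (Fin 2 → ℤ) → W) :
    lau (Fin 2) W (polyToLaurent p) F = act (Fin 2) W p F := by
  rw [← laurentMul_eq_lau, ← polyMul_eq_act]; rfl

theorem polyToLaurent_ne_zero {p : MvPolynomial (Fin 2) ℂ} (hp : p ≠ 0) : polyToLaurent p ≠ 0 := by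
  intro h
  have h1 := eq_zero_of_act_eq_zero (W := ℂ) hp (F := fun m => if m = 0 then 1 else 0)
    ⟨0, fun m hm => if_neg fun h => by simp [h] at hm⟩
    (fun m => ⟨0, fun k hk => if_neg fun h => by
      have := congrFun h 1
      simp at this; omega⟩)
    (by rw [← lau_polyToLaurent, h, map_zero]; rfl)
  simpa using congrFun h1 0

theorem single_mul_single_neg (d : Fin 2 → ℤ) :
    (AddMonoidAlgebra.single d 1 * AddMonoidAlgebra.single (-d) 1 : LaurentPoly 2) = 1 := by
  rw [AddMonoidAlgebra.single_mul_single, add_neg_cancel, mul_one]; rfl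

theorem polyToLaurent_X_pow (s : Fin 2) (n : ℕ) :
    polyToLaurent (X s ^ n) = AddMonoidAlgebra.single (Pi.single s (n : ℤ)) (1 : ℂ) := by
  rw [map_pow, polyToLaurent, MvPolynomial.aeval_X, AddMonoidAlgebra.single_pow, one_pow]
  congr 1
  funext i
  simp [Pi.single_apply]

theorem polyToLaurent_X_pow_mul_X_pow (n : ℕ) : polyToLaurent (X 0 ^ n * X 1 ^ n) =
    AddMonoidAlgebra.single (fun _ : Fin 2 => (n : ℤ)) (1 : ℂ) := by
  rw [map_mul, polyToLaurent_X_pow, polyToLaurent_X_pow, AddMonoidAlgebra.single_mul_single,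
    mul_one]
  congr 1
  funext i
  fin_cases i <;> simp

theorem exists_polyToLaurent_eq (p : LaurentPoly 2) : ∃ (n : ℕ) (P : MvPolynomial (Fin 2) ℂ),
    polyToLaurent P = AddMonoidAlgebra.single (fun _ => (n : ℤ)) 1 * p := by
  induction p using AddMonoidAlgebra.induction_linear with
  | zero => exact ⟨0, 0, by simp⟩
  | add p q hp hq =>
    obtain ⟨n, P, hP⟩ := hp
    obtain ⟨k, Q, hQ⟩ := hq
    refine ⟨n + k, X 0 ^ k * X 1 ^ k * P + X 0 ^ n * X 1 ^ n * Q, ?_⟩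
    have : (AddMonoidAlgebra.single (fun _ => ((n + k : ℕ) : ℤ)) 1 : LaurentPoly 2) =
        AddMonoidAlgebra.single (fun _ => (n : ℤ)) 1 * AddMonoidAlgebra.single (fun _ => (k : ℤ)) 1 := by
      rw [AddMonoidAlgebra.single_mul_single, mul_one]
      congr 1
    rw [map_add, map_mul _ (X 0 ^ k * X 1 ^ k), map_mul _ (X 0 ^ n * X 1 ^ n),
      polyToLaurent_X_pow_mul_X_pow, polyToLaurent_X_pow_mul_X_pow, hP, hQ, this]; ring
  | single d c =>
    refine ⟨(-d 0).toNat + (-d 1).toNat, C c * (X 0 ^ (d 0 + ((-d 0).toNat + (-d 1).toNat)).toNat *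
      X 1 ^ (d 1 + ((-d 0).toNat + (-d 1).toNat)).toNat), ?_⟩
    rw [map_mul, map_mul, polyToLaurent_X_pow, polyToLaurent_X_pow,
      AddMonoidAlgebra.single_mul_single, AddMonoidAlgebra.single_mul_single,
      ← MvPolynomial.algebraMap_eq, AlgHom.commutes, ← Algebra.smul_def,
      AddMonoidAlgebra.smul_single, mul_one, one_mul, smul_eq_mul, mul_one]
    congr 1
    funext i
    fin_cases i <;> simp <;> omega

theorem toFormal_inn_pow_smul (n : ℕ) (F : IterModule W) :
    toFormal (inn ^ n • F) = lau (Fin 2) W (AddMonoidAlgebra.single ![0, (n : ℤ)] 1) (toFormal F) := by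
  have h : inn ^ n = polyEmb (X 1 ^ n) := by simp [polyEmb]
  rw [h, toFormal_polyEmb_smul, ← lau_polyToLaurent, polyToLaurent_X_pow]
  congr 3
  funext i; fin_cases i <;> simp

theorem IsPseudoLocal.exchange (h : IsPseudoLocal U) {a b : VertexOperator ℂ W} (ha : a ∈ U)
    (hb : b ∈ U) : Exchange (nonZeroDivisors _) U U a b := by
  obtain ⟨r, p, q, u, v, hp, hq, hu, hv, e⟩ := h a ha b hb
  obtain ⟨n, P, hP⟩ := exists_polyToLaurent_eq p
  have hP0 : P ≠ 0 := by
    rintro rfl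
    refine hp ?_
    have := congrArg (AddMonoidAlgebra.single (-fun _ => (n : ℤ)) 1 * ·) hP
    simp only [map_zero, mul_zero] at this
    rwa [← mul_assoc, mul_comm (AddMonoidAlgebra.single _ _), single_mul_single_neg, one_mul,
      eq_comm] at this
  -- Multiplication by a monomial turns the Laurent polynomial into a polynomial; the coefficients
  -- on the right absorb the same monomial.
  refine exchange_of_eq_sum (q := fun i => polyEmb (X 0 ^ n * X 1 ^ n) * q i)
    (mem_nonZeroDivisors_of_ne_zero hP0) (fun i => ?_) hu hv fun w => ?_
  · obtain ⟨f, d, hd, e⟩ := hq i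
    refine ⟨d, mem_nonZeroDivisors_of_ne_zero hd, ?_⟩
    rw [e, mul_left_comm, show aeval ![out, inn] d = polyEmb d from rfl,
      mul_div_cancel₀ _ (polyEmb_ne_zero hd)]
    exact mul_mem (polyEmb_mem _) (powerSeriesEmb_mem _)
  · have e' : lau (Fin 2) W p (pair a b w) = ∑ i, toFormal (q i • comp₂ (u i) (v i) w) := by
      funext m
      rw [← laurentMul_eq_lau, ← prodSeries_pair, show m = ![m 0, m 1] by
        funext i; fin_cases i <;> rfl, e, Finset.sum_apply]
      rfl
    rw [← lau_polyToLaurent, hP, ← polyToLaurent_X_pow_mul_X_pow, lau_mul, lau_polyToLaurent, e', map_sum]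
    exact Finset.sum_congr rfl fun i _ => by rw [mul_smul, toFormal_polyEmb_smul]

theorem isPseudoLocal_of_exchange
    (h : ∀ a ∈ U, ∀ b ∈ U, Exchange (nonZeroDivisors _) U U a b) : IsPseudoLocal U := by
  intro a ha b hb
  obtain ⟨p, hp, hs⟩ := h a ha b hb
  obtain ⟨r, q, u, v, hq, hu, hv, e⟩ := swapSpan_iff.1 hs
  refine ⟨r, polyToLaurent p, q, u, v,
    polyToLaurent_ne_zero (nonZeroDivisors.ne_zero hp), fun i => ?_, hu, hv, fun w m₁ m₂ => ?_⟩
  · obtain ⟨n, f, hf⟩ := hq i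
    have h0 : (X 0 * X 1 : MvPolynomial (Fin 2) ℂ) ^ n ≠ 0 :=
      pow_ne_zero _ (mul_ne_zero (MvPolynomial.X_ne_zero _) (MvPolynomial.X_ne_zero _))
    refine ⟨f, (X 0 * X 1) ^ n, h0, ?_⟩
    refine (eq_div_iff (polyEmb_ne_zero h0)).2 ?_
    rw [← hf, polyEmb]
    simp [mul_comm]
  · rw [laurentMul_eq_lau, prodSeries_pair, lau_polyToLaurent]
    have := congrFun (e w) ![m₁, m₂]
    rw [Finset.sum_apply] at this
    exact this

/-- The monoid generated by the forms `x₁ - α x₂` with `α ∈ Γ`. -/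
def gammaForms (Γ : Subgroup ℂˣ) : Submonoid (MvPolynomial (Fin 2) ℂ) :=
  Submonoid.closure {p | ∃ α ∈ Γ, p = X 0 - C (α : ℂ) * X 1}

variable {Γ : Subgroup ℂˣ}

/-- `P` is a homogenization of `p`. -/
def IsHomogenization (p : Polynomial ℂ) (P : MvPolynomial (Fin 2) ℂ) : Prop :=
  ∃ n : ℕ, polyToLaurent P = AddMonoidAlgebra.single ![0, (n : ℤ)] 1 * ratioToLaurent p ∧
    polyEmb P = inn ^ n * Polynomial.aeval (out / inn : IterField) p

theorem isHomogenization_one : IsHomogenization 1 1 :=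
  ⟨0, by
    rw [map_one, map_one, mul_one]
    have : (![0, ((0 : ℕ) : ℤ)] : Fin 2 → ℤ) = 0 := by funext i; fin_cases i <;> rfl
    rw [this]; rfl, by simp⟩

theorem IsHomogenization.mul {p q : Polynomial ℂ} {P Q : MvPolynomial (Fin 2) ℂ}
    (hp : IsHomogenization p P) (hq : IsHomogenization q Q) : IsHomogenization (p * q) (P * Q) := by
  obtain ⟨n, h1, h2⟩ := hp
  obtain ⟨k, h3, h4⟩ := hq
  refine ⟨n + k, ?_, ?_⟩
  · have : (AddMonoidAlgebra.single ![0, ((n + k : ℕ) : ℤ)] 1 : LaurentPoly 2) =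
        AddMonoidAlgebra.single ![0, (n : ℤ)] 1 * AddMonoidAlgebra.single ![0, (k : ℤ)] 1 := by
      rw [AddMonoidAlgebra.single_mul_single, mul_one]
      congr 1
      funext i; fin_cases i <;> simp
    rw [map_mul, map_mul, h1, h3, this]; ring
  · rw [map_mul, map_mul, h2, h4]; ring

theorem isHomogenization_sub (α : ℂ) :
    IsHomogenization (Polynomial.X - Polynomial.C α) (X 0 - C α * X 1) := by
  refine ⟨1, ?_, ?_⟩
  · have h0 := polyToLaurent_X_pow 0 1
    have h1 := polyToLaurent_X_pow 1 1
    rw [pow_one] at h0 h1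
    rw [map_sub, map_sub, map_mul, h0, h1, ratioToLaurent, Polynomial.aeval_X, Polynomial.aeval_C,
      ← MvPolynomial.algebraMap_eq, AlgHom.commutes, mul_sub, AddMonoidAlgebra.single_mul_single,
      mul_one, mul_comm (algebraMap _ _ _)]
    congr 2
    · funext i; fin_cases i <;> simp
    · exact congrArg (fun d => AddMonoidAlgebra.single d (1 : ℂ)) (by
        funext i; fin_cases i <;> simp)
  · rw [map_sub, map_sub, map_mul, Polynomial.aeval_X, Polynomial.aeval_C,
      ← MvPolynomial.algebraMap_eq, AlgHom.commutes, pow_one, mul_sub, mul_div_cancel₀ _ inn_ne_zero,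
      mul_comm inn]
    simp [polyEmb]

theorem exists_isHomogenization {p : Polynomial ℂ} (hp : p ∈ gammaPoly Γ) :
    ∃ P ∈ gammaForms Γ, IsHomogenization p P := by
  induction hp using Submonoid.closure_induction with
  | mem p hp =>
    obtain ⟨α, hα, rfl⟩ := hp
    exact ⟨_, Submonoid.subset_closure ⟨α, hα, rfl⟩, isHomogenization_sub α⟩
  | one => exact ⟨1, one_mem _, isHomogenization_one⟩
  | mul p q _ _ hp hq =>
    obtain ⟨P, hP, h1⟩ := hp
    obtain ⟨Q, hQ, h2⟩ := hq
    exact ⟨P * Q, mul_mem hP hQ, h1.mul h2⟩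

theorem exists_isHomogenization' {P : MvPolynomial (Fin 2) ℂ} (hP : P ∈ gammaForms Γ) :
    ∃ p ∈ gammaPoly Γ, IsHomogenization p P := by
  induction hP using Submonoid.closure_induction with
  | mem p hp =>
    obtain ⟨α, hα, rfl⟩ := hp
    exact ⟨_, Submonoid.subset_closure ⟨α, hα, rfl⟩, isHomogenization_sub α⟩
  | one => exact ⟨1, one_mem _, isHomogenization_one⟩
  | mul p q _ _ hp hq =>
    obtain ⟨P, hP, h1⟩ := hp
    obtain ⟨Q, hQ, h2⟩ := hq
    exact ⟨P * Q, mul_mem hP hQ, h1.mul h2⟩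

theorem gammaPoly_ne_zero {p : Polynomial ℂ} (hp : p ∈ gammaPoly Γ) : p ≠ 0 := by
  induction hp using Submonoid.closure_induction with
  | mem p hp =>
    obtain ⟨α, -, rfl⟩ := hp
    exact Polynomial.X_sub_C_ne_zero _
  | one => exact one_ne_zero
  | mul p q _ _ hp hq => exact mul_ne_zero hp hq

theorem gammaForms_le : gammaForms Γ ≤ nonZeroDivisors (MvPolynomial (Fin 2) ℂ) := by
  refine (Submonoid.closure_le).2 ?_
  rintro _ ⟨α, -, rfl⟩
  refine mem_nonZeroDivisors_of_ne_zero fun h => ?_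
  -- At `(1, 0)` every form `x₁ - α x₂` takes the value `1`.
  have := congrArg (MvPolynomial.eval ![1, 0]) h
  simp at this

/-- The only inverses other than those of `x₁, x₂` are inverses of forms, so a product of forms is a
common denominator. -/
theorem exists_polyEmb_mul_mem {q : IterField} (hq : q ∈ iotaGamma Γ) :
    ∃ P ∈ gammaForms Γ, polyEmb P * q ∈ laurentRing := by
  induction hq using Subring.closure_induction with
  | mem q hq =>
    rcases hq with (⟨f, rfl⟩ | hq) | ⟨α, hα, rfl⟩
    · exact ⟨1, one_mem _, by rw [map_one, one_mul]; exact powerSeriesEmb_mem f⟩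
    · have hmem : ∀ q : IterField, ∀ f, out * inn * q = powerSeriesEmb f → q ∈ laurentRing :=
        fun q f h => ⟨1, f, by rw [pow_one, h]⟩
      refine ⟨1, one_mem _, ?_⟩
      rw [map_one, one_mul]
      rcases hq with rfl | rfl
      · refine hmem _ (PowerSeries.C PowerSeries.X) ?_
        rw [powerSeriesEmb_C_X, mul_right_comm, mul_inv_cancel₀ out_ne_zero, one_mul]
      · refine hmem _ PowerSeries.X ?_
        rw [powerSeriesEmb_X, mul_assoc, mul_inv_cancel₀ inn_ne_zero, mul_one]
    · refine ⟨X 0 - C (α : ℂ) * X 1, Submonoid.subset_closure ⟨α, hα, rfl⟩, ?_⟩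
      have h0 : polyEmb (X 0 - C (α : ℂ) * X 1) ≠ 0 := polyEmb_ne_zero
        (nonZeroDivisors.ne_zero (gammaForms_le (Submonoid.subset_closure ⟨α, hα, rfl⟩)))
      have h1 : polyEmb (X 0 - C (α : ℂ) * X 1) = out - algebraMap ℂ IterField α * inn := by
        rw [map_sub, map_mul, ← MvPolynomial.algebraMap_eq, AlgHom.commutes]
        simp [polyEmb]
      rw [← h1, mul_inv_cancel₀ h0]
      exact one_mem _
  | zero => exact ⟨1, one_mem _, by rw [mul_zero]; exact zero_mem _⟩
  | one => exact ⟨1, one_mem _, by rw [map_one, mul_one]; exact one_mem _⟩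
  | add p q _ _ hp hq =>
    obtain ⟨P, hP, h1⟩ := hp
    obtain ⟨Q, hQ, h2⟩ := hq
    refine ⟨P * Q, mul_mem hP hQ, ?_⟩
    rw [show polyEmb (P * Q) * (p + q) = polyEmb Q * (polyEmb P * p) + polyEmb P * (polyEmb Q * q) by
      rw [map_mul]; ring]
    exact add_mem (mul_mem (polyEmb_mem _) h1) (mul_mem (polyEmb_mem _) h2)
  | neg p _ hp =>
    obtain ⟨P, hP, h1⟩ := hp
    exact ⟨P, hP, by rw [mul_neg]; exact neg_mem h1⟩
  | mul p q _ _ hp hq =>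
    obtain ⟨P, hP, h1⟩ := hp
    obtain ⟨Q, hQ, h2⟩ := hq
    refine ⟨P * Q, mul_mem hP hQ, ?_⟩
    rw [map_mul, mul_mul_mul_comm]
    exact mul_mem h1 h2

theorem IsPseudoGammaLocal.exchange (h : IsPseudoGammaLocal Γ U) {a b : VertexOperator ℂ W}
    (ha : a ∈ U) (hb : b ∈ U) : Exchange (gammaForms Γ) U U a b := by
  obtain ⟨r, p, q, u, v, -, hp, hq, hu, hv, e⟩ := h a ha b hb
  obtain ⟨P, hP, n, h1, h2⟩ := exists_isHomogenization hp
  refine exchange_of_eq_sum (q := fun i => polyEmb P * q i) hP (fun i => ?_) hu hv fun w => ?_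
  · obtain ⟨Q, hQ, h3⟩ := exists_polyEmb_mul_mem (hq i)
    exact ⟨Q, hQ, by rw [mul_left_comm]; exact mul_mem (polyEmb_mem _) h3⟩
  · have e' : lau (Fin 2) W (ratioToLaurent p) (pair a b w) = ∑ i, toFormal
        ((Polynomial.aeval (out / inn : IterField) p * q i) • comp₂ (u i) (v i) w) := by
      funext m
      rw [← laurentMul_eq_lau, ← prodSeries_pair, show m = ![m 0, m 1] by
        funext i; fin_cases i <;> rfl, e, Finset.sum_apply]
      rfl
    rw [← lau_polyToLaurent, h1, lau_mul, e', map_sum]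
    refine Finset.sum_congr rfl fun i _ => ?_
    rw [← toFormal_inn_pow_smul, ← mul_smul, h2, mul_assoc]

theorem inv_polyEmb_mem {P : MvPolynomial (Fin 2) ℂ} (hP : P ∈ gammaForms Γ) :
    (polyEmb P)⁻¹ ∈ iotaGamma Γ := by
  induction hP using Submonoid.closure_induction with
  | mem P hP =>
    obtain ⟨α, hα, rfl⟩ := hP
    refine Subring.subset_closure (Or.inr ⟨α, hα, ?_⟩)
    rw [map_sub, map_mul, ← MvPolynomial.algebraMap_eq, AlgHom.commutes]
    simp [polyEmb]
  | one => rw [map_one, inv_one]; exact one_mem _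
  | mul P Q _ _ hP hQ => rw [map_mul, mul_inv]; exact mul_mem hP hQ

theorem laurentRing_le : laurentRing ≤ iotaGamma Γ := by
  rintro q ⟨n, f, hf⟩
  have h : q = out⁻¹ ^ n * inn⁻¹ ^ n * powerSeriesEmb f := by
    rw [← hf, ← mul_pow, ← mul_assoc, ← mul_pow, ← mul_inv,
      inv_mul_cancel₀ (mul_ne_zero out_ne_zero inn_ne_zero), one_pow, one_mul]
  rw [h]
  exact mul_mem (mul_mem (pow_mem (Subring.subset_closure (by simp)) _)
    (pow_mem (Subring.subset_closure (by simp)) _)) (Subring.subset_closure (by simp))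

/-- The definition carries `p(x₁/x₂)` on both sides, so the coefficients are divided by the form
`P`; this stays in `ℂ_Γ`. Since `P = x₂^n p(x₁/x₂)`, the two conventions differ by an invertible
monomial. -/
theorem isPseudoGammaLocal_of_exchange
    (h : ∀ a ∈ U, ∀ b ∈ U, Exchange (gammaForms Γ) U U a b) : IsPseudoGammaLocal Γ U := by
  intro a ha b hb
  obtain ⟨P, hP, hs⟩ := h a ha b hb
  obtain ⟨r, q, u, v, hq, hu, hv, e⟩ := swapSpan_iff.1 hs
  obtain ⟨p, hp, n, h1, h2⟩ := exists_isHomogenization' hP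
  have hP0 : polyEmb P ≠ 0 := polyEmb_ne_zero (nonZeroDivisors.ne_zero (gammaForms_le hP))
  refine ⟨r, p, fun i => (polyEmb P)⁻¹ * q i, u, v, gammaPoly_ne_zero hp, hp, fun i =>
    mul_mem (inv_polyEmb_mem hP) (laurentRing_le (hq i)), hu, hv, fun w m₁ m₂ => ?_⟩
  have key : lau (Fin 2) W (ratioToLaurent p) (pair a b w) = ∑ i, toFormal
      ((Polynomial.aeval (out / inn : IterField) p * ((polyEmb P)⁻¹ * q i)) •
        comp₂ (u i) (v i) w) := by
    have hinj : Function.Injective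
        (lau (Fin 2) W (AddMonoidAlgebra.single ![0, (n : ℤ)] 1)) := by
      intro F G hFG
      have := congrArg (lau (Fin 2) W (AddMonoidAlgebra.single (-![0, (n : ℤ)]) 1)) hFG
      rwa [← lau_mul, ← lau_mul, mul_comm, single_mul_single_neg, map_one] at this
    refine hinj ?_
    rw [← lau_mul, ← h1, lau_polyToLaurent, e, map_sum]
    refine Finset.sum_congr rfl fun i _ => ?_
    rw [← toFormal_inn_pow_smul, ← mul_smul, ← mul_assoc, ← h2, mul_inv_cancel_left₀ hP0]
  rw [laurentMul_eq_lau, prodSeries_pair, key, Finset.sum_apply]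
  rfl

end Laurent

/-! ### Quasi compatibility of words -/

section Words

open MvPolynomial (aeval X C rename)

variable {ι : Type*} [DecidableEq ι] {W : Type*} [AddCommGroup W] [Module ℂ W]

/-- The product `a₁(x_{i₁}) ⋯ a_r(x_{i_r})` of a labelled word. -/
def wordOp (L : List (ι × VertexOperator ℂ W)) (m : ι → ℤ) : Module.End ℂ W :=
  (L.map fun x => (HVertexOperator.coeff x.2 (m x.1) : Module.End ℂ W)).prod

theorem wordOp_append (A B : List (ι × VertexOperator ℂ W)) (m : ι → ℤ) :
    wordOp (A ++ B) m = wordOp A m * wordOp B m := by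
  rw [wordOp, List.map_append, List.prod_append]; rfl

theorem wordOp_cons (x : ι × VertexOperator ℂ W) (B : List (ι × VertexOperator ℂ W)) (m : ι → ℤ)
    (w : W) : wordOp (x :: B) m w = HVertexOperator.coeff x.2 (m x.1) (wordOp B m w) := by
  rw [wordOp, List.map_cons, List.prod_cons]; rfl

theorem wordOp_append_apply (A B : List (ι × VertexOperator ℂ W)) (m : ι → ℤ) (w : W) :
    wordOp (A ++ B) m w = wordOp A m (wordOp B m w) := by
  rw [wordOp_append]; rfl

/-- The series `a₁(x_{i₁}) ⋯ a_r(x_{i_r}) w`. -/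
def wordSeries (L : List (ι × VertexOperator ℂ W)) (w : W) : (ι → ℤ) → W := fun m => wordOp L m w

theorem wordOp_map {κ : Type*} (f : ι → κ) (L : List (ι × VertexOperator ℂ W)) (m : κ → ℤ) :
    wordOp (L.map (Prod.map f id)) m = wordOp L (m ∘ f) := by
  rw [wordOp, wordOp, List.map_map]; rfl

theorem indepOf_wordOp {τ : Type*} {e : τ → ι} {L : List (ι × VertexOperator ℂ W)}
    (h : ∀ x ∈ L, ∀ t, e t ≠ x.1) : IndepOf e (wordOp L) := by
  intro m d
  refine congrArg List.prod (List.map_congr_left fun x hx => ?_)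
  rw [Function.extend_apply' _ _ _ (by rintro ⟨t, ht⟩; exact h x hx t ht)]

theorem spread_pair_wordOp (A B : List (ι × VertexOperator ℂ W)) (i j : ι)
    (a b : VertexOperator ℂ W) (w : W) :
    spread ![i, j] (wordOp A) (wordOp B) (pair a b) w =
      wordSeries (A ++ (i, a) :: (j, b) :: B) w := by
  funext m
  rw [wordSeries, wordOp_append_apply, wordOp_cons, wordOp_cons]; rfl

theorem spread_opPair_wordOp (A B : List (ι × VertexOperator ℂ W)) (i j : ι)
    (u v : VertexOperator ℂ W) (w : W) :
    spread ![i, j] (wordOp A) (wordOp B) (opPair u v) w =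
      wordSeries (A ++ (j, u) :: (i, v) :: B) w := by
  funext m
  rw [wordSeries, wordOp_append_apply, wordOp_cons, wordOp_cons]; rfl

variable (ι) in
/-- The monoid generated by the nonzero polynomials in `x_i, x_j` with `i ≠ j` and the nonzero
polynomials in one of the variables. -/
def pairMonoid : Submonoid (MvPolynomial ι ℂ) :=
  Submonoid.closure ({P | ∃ (i j : ι) (p : MvPolynomial (Fin 2) ℂ), i ≠ j ∧ p ≠ 0 ∧
    P = rename ![i, j] p} ∪ {P | ∃ (i : ι) (q : Polynomial ℂ), q ≠ 0 ∧ P = Polynomial.aeval (X i) q})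

theorem rename_mem_pairMonoid {i j : ι} (hij : i ≠ j) {p : MvPolynomial (Fin 2) ℂ} (hp : p ≠ 0) :
    rename ![i, j] p ∈ pairMonoid ι :=
  Submonoid.subset_closure (Or.inl ⟨i, j, p, hij, hp, rfl⟩)

theorem aeval_mem_pairMonoid (i : ι) {q : Polynomial ℂ} (hq : q ≠ 0) :
    Polynomial.aeval (X i) q ∈ pairMonoid ι :=
  Submonoid.subset_closure (Or.inr ⟨i, q, hq, rfl⟩)

/-- A word is tame if some product of polynomials in two variables maps it to
`Hom (W, W((x₁, …, x_r)))`. -/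
def TameWord (L : List (ι × VertexOperator ℂ W)) : Prop :=
  ∃ P ∈ pairMonoid ι, ∀ w, LowerTrunc (act ι W P (wordSeries L w))

/-- The series is bounded below in the variable `x_i`. -/
def VarBdd (i : ι) (F : (ι → ℤ) → W) : Prop := ∃ N : ℤ, ∀ m, m i < N → F m = 0

theorem VarBdd.add {i : ι} {F G : (ι → ℤ) → W} (hF : VarBdd i F) (hG : VarBdd i G) :
    VarBdd i (F + G) := by
  obtain ⟨N, hN⟩ := hF
  obtain ⟨M, hM⟩ := hG
  exact ⟨min N M, fun m hm => by
    rw [Pi.add_apply, hN m (by omega), hM m (by omega), add_zero]⟩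

theorem VarBdd.act {i : ι} {F : (ι → ℤ) → W} (hF : VarBdd i F) (p : MvPolynomial ι ℂ) :
    VarBdd i (act ι W p F) := by
  obtain ⟨N, hN⟩ := hF
  refine ⟨N, IsDown.act_eq_zero (D := {m | m i < N}) ?_ p hN⟩
  intro m hm s
  have : (m - Pi.single s 1 : ι → ℤ) i ≤ m i := by
    simp only [Pi.sub_apply, Pi.single_apply]; split_ifs <;> omega
  exact lt_of_le_of_lt this hm

variable {S : Set (VertexOperator ℂ W)}

/-- If the letter `ψ` stands last it acts directly on `w`, so its variable is bounded below.
Otherwise it is exchanged with its right neighbour, which costs a nonzero polynomial in two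
variables, and the number of letters to its right drops. -/
theorem exists_varBdd_word
    (hS : ∀ a ∈ S, ∀ b ∈ S, Exchange (nonZeroDivisors _) S S a b)
    (B : List (ι × VertexOperator ℂ W)) (A : List (ι × VertexOperator ℂ W)) (i : ι)
    {ψ : VertexOperator ℂ W} (hA : ∀ x ∈ A, x.2 ∈ S) (hB : ∀ x ∈ B, x.2 ∈ S) (hψ : ψ ∈ S)
    (hd : ((A ++ (i, ψ) :: B).map Prod.fst).Nodup) :
    ∃ P ∈ pairMonoid ι, ∀ w, VarBdd i (act ι W P (wordSeries (A ++ (i, ψ) :: B) w)) := by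
  induction B generalizing A ψ with
  | nil =>
    refine ⟨1, one_mem _, fun w => ?_⟩
    obtain ⟨N, hN⟩ := coeff_bddBelow ψ w
    refine ⟨N, fun m hm => ?_⟩
    rw [act_one, wordSeries, wordOp_append_apply, wordOp_cons]
    simp only [wordOp, List.map_nil, List.prod_nil, Module.End.one_apply]
    rw [hN _ hm, map_zero]
  | cons y B ih =>
    obtain ⟨j, φ⟩ := y
    have hφ : φ ∈ S := hB (j, φ) (by simp)
    have hd' : i ≠ j ∧ (∀ x ∈ A, x.1 ≠ i ∧ x.1 ≠ j) ∧ (∀ x ∈ B, x.1 ≠ i ∧ x.1 ≠ j) := by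
      simp only [List.map_append, List.map_cons, List.nodup_append, List.nodup_cons, List.mem_cons,
        List.mem_map, not_or] at hd
      obtain ⟨-, ⟨⟨hij, hiB⟩, hjB, -⟩, hAB⟩ := hd
      refine ⟨hij, fun x hx => ⟨?_, ?_⟩, fun x hx => ⟨?_, ?_⟩⟩
      · exact hAB _ ⟨x, hx, rfl⟩ _ (Or.inl rfl)
      · exact hAB _ ⟨x, hx, rfl⟩ _ (Or.inr (Or.inl rfl))
      · exact fun h => hiB ⟨x, hx, h⟩
      · exact fun h => hjB ⟨x, hx, h⟩
    obtain ⟨hij, hAi, hBi⟩ := hd'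
    have he : Function.Injective ![i, j] := by
      intro s t hst
      fin_cases s <;> fin_cases t <;> simp_all
    have iA : IndepOf ![i, j] (wordOp A) := indepOf_wordOp fun x hx t => by
      fin_cases t
      exacts [(hAi x hx).1.symm, (hAi x hx).2.symm]
    have iB : IndepOf ![i, j] (wordOp B) := indepOf_wordOp fun x hx t => by
      fin_cases t
      exacts [(hBi x hx).1.symm, (hBi x hx).2.symm]
    have key : ∀ {Φ : W → (Fin 2 → ℤ) → W}, SwapSpan S S Φ → ∃ P ∈ pairMonoid ι, ∀ w,
        VarBdd i (act ι W P (spread ![i, j] (wordOp A) (wordOp B) Φ w)) := by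
      intro Φ hΦ
      unfold SwapSpan at hΦ
      induction hΦ with
      | base hb =>
        obtain ⟨u, hu, v, hv, rfl⟩ := hb
        -- After the exchange `u` carries the label `j` and joins the left part, while `v` keeps the
        -- label `i` and has one letter fewer to its right.
        obtain ⟨P, hP, h⟩ := ih (A ++ [(j, u)]) (ψ := v)
          (by simpa [or_imp, forall_and] using ⟨fun a b h => hA (a, b) h, hu⟩)
          (fun x hx => hB x (List.mem_cons_of_mem _ hx)) hv (by
            have : (((A ++ [(j, u)]) ++ (i, v) :: B).map Prod.fst).Perm
                ((A ++ (i, ψ) :: (j, φ) :: B).map Prod.fst) := by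
              simp only [List.map_append, List.map_cons, List.map_nil, List.append_assoc,
                List.cons_append, List.nil_append]
              exact (List.Perm.swap _ _ _).append_left _
            exact this.nodup_iff.2 hd)
        refine ⟨P, hP, fun w => ?_⟩
        rw [spread_opPair_wordOp]
        simpa using h w
      | zero =>
        refine ⟨1, one_mem _, fun w => ⟨0, fun m _ => ?_⟩⟩
        rw [act_one]
        exact map_zero _
      | @add Φ Ψ _ _ h1 h2 =>
        obtain ⟨P, hP, h1⟩ := h1
        obtain ⟨Q, hQ, h2⟩ := h2
        refine ⟨P * Q, mul_mem hP hQ, fun w => ?_⟩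
        have : spread ![i, j] (wordOp A) (wordOp B) (fun w => Φ w + Ψ w) w =
            spread ![i, j] (wordOp A) (wordOp B) Φ w + spread ![i, j] (wordOp A) (wordOp B) Ψ w := by
          funext m; simp [spread]
        rw [this, map_add]
        refine VarBdd.add ?_ ?_
        · rw [mul_comm, act_mul]; exact (h1 w).act Q
        · rw [act_mul]; exact (h2 w).act P
      | conv hr hq hΦ ih =>
        obtain ⟨rfl, rfl⟩ := hr
        obtain ⟨P, hP, h⟩ := ih
        have hc := SwapSpan.convolvable hΦ hq
        refine ⟨P, hP, fun w => ?_⟩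
        -- Series in `ℂ((x_i, x_j))` commute with polynomials and preserve boundedness in `x_i`, so
        -- they cost no further factor.
        rw [← conv_spread he iA iB hc, ← conv_act (convolvable_spread he iA iB hc w)]
        exact bddBelow_conv hq hij i (h w)
    obtain ⟨p, hp, h⟩ := hS ψ hψ φ hφ
    obtain ⟨P, hP, h⟩ := key h
    refine ⟨P * rename ![i, j] p,
      mul_mem hP (rename_mem_pairMonoid hij (nonZeroDivisors.ne_zero hp)), fun w => ?_⟩
    rw [act_mul, ← spread_pair_wordOp, act_spread he iA iB]
    exact h w

/-- Each variable can be bounded separately by some polynomial; the product of these polynomials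
bounds all of them simultaneously. -/
theorem tameWord_of_exchange (hS : ∀ a ∈ S, ∀ b ∈ S, Exchange (nonZeroDivisors _) S S a b)
    (L : List (ι × VertexOperator ℂ W)) (hL : ∀ x ∈ L, x.2 ∈ S) (hd : (L.map Prod.fst).Nodup)
    (hc : ∀ i, i ∈ L.map Prod.fst) : TameWord L := by
  have h : ∀ i, ∃ P ∈ pairMonoid ι, ∀ w, VarBdd i (act ι W P (wordSeries L w)) := by
    intro i
    obtain ⟨⟨i', ψ⟩, hx, rfl⟩ := List.mem_map.1 (hc i)
    obtain ⟨A, B, rfl⟩ := List.append_of_mem hx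
    exact exists_varBdd_word hS B A i' (fun x hx => hL x (by simp [hx]))
      (fun x hx => hL x (by simp [hx])) (hL (i', ψ) hx) hd
  choose P hP h using h
  set I := (L.map Prod.fst).toFinset
  have hI : ∀ i, i ∈ I := fun i => List.mem_toFinset.2 (hc i)
  refine ⟨∏ i ∈ I, P i, prod_mem fun i _ => hP i, fun w => ?_⟩
  have h' : ∀ i, VarBdd i (act ι W (∏ i ∈ I, P i) (wordSeries L w)) := by
    intro i
    rw [← Finset.prod_erase_mul _ _ (hI i), act_mul]
    exact (h i w).act _
  choose N hN using h'
  obtain ⟨K, hK⟩ := (I.image N).bddBelow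
  refine ⟨K, fun m ⟨i, hi⟩ => hN i m (lt_of_lt_of_le hi (hK ?_))⟩
  exact Finset.mem_coe.2 (Finset.mem_image_of_mem _ (hI i))

end Words

/-! ### Series in an additional variable -/

section Slice

open MvPolynomial (aeval X C rename)

variable {ι : Type*} [DecidableEq ι] {W : Type*} [AddCommGroup W] [Module ℂ W]

/-- The coefficient of `x_none^k`. -/
def slice (k : ℤ) (F : (Option ι → ℤ) → W) : (ι → ℤ) → W := fun d => F fun o => o.elim k d

theorem restrict_some (m : Option ι → ℤ) (F : (Option ι → ℤ) → W) :
    restrict some m F = slice (m none) F := by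
  funext d
  refine congrArg F (funext fun o => ?_)
  cases o with
  | none => exact Function.extend_apply' _ _ _ (by simp)
  | some i => exact (Option.some_injective ι).extend_apply _ _ _

theorem slice_eq_restrict (k : ℤ) (F : (Option ι → ℤ) → W) :
    slice k F = restrict some (fun _ => k) F := by rw [restrict_some]

theorem slice_act_rename (k : ℤ) (p : MvPolynomial ι ℂ) (F : (Option ι → ℤ) → W) :
    slice k (act (Option ι) W (rename some p) F) = act ι W p (slice k F) := by
  rw [slice_eq_restrict, slice_eq_restrict, restrict_act _ (Option.some_injective ι)]

theorem slice_act_X_none (k : ℤ) (F : (Option ι → ℤ) → W) :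
    slice k (act (Option ι) W (X none) F) = slice (k - 1) F := by
  funext d
  rw [slice, act_X]
  refine congrArg F (funext fun o => ?_)
  cases o <;> simp

theorem slice_act_X_none_pow (k : ℤ) (n : ℕ) (F : (Option ι → ℤ) → W) :
    slice k (act (Option ι) W (X none ^ n) F) = slice (k - n) F := by
  funext d
  rw [slice, act_X_pow]
  refine congrArg F (funext fun o => ?_)
  cases o <;> simp

theorem slice_add (k : ℤ) (F G : (Option ι → ℤ) → W) :
    slice k (F + G) = slice k F + slice k G := rfl

/-- A class of families of series that is closed under sums and multiplication by polynomials. -/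
structure IsActClosed (Q : (W → (ι → ℤ) → W) → Prop) : Prop where
  zero : Q fun _ => 0
  add : ∀ {Φ Ψ : W → (ι → ℤ) → W}, Q Φ → Q Ψ → Q fun w => Φ w + Ψ w
  act : ∀ {Φ : W → (ι → ℤ) → W} (p : MvPolynomial ι ℂ), Q Φ → Q fun w => act ι W p (Φ w)

theorem IsActClosed.slice_act {Q : (W → (ι → ℤ) → W) → Prop} (hQ : IsActClosed Q)
    {Ψ : W → (Option ι → ℤ) → W} {K : ℤ} {g : MvPolynomial ι ℂ}
    (h : ∀ k ≤ K, Q fun w => NonlocalVA.act ι W g (slice k (Ψ w))) (p : MvPolynomial (Option ι) ℂ) :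
    ∀ k ≤ K, Q fun w => NonlocalVA.act ι W g (slice k (NonlocalVA.act (Option ι) W p (Ψ w))) := by
  induction p using MvPolynomial.induction_on with
  | C a =>
    intro k hk
    have e : (C a : MvPolynomial (Option ι) ℂ) = rename some (C a) := by simp
    simp only [e, slice_act_rename]
    simp only [act_comm g]
    exact hQ.act _ (h k hk)
  | add p q hp hq =>
    intro k hk
    simp only [act_add, slice_add]
    simp only [map_add]
    exact hQ.add (hp k hk) (hq k hk)
  | mul_X p u hp =>
    intro k hk
    simp only [mul_comm p, act_mul]
    cases u with
    | none =>
      simp only [slice_act_X_none]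
      exact hp _ (by omega)
    | some i =>
      have e : (X (some i) : MvPolynomial (Option ι) ℂ) = rename some (X i) := by simp
      simp only [e, slice_act_rename]
      simp only [act_comm g]
      exact hQ.act _ (hp k hk)

/-- If the coefficients of `(P(x) + x_none h) Ψ` lie in a class, then the coefficients of `Ψ` do
after multiplication by powers of `P`. -/
theorem IsActClosed.exists_pow {Q : (W → (ι → ℤ) → W) → Prop} (hQ : IsActClosed Q)
    {Ψ : W → (Option ι → ℤ) → W} {N : ℤ} (hN : ∀ k < N, ∀ w, slice k (Ψ w) = 0)
    {P : MvPolynomial ι ℂ} {h : MvPolynomial (Option ι) ℂ}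
    (hP : ∀ k, Q fun w => slice k (NonlocalVA.act (Option ι) W (rename some P + X none * h) (Ψ w)))
    (k : ℤ) : ∃ n, Q fun w => NonlocalVA.act ι W (P ^ n) (slice k (Ψ w)) := by
  -- The given relation expresses `P` times the `k`-th coefficient through lower coefficients of
  -- `Ψ`, so each step up costs one more factor `P`.
  have key : ∀ n : ℕ, ∀ k < N + n, Q fun w => NonlocalVA.act ι W (P ^ n) (slice k (Ψ w)) := by
    intro n
    induction n with
    | zero =>
      intro k hk
      simp only [hN k (by simpa using hk), map_zero]
      exact hQ.zero
    | succ n ih =>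
      intro k hk
      have e : ∀ w, NonlocalVA.act ι W (P ^ (n + 1)) (slice k (Ψ w)) =
          NonlocalVA.act ι W (P ^ n) (slice k (NonlocalVA.act (Option ι) W
            (rename some P + X none * h) (Ψ w))) +
          NonlocalVA.act ι W (C (-1)) (NonlocalVA.act ι W (P ^ n) (slice (k - 1)
            (NonlocalVA.act (Option ι) W h (Ψ w)))) := by
        intro w
        rw [act_add, slice_add, map_add, act_mul, slice_act_X_none, slice_act_rename, ← act_mul,
          ← pow_succ, act_C]
        simp
      simp only [e]
      refine hQ.add (hQ.act _ (hP k)) (hQ.act _ ?_)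
      exact hQ.slice_act (K := N + n - 1) (fun j hj => ih j (by omega)) h _ (by push_cast at hk; omega)
  refine ⟨(k - N + 1).toNat, key _ _ ?_⟩
  omega

end Slice

/-! ### Leading coefficients -/

section Lead

open MvPolynomial (aeval X C rename)

variable {ι : Type*} [DecidableEq ι]

theorem aeval_X_ne_zero (i : ι) {q : Polynomial ℂ} (hq : q ≠ 0) :
    (Polynomial.aeval (X i : MvPolynomial ι ℂ) q) ≠ 0 := by
  intro h
  refine hq ?_
  have := congrArg (aeval fun _ : ι => (Polynomial.X : Polynomial ℂ)) h
  rwa [← Polynomial.aeval_algHom_apply, MvPolynomial.aeval_X, Polynomial.aeval_X_left_apply,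
    map_zero] at this

/-- `F = x_none^l (P + x_none h)` for some `P ∈ M`. -/
def HasLead (M : Submonoid (MvPolynomial ι ℂ)) (F : MvPolynomial (Option ι) ℂ) : Prop :=
  ∃ (l : ℕ) (P : MvPolynomial ι ℂ) (h : MvPolynomial (Option ι) ℂ), P ∈ M ∧
    F = X none ^ l * (rename some P + X none * h)

variable {M : Submonoid (MvPolynomial ι ℂ)}

theorem HasLead.one : HasLead M 1 := ⟨0, 1, 0, one_mem _, by simp⟩

theorem HasLead.mul {F G : MvPolynomial (Option ι) ℂ} (hF : HasLead M F) (hG : HasLead M G) :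
    HasLead M (F * G) := by
  obtain ⟨l, P, h, hP, rfl⟩ := hF
  obtain ⟨k, Q, g, hQ, rfl⟩ := hG
  refine ⟨l + k, P * Q, rename some P * g + h * rename some Q + X none * h * g, mul_mem hP hQ, ?_⟩
  rw [map_mul]; ring

theorem hasLead_of_setZero {F : MvPolynomial (Option ι) ℂ} {P : MvPolynomial ι ℂ} (hP : P ∈ M)
    (h : setZero none F = rename some P) : HasLead M F := by
  obtain ⟨g, hg⟩ := eq_setZero_add none F
  exact ⟨0, P, g, hP, by rw [pow_zero, one_mul, ← h]; exact hg⟩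

/-- Substituting `x_none ↦ x_none + x_i` and then setting `x_none = 0` just identifies `x_none` with
`x_i`. -/
theorem setZero_substAlg_rename (i : ι) {κ : Type*} (f : κ → Option ι) (p : MvPolynomial κ ℂ) :
    setZero none (substAlg none (some i) (rename f p)) =
      rename some (rename (fun t => (f t).getD i) p) := by
  simp only [← AlgHom.comp_apply]
  refine DFunLike.congr_fun (MvPolynomial.algHom_ext fun u => ?_) p
  simp only [AlgHom.comp_apply, MvPolynomial.rename_X]
  cases h : f u with
  | none => rw [substAlg_X_self, map_add, setZero_X_self, setZero_X_ne (by simp)]; simp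
  | some j => rw [substAlg_X_ne (by simp), setZero_X_ne (by simp)]; simp

/-- The polynomial `p(x_i + x_none, x_i)` has a univariate leading coefficient. -/
theorem exists_substAlg_eq (i : ι) {p : MvPolynomial (Fin 2) ℂ} (hp : p ≠ 0) :
    ∃ (l : ℕ) (g : Polynomial ℂ) (h : MvPolynomial (Option ι) ℂ), g ≠ 0 ∧
      substAlg none (some i) (rename ![none, some i] p) =
        X none ^ l * (rename some (Polynomial.aeval (X i) g) + X none * h) := by
  have he : Function.Injective ![none, some i] := by
    intro s t hst
    fin_cases s <;> fin_cases t <;> simp_all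
  obtain ⟨l, g, g₀, e, hg₀, hg⟩ := exists_eq_X_pow_mul_fin_two (substAlg 0 1 p)
    ((map_ne_zero_iff _ (substAlg_injective (by decide))).2 hp)
  obtain ⟨h, hh⟩ := eq_setZero_add 0 g
  refine ⟨l, g₀, rename ![none, some i] h, hg₀, ?_⟩
  have e1 := rename_substAlg ![none, some i] he 0 1 p
  simp only [Matrix.cons_val_zero, Matrix.cons_val_one] at e1
  rw [← e1, e, map_mul, map_pow, hh, hg, map_add, map_mul, MvPolynomial.rename_X,
    ← Polynomial.aeval_algHom_apply, ← Polynomial.aeval_algHom_apply]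
  simp

/-- A factor in two variables that stay distinct after the identification has itself, relabelled, as
lowest coefficient. A factor in `x_none, x_i` has a lowest coefficient in `x_i` alone, which is why
`pairMonoid` also contains polynomials in one variable. -/
theorem hasLead_of_mem_pairMonoid (i : ι) {F : MvPolynomial (Option ι) ℂ}
    (hF : F ∈ pairMonoid (Option ι)) : HasLead (pairMonoid ι) (substAlg none (some i) F) := by
  induction hF using Submonoid.closure_induction with
  | one => rw [map_one]; exact .one
  | mul F G _ _ hF hG => rw [map_mul]; exact hF.mul hG
  | mem F hF =>
    rcases hF with ⟨u, v, p, huv, hp, rfl⟩ | ⟨u, q, hq, rfl⟩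
    · by_cases h : u.getD i = v.getD i
      · have : ∃ p' : MvPolynomial (Fin 2) ℂ, p' ≠ 0 ∧
            rename ![u, v] p = rename ![none, some i] p' := by
          cases u with
          | none =>
            cases v with
            | none => exact absurd rfl huv
            | some j => exact ⟨p, hp, by rw [show i = j from h]⟩
          | some j =>
            cases v with
            | none =>
              refine ⟨rename ![1, 0] p, (map_ne_zero_iff _ (MvPolynomial.rename_injective _
                (by decide))).2 hp, ?_⟩
              rw [MvPolynomial.rename_rename, show i = j from h.symm]
              congr 2
              funext t; fin_cases t <;> rfl
            | some k => exact absurd (congrArg some h) huv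
        obtain ⟨p', hp', e⟩ := this
        obtain ⟨l, g, h, hg, e'⟩ := exists_substAlg_eq i hp'
        exact ⟨l, _, h, aeval_mem_pairMonoid i hg, by rw [e, e']⟩
      · refine hasLead_of_setZero (rename_mem_pairMonoid h hp) ?_
        rw [setZero_substAlg_rename]
        congr 2
        refine congrArg rename (funext fun t => ?_)
        fin_cases t <;> rfl
    · refine hasLead_of_setZero (aeval_mem_pairMonoid (u.getD i) hq) ?_
      have := setZero_substAlg_rename i (fun _ : Unit => u) (Polynomial.aeval (X ()) q)
      simpa [← Polynomial.aeval_algHom_apply] using this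

end Lead

/-! ### Merging two adjacent letters of a word into one product. -/

section Merge

open MvPolynomial (aeval X C rename)

variable {ι : Type*} [DecidableEq ι] {W : Type*} [AddCommGroup W] [Module ℂ W]

theorem isActClosed_lowerTrunc :
    IsActClosed fun Φ : W → (ι → ℤ) → W => ∀ w, LowerTrunc (Φ w) where
  zero _ := lowerTrunc_zero
  add h1 h2 w := (h1 w).add (h2 w)
  act p h w := (h w).act p

theorem injective_none_some (i : ι) : Function.Injective ![none, some i] := by
  intro s t hst
  fin_cases s <;> fin_cases t <;> simp_all

theorem indepOf_wordOp_map {i : ι} {L : List (ι × VertexOperator ℂ W)} (hL : ∀ x ∈ L, x.1 ≠ i) :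
    IndepOf ![none, some i] (wordOp (L.map (Prod.map some id))) := by
  refine indepOf_wordOp fun x hx t => ?_
  obtain ⟨y, hy, rfl⟩ := List.mem_map.1 hx
  fin_cases t
  · simp
  · simpa using (hL y hy).symm

theorem slice_spread_opeFormal (A B : List (ι × VertexOperator ℂ W)) (i : ι)
    (a b : VertexOperator ℂ W) (k : ℤ) (w : W) :
    slice k (spread ![none, some i] (wordOp (A.map (Prod.map some id)))
      (wordOp (B.map (Prod.map some id))) (opeFormal a b) w) =
      wordSeries (A ++ (i, ope a b k) :: B) w := by
  funext d
  simp only [slice, spread, wordSeries, wordOp_map, wordOp_append_apply, wordOp_cons, opeFormal]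
  rfl

/-- The shorter word is the coefficient of `x_none^k` in the longer one after `x_none ↦ x_none +
x_i`. A clearing polynomial of the longer word, multiplied by one for `a, b`, has a lowest
coefficient `P₀` in `x_none`, and a power of `P₀` clears the coefficient by
`IsActClosed.exists_pow`. -/
theorem tameWord_ope {A B : List (ι × VertexOperator ℂ W)} {i : ι} {a b : VertexOperator ℂ W}
    (hA : ∀ x ∈ A, x.1 ≠ i) (hB : ∀ x ∈ B, x.1 ≠ i) (hab : Compat a b)
    (h : TameWord (A.map (Prod.map some id) ++ (none, a) :: (some i, b) ::
      B.map (Prod.map some id))) (k : ℤ) : TameWord (A ++ (i, ope a b k) :: B) := by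
  obtain ⟨p, hp, hc⟩ := hab
  obtain ⟨P, hP, h⟩ := h
  have hP' : P * rename ![none, some i] p ∈ pairMonoid (Option ι) :=
    mul_mem hP (rename_mem_pairMonoid (by simp) hp)
  obtain ⟨l, P₀, g, hP₀, e⟩ := hasLead_of_mem_pairMonoid i hP'
  set Ψ : W → (Option ι → ℤ) → W := spread ![none, some i] (wordOp (A.map (Prod.map some id)))
    (wordOp (B.map (Prod.map some id))) (opeFormal a b) with hΨ
  have hslice : ∀ k w, slice k (Ψ w) = wordSeries (A ++ (i, ope a b k) :: B) w :=
    slice_spread_opeFormal A B i a b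
  have hsub : ∀ w, act (Option ι) W (substAlg none (some i) (P * rename ![none, some i] p)) (Ψ w) =
      subst binomLeft none (some i) (act (Option ι) W (P * rename ![none, some i] p) (wordSeries
        (A.map (Prod.map some id) ++ (none, a) :: (some i, b) :: B.map (Prod.map some id)) w)) := by
    intro w
    rw [← spread_pair_wordOp]
    exact (spread_ope (injective_none_some i) (indepOf_wordOp_map hA)
      (indepOf_wordOp_map hB) hp hc P w).2
  obtain ⟨N, hN⟩ := exists_ope_eq_zero a b
  obtain ⟨n, hn⟩ := isActClosed_lowerTrunc.exists_pow (Ψ := Ψ) (N := N) (P := P₀) (h := g)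
    (fun k hk w => by
      rw [hslice, hN k hk]
      funext d
      rw [wordSeries, wordOp_append_apply, wordOp_cons]; simp)
    (fun k w => by
      have h1 := congrArg (slice (k + l)) (hsub w)
      rw [e, act_mul, slice_act_X_none_pow, add_sub_cancel_right] at h1
      simp only
      rw [h1, slice_eq_restrict, mul_comm, act_mul]
      exact ((h w).act _).restrict_subst _ (by simp) (by simp) (Option.some_injective ι) _) k
  refine ⟨P₀ ^ n, pow_mem hP₀ n, fun w => ?_⟩
  rw [← hslice]
  exact hn w

end Merge

/-! ### The closed subspace generated by a pseudo-local set -/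

section Generated

open MvPolynomial (aeval X C rename)

variable {W : Type*} [AddCommGroup W] [Module ℂ W]

/-- Every labelling of the sequence by distinct variables is tame. -/
def TameList (L : List (VertexOperator ℂ W)) : Prop :=
  ∀ (ι : Type) [DecidableEq ι] (L' : List (ι × VertexOperator ℂ W)), L'.map Prod.snd = L →
    (L'.map Prod.fst).Nodup → (∀ i, i ∈ L'.map Prod.fst) → TameWord L'

theorem exists_eq_of_map_snd {ι : Type*} {L : List (ι × VertexOperator ℂ W)}
    {A B : List (VertexOperator ℂ W)} {a : VertexOperator ℂ W}
    (h : L.map Prod.snd = A ++ a :: B) : ∃ (A' B' : List (ι × VertexOperator ℂ W)) (i : ι),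
      L = A' ++ (i, a) :: B' ∧ A'.map Prod.snd = A ∧ B'.map Prod.snd = B := by
  obtain ⟨A', L₂, rfl, hA, h2⟩ := List.map_eq_append_iff.1 h
  obtain ⟨⟨i, a'⟩, B', rfl, rfl, hB⟩ := List.map_eq_cons_iff.1 h2
  exact ⟨A', B', i, rfl, hA, hB⟩

variable {A B : List (VertexOperator ℂ W)} {a b : VertexOperator ℂ W}

theorem TameList.zero : TameList (A ++ 0 :: B) := by
  intro ι _ L h _ _
  obtain ⟨A', B', i, rfl, -, -⟩ := exists_eq_of_map_snd h
  refine ⟨1, one_mem _, fun w => ?_⟩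
  have : wordSeries (A' ++ (i, 0) :: B') w = 0 := by
    funext m
    rw [wordSeries, wordOp_append_apply, wordOp_cons]; simp
  rw [this, map_zero]
  exact lowerTrunc_zero

theorem TameList.add (h₁ : TameList (A ++ a :: B)) (h₂ : TameList (A ++ b :: B)) :
    TameList (A ++ (a + b) :: B) := by
  intro ι _ L h hd hc
  obtain ⟨A', B', i, rfl, rfl, rfl⟩ := exists_eq_of_map_snd h
  obtain ⟨P, hP, h₁⟩ := h₁ ι (A' ++ (i, a) :: B') (by simp) (by simpa using hd) (by simpa using hc)
  obtain ⟨Q, hQ, h₂⟩ := h₂ ι (A' ++ (i, b) :: B') (by simp) (by simpa using hd) (by simpa using hc)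
  refine ⟨P * Q, mul_mem hP hQ, fun w => ?_⟩
  have : wordSeries (A' ++ (i, a + b) :: B') w =
      wordSeries (A' ++ (i, a) :: B') w + wordSeries (A' ++ (i, b) :: B') w := by
    funext m
    simp [wordSeries, wordOp_append_apply, wordOp_cons]
  rw [this, map_add]
  refine LowerTrunc.add ?_ ?_
  · rw [mul_comm, act_mul]; exact (h₁ w).act Q
  · rw [act_mul]; exact (h₂ w).act P

theorem TameList.smul (h₁ : TameList (A ++ a :: B)) (c : ℂ) : TameList (A ++ (c • a) :: B) := by
  intro ι _ L h hd hc
  obtain ⟨A', B', i, rfl, rfl, rfl⟩ := exists_eq_of_map_snd h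
  obtain ⟨P, hP, h₁⟩ := h₁ ι (A' ++ (i, a) :: B') (by simp) (by simpa using hd) (by simpa using hc)
  refine ⟨P, hP, fun w => ?_⟩
  have : wordSeries (A' ++ (i, c • a) :: B') w = c • wordSeries (A' ++ (i, a) :: B') w := by
    funext m
    simp [wordSeries, wordOp_append_apply, wordOp_cons]
  rw [this, map_smul]
  exact (h₁ w).smul c

/-- Splitting the letter turns the labels `ι` into `Option ι`, with `none` for `a` and `some i` for
`b`. This is the reason for quantifying over all label types in `TameList`. -/
theorem TameList.ope (h₁ : TameList (A ++ a :: b :: B)) (hab : Compat a b) (k : ℤ) :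
    TameList (A ++ ope a b k :: B) := by
  intro ι _ L h hd hc
  obtain ⟨A', B', i, rfl, rfl, rfl⟩ := exists_eq_of_map_snd h
  have hd' := hd
  simp only [List.map_append, List.map_cons, List.nodup_append, List.nodup_cons, List.mem_cons,
    List.mem_map] at hd'
  obtain ⟨-, ⟨hiB, -⟩, hAB⟩ := hd'
  refine tameWord_ope (fun x hx => hAB _ ⟨x, hx, rfl⟩ _ (Or.inl rfl))
    (fun x hx h => hiB ⟨x, hx, h⟩) hab (h₁ (Option ι) _ ?_ ?_ ?_) k
  · simp [Function.comp_def]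
  · have e : (A'.map (Prod.map some id) ++ (none, a) :: (some i, b) ::
        B'.map (Prod.map some id)).map Prod.fst =
        (A'.map Prod.fst).map some ++ none :: ((i :: B'.map Prod.fst).map some) := by
      simp [Function.comp_def]
    rw [e]
    refine (List.perm_middle.nodup_iff).2 (List.nodup_cons.2 ⟨by simp, ?_⟩)
    rw [← List.map_append]
    exact List.Nodup.map (Option.some_injective ι) (by simpa using hd)
  · intro o
    cases o with
    | none => simp
    | some j => simpa [Function.comp_def] using hc j

variable {S : Set (VertexOperator ℂ W)}

variable (S) in
/-- The elements obtained from `S` by linear combinations and the products `a(x)_n b(x)`. -/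
inductive Generated : VertexOperator ℂ W → Prop
  | mem {a : VertexOperator ℂ W} (h : a ∈ S) : Generated a
  | zero : Generated 0
  | add {a b : VertexOperator ℂ W} (ha : Generated a) (hb : Generated b) : Generated (a + b)
  | smul (c : ℂ) {a : VertexOperator ℂ W} (ha : Generated a) : Generated (c • a)
  | ope {a b : VertexOperator ℂ W} (ha : Generated a) (hb : Generated b) (hab : Compat a b)
      (k : ℤ) : Generated (NonlocalVA.ope a b k)

/-- Induction on the construction of `ψ` with an arbitrary context: tameness with `ψ` replaced by
words in `S` suffices. For a product the letter is split in two, and the induction hypothesis is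
used for `a` with `b` in the context, then for `b` with a word in place of `a`. -/
theorem Generated.tameList_of_forall {ψ : VertexOperator ℂ W} (hψ : Generated S ψ) :
    ∀ A B, (∀ L : List (VertexOperator ℂ W), (∀ a ∈ L, a ∈ S) → TameList (A ++ L ++ B)) →
      TameList (A ++ ψ :: B) := by
  induction hψ with
  | @mem a h =>
    intro A B hL
    simpa using hL [a] (by simpa using h)
  | zero => exact fun A B _ => .zero
  | add _ _ h1 h2 => exact fun A B hL => (h1 A B hL).add (h2 A B hL)
  | smul c _ h1 => exact fun A B hL => (h1 A B hL).smul c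
  | @ope a b _ _ hab k h1 h2 =>
    intro A B hL
    refine TameList.ope (h1 A (b :: B) fun L hLS => ?_) hab k
    refine h2 (A ++ L) B fun L' hLS' => ?_
    rw [List.append_assoc A]
    refine hL (L ++ L') fun a ha => ?_
    rcases List.mem_append.1 ha with ha | ha
    exacts [hLS a ha, hLS' a ha]

theorem tameList_of_exchange (hS : ∀ a ∈ S, ∀ b ∈ S, Exchange (nonZeroDivisors _) S S a b)
    {L : List (VertexOperator ℂ W)} (hL : ∀ a ∈ L, a ∈ S) : TameList L := by
  rintro ι _ L' rfl hd hc
  exact tameWord_of_exchange hS L' (fun x hx => hL _ (List.mem_map_of_mem hx)) hd hc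

theorem tameList_of_generated (hS : ∀ a ∈ S, ∀ b ∈ S, Exchange (nonZeroDivisors _) S S a b)
    {L : List (VertexOperator ℂ W)} (hL : ∀ a ∈ L, Generated S a) : TameList L := by
  have key : ∀ (L : List (VertexOperator ℂ W)), (∀ a ∈ L, Generated S a) →
      ∀ A, (∀ a ∈ A, a ∈ S) → TameList (A ++ L) := by
    intro L
    induction L with
    | nil =>
      intro _ A hA
      rw [List.append_nil]
      exact tameList_of_exchange hS hA
    | cons ψ L ih =>
      intro hL A hA
      refine (hL ψ (by simp)).tameList_of_forall A L fun L' hL' => ?_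
      refine ih (fun a ha => hL a (by simp [ha])) _ fun a ha => ?_
      rcases List.mem_append.1 ha with ha | ha
      exacts [hA a ha, hL' a ha]
  exact key L hL [] (by simp)

/-- Quasi compatibility asks for one polynomial for all pairs `i < j`. A factor in `x_i, x_j` with
`i > j` is used with its variables swapped, and a factor in one variable is regarded as one in two
variables, which needs `2 ≤ r`. -/
theorem exists_dvd_prod {r : ℕ} (hr : 2 ≤ r) {P : MvPolynomial (Fin r) ℂ}
    (hP : P ∈ pairMonoid (Fin r)) : ∃ p : MvPolynomial (Fin 2) ℂ, p ≠ 0 ∧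
      P ∣ ∏ i : Fin r, ∏ j ∈ Finset.Ioi i, rename ![i, j] p := by
  have fac : ∀ {i j : Fin r} (p : MvPolynomial (Fin 2) ℂ), i < j →
      rename ![i, j] p ∣ ∏ i : Fin r, ∏ j ∈ Finset.Ioi i, rename ![i, j] p := by
    intro i j p hij
    have h1 : rename ![i, j] p ∣ ∏ j ∈ Finset.Ioi i, rename ![i, j] p :=
      Finset.dvd_prod_of_mem (fun j => rename ![i, j] p) (Finset.mem_Ioi.2 hij)
    exact h1.trans (Finset.dvd_prod_of_mem (fun i => ∏ j ∈ Finset.Ioi i, rename ![i, j] p)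
      (Finset.mem_univ i))
  induction hP using Submonoid.closure_induction with
  | one => exact ⟨1, one_ne_zero, one_dvd _⟩
  | mul P Q _ _ hP hQ =>
    obtain ⟨p, hp, h1⟩ := hP
    obtain ⟨q, hq, h2⟩ := hQ
    refine ⟨p * q, mul_ne_zero hp hq, ?_⟩
    simp only [map_mul, Finset.prod_mul_distrib]
    exact mul_dvd_mul h1 h2
  | mem P hP =>
    rcases hP with ⟨i, j, p, hij, hp, rfl⟩ | ⟨i, q, hq, rfl⟩
    · rcases lt_or_gt_of_ne hij with h | h
      · exact ⟨p, hp, fac p h⟩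
      · refine ⟨rename ![1, 0] p, (map_ne_zero_iff _ (MvPolynomial.rename_injective _
          (by decide))).2 hp, ?_⟩
        have : rename ![i, j] p = rename ![j, i] (rename ![1, 0] p) := by
          rw [MvPolynomial.rename_rename]
          refine congrArg (fun f : Fin 2 → Fin r => rename f p) (funext fun t => ?_)
          fin_cases t <;> rfl
        rw [this]
        exact fac _ h
    · have : ∃ j, j ≠ i := by
        by_cases h : (i : ℕ) = 0
        · exact ⟨⟨1, hr⟩, fun h' => by simp [← h'] at h⟩
        · exact ⟨⟨0, by omega⟩, fun h' => h (by rw [← h'])⟩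
      obtain ⟨j, hj⟩ := this
      rcases lt_or_gt_of_ne hj with h | h
      · refine ⟨Polynomial.aeval (X 1) q, aeval_X_ne_zero 1 hq, ?_⟩
        have e : (Polynomial.aeval (X i) q : MvPolynomial (Fin r) ℂ) = rename ![j, i] (Polynomial.aeval (X 1) q) := by
          rw [← Polynomial.aeval_algHom_apply]; simp
        rw [e]
        exact fac _ h
      · refine ⟨Polynomial.aeval (X 0) q, aeval_X_ne_zero 0 hq, ?_⟩
        have e : (Polynomial.aeval (X i) q : MvPolynomial (Fin r) ℂ) = rename ![i, j] (Polynomial.aeval (X 0) q) := by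
          rw [← Polynomial.aeval_algHom_apply]; simp
        rw [e]
        exact fac _ h

theorem prodSeries_eq_wordSeries {r : ℕ} (ψ : Fin r → VertexOperator ℂ W) (w : W) :
    prodSeries ψ w = wordSeries (List.ofFn fun i => (i, ψ i)) w := by
  funext m
  rw [prodSeries, wordSeries, wordOp, List.map_ofFn]; rfl

theorem quasiCompatible_generated (hS : ∀ a ∈ S, ∀ b ∈ S, Exchange (nonZeroDivisors _) S S a b) :
    QuasiCompatible {a | Generated S a} := by
  intro r ψ hψ
  -- For `r < 2` the product over pairs is empty and a single operator is already bounded below.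
  rcases lt_or_ge r 2 with hr | hr
  · refine ⟨1, one_ne_zero, fun w => ?_⟩
    have e : (∏ i : Fin r, ∏ j ∈ Finset.Ioi i, rename ![i, j] (1 : MvPolynomial (Fin 2) ℂ)) = 1 := by
      simp
    rw [e, polyMul_eq_act, act_one]
    interval_cases r
    · exact ⟨0, fun m ⟨i, _⟩ => i.elim0⟩
    · obtain ⟨N, hN⟩ := coeff_bddBelow (ψ 0) w
      refine ⟨N, fun m ⟨i, hi⟩ => ?_⟩
      rw [Subsingleton.elim i 0] at hi
      simpa [prodSeries, List.ofFn_succ] using hN _ hi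
  · obtain ⟨P, hP, h⟩ := tameList_of_generated hS (L := List.ofFn ψ)
      (by simpa [List.mem_ofFn] using hψ) (Fin r) (List.ofFn fun i => (i, ψ i))
      (by rw [List.map_ofFn]; rfl)
      (by rw [List.map_ofFn]; exact List.nodup_ofFn.2 Function.injective_id)
      (fun i => by rw [List.map_ofFn]; exact List.mem_ofFn.2 ⟨i, rfl⟩)
    obtain ⟨p, hp, Q, hQ⟩ := exists_dvd_prod hr hP
    refine ⟨p, hp, fun w => ?_⟩
    rw [polyMul_eq_act, prodSeries_eq_wordSeries, hQ, mul_comm, act_mul]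
    exact (h w).act Q

variable (S) in
/-- The subspace of generated elements. -/
def generatedSubmodule : Submodule ℂ (VertexOperator ℂ W) where
  carrier := {a | Generated S a}
  add_mem' := .add
  zero_mem' := .zero
  smul_mem' := .smul

theorem isClosedSubspace_generated : IsClosedSubspace (generatedSubmodule S) := by
  intro a ha b hb p hp h n
  rw [nthProd_eq_ope hp]
  exact Generated.ope ha hb ⟨p, hp, h⟩ _

/-- The constant series `1_W` commutes with everything, so its exchange relations hold with `p = 1`.
-/
theorem exchange_insert_idOp {M : Submonoid (MvPolynomial (Fin 2) ℂ)}
    (hS : ∀ a ∈ S, ∀ b ∈ S, Exchange M S S a b) :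
    ∀ a ∈ insert (idOp W) S, ∀ b ∈ insert (idOp W) S,
      Exchange M (insert (idOp W) S) (insert (idOp W) S) a b := by
  have swap : ∀ {a b u v : VertexOperator ℂ W}, u ∈ insert (idOp W) S → v ∈ insert (idOp W) S →
      (∀ w, pair a b w = opPair u v w) →
      Exchange M (insert (idOp W) S) (insert (idOp W) S) a b := by
    intro a b u v hu hv h
    refine ⟨1, one_mem _, ?_⟩
    simp only [act_one, h]
    exact .base ⟨u, hu, v, hv, rfl⟩
  have hid : idOp W ∈ insert (idOp W) S := Set.mem_insert _ _
  intro a ha b hb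
  rcases Set.mem_insert_iff.1 ha with rfl | ha'
  · refine swap hb hid fun w => ?_
    funext m
    rw [pair, opPair, toFormal_comp₂, coeff_idOp]
    split_ifs <;> simp
  · rcases Set.mem_insert_iff.1 hb with rfl | hb'
    · refine swap hid ha fun w => ?_
      funext m
      rw [pair, opPair, toFormal_comp₂, coeff_idOp]
      split_ifs <;> simp
    · obtain ⟨p, hp, h⟩ := hS a ha' b hb'
      exact ⟨p, hp, h.mono (Set.subset_insert _ _) (Set.subset_insert _ _)⟩

theorem generatedSubmodule_le {U : Submodule ℂ (VertexOperator ℂ W)}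
    (hU : U ∈ closedQuasiCompatible S) : generatedSubmodule (insert (idOp W) S) ≤ U := by
  obtain ⟨hq, hc, hSU, h1⟩ := hU
  intro a ha
  have ha' : Generated _ a := ha
  clear ha
  induction ha' with
  | mem h =>
    rcases Set.mem_insert_iff.1 h with rfl | h
    exacts [h1, hSU h]
  | zero => exact U.zero_mem
  | add _ _ h1 h2 => exact U.add_mem h1 h2
  | smul c _ h1 => exact U.smul_mem c h1
  | ope _ _ _ k h1 h2 => exact ope_mem hq hc h1 h2 k

theorem generatedSubmodule_mem (hS : IsPseudoLocal S) :
    generatedSubmodule (insert (idOp W) S) ∈ closedQuasiCompatible S :=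
  ⟨quasiCompatible_generated (exchange_insert_idOp fun _ ha _ hb => hS.exchange ha hb),
    isClosedSubspace_generated, fun _ ha => Generated.mem (Set.mem_insert_of_mem _ ha),
    Generated.mem (Set.mem_insert _ _)⟩

theorem generated_eq (hS : IsPseudoLocal S) :
    generated S = generatedSubmodule (insert (idOp W) S) :=
  le_antisymm (sInf_le (generatedSubmodule_mem hS)) (le_sInf fun _ hU => generatedSubmodule_le hU)

theorem isLeast_generated (hS : IsPseudoLocal S) : IsLeast (closedQuasiCompatible S) (generated S) :=
  ⟨by rw [generated_eq hS]; exact generatedSubmodule_mem hS, fun _ hU => sInf_le hU⟩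

end Generated

/-! ### The Leibniz rule -/

section Leibniz

open MvPolynomial (aeval X C rename)

variable {ι : Type*} [DecidableEq ι] {W : Type*} [AddCommGroup W] [Module ℂ W]

/-- The exponents after identification of `x_none` with `x_s`. -/
def mergeHom (s : ι) : (Option ι → ℤ) →+ (ι → ℤ) where
  toFun m := (fun j => m (some j)) + Pi.single s (m none)
  map_zero' := by funext j; simp
  map_add' m n := by
    funext j
    simp only [Pi.add_apply, Pi.single_add]
    ring

theorem mergeHom_apply (s : ι) (m : Option ι → ℤ) (j : ι) :
    mergeHom s m j = m (some j) + (Pi.single s (m none) : ι → ℤ) j := rfl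

theorem mergeHom_single_none (s : ι) (k : ℤ) : mergeHom s (Pi.single none k) = Pi.single s k := by
  funext j; simp [mergeHom_apply]

theorem mergeHom_single_some (s j : ι) (k : ℤ) :
    mergeHom s (Pi.single (some j) k) = Pi.single j k := by
  funext i; simp [mergeHom_apply, Pi.single_apply]

/-- The substitution preserves the sum of the exponents of `x_none` and `x_s`. All terms of a
substituted coefficient therefore lie over one merged exponent, which makes sparseness along
`mergeHom` the right finiteness condition. -/
theorem mergeHom_moved (s : ι) (m : Option ι → ℤ) (n : ℤ) :
    mergeHom s (moved none (some s) m n) = mergeHom s m := by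
  funext j
  rw [mergeHom_apply, mergeHom_apply]
  by_cases h : j = s
  · subst h
    rw [moved_t, moved_s (by simp)]; simp
  · rw [moved_ne (by simp) (by simpa using h), Pi.single_eq_of_ne h, Pi.single_eq_of_ne h]

theorem moved_injective (s : ι) (m : Option ι → ℤ) :
    Function.Injective (moved none (some s) m) := fun n k h => by
  simpa [moved_s] using congrFun h none

variable {s t : ι} {q : ℤ × ℤ → ℂ} {F : (Option ι → ℤ) → W}

theorem zsmul_finsum {α : Type*} (c : ℤ) (f : α → W) : c • ∑ᶠ i, f i = ∑ᶠ i, c • f i := by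
  simp only [← Int.cast_smul_eq_zsmul ℂ]
  exact smul_finsum _ _

theorem Sparse.substitutable [Finite ι] (hF : Sparse (mergeHom s) F) :
    Substitutable binomLeft none (some s) F := by
  intro m
  obtain ⟨K, hK⟩ := (Set.finite_range (mergeHom s m)).bddAbove
  refine ((hF K).preimage (moved_injective s m).injOn).subset fun n hn => ⟨fun i => ?_, hn.2⟩
  rw [mergeHom_moved]
  exact hK ⟨i, rfl⟩

theorem finite_conv_moved [Finite ι] (hF : Sparse (mergeHom s) F) (hq : IsLaurent q)
    {u : Option ι} {u' : ι} (hu : ∀ d, mergeHom s (Pi.single u d) = Pi.single u' d) (hut : u' ≠ t)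
    (m : Option ι → ℤ) :
    {x : ℤ × (ℤ × ℤ) | q x.2 ≠ 0 ∧
      F (moved none (some s) m x.1 - Pi.single u x.2.1 - Pi.single (some t) x.2.2) ≠ 0}.Finite := by
  obtain ⟨K, hK⟩ := (Set.finite_range (mergeHom s m)).bddAbove
  have h := finite_conv_support hu (mergeHom_single_some s t) hut hF hq K
  have hinj : Function.Injective fun x : ℤ × (ℤ × ℤ) => (moved none (some s) m x.1, x.2) := by
    rintro ⟨n, d⟩ ⟨k, e⟩ h
    simp only [Prod.mk.injEq] at h
    rw [moved_injective s m h.1, h.2]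
  refine (h.preimage hinj.injOn).subset fun x hx => ⟨fun i => ?_, hx⟩
  simp only [mergeHom_moved]
  exact hK ⟨i, rfl⟩

/-- Here `q` does not involve `x_none`; only the order of two sums changes, and their joint support
is finite. -/
theorem subst_conv_some [Finite ι] (hst : s ≠ t) (hF : Sparse (mergeHom s) F) (hq : IsLaurent q) :
    subst binomLeft none (some s) (conv q (some s) (some t) F) =
      conv q (some s) (some t) (subst binomLeft none (some s) F) := by
  funext m
  have hfin := finite_conv_moved hF hq (mergeHom_single_some s s) hst m
  have e1 : subst binomLeft none (some s) (conv q (some s) (some t) F) m =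
      ∑ᶠ x : ℤ × (ℤ × ℤ), binomLeft x.1 (m none) • q x.2 • F (moved none (some s) m x.1 -
        Pi.single (some s) x.2.1 - Pi.single (some t) x.2.2) := by
    rw [finsum_curry _ (hfin.subset fun x hx => ?_)]
    · refine finsum_congr fun n => ?_
      rw [conv, zsmul_finsum]
    · have := right_ne_zero_of_smul hx
      exact ⟨left_ne_zero_of_smul this, right_ne_zero_of_smul this⟩
  rw [e1, ← finsum_comp_equiv (Equiv.prodComm (ℤ × ℤ) ℤ), finsum_curry]
  · refine finsum_congr fun d => ?_
    rw [subst, smul_finsum]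
    refine finsum_congr fun n => ?_
    rw [moved_sub_single (by simp) (by simp), moved_sub_single (by simp) (by simp), smul_comm]
    simp
  · refine (hfin.preimage (Equiv.prodComm (ℤ × ℤ) ℤ).injective.injOn).subset fun x hx => ?_
    have := right_ne_zero_of_smul hx
    exact ⟨left_ne_zero_of_smul this, right_ne_zero_of_smul this⟩

/-- The coefficient of `x₀^i` in `q(x₀ + x₁, x₂)`. -/
def taylorCoeff (q : ℤ × ℤ → ℂ) (i : ℕ) : ℤ × ℤ → ℂ :=
  fun d => (binomLeft (d.1 + i) i : ℂ) * q (d.1 + i, d.2)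

theorem IsLaurent.taylorCoeff (hq : IsLaurent q) (i : ℕ) : IsLaurent (taylorCoeff q i) := by
  obtain ⟨N, hN⟩ := hq
  refine ⟨N - i, fun d hd => ?_⟩
  rw [NonlocalVA.taylorCoeff, hN _ (by simp only; omega), mul_zero]

theorem sum_binomLeft_mul (a b : ℤ) (k : ℕ) :
    ∑ i ∈ Finset.range (k + 1), binomLeft a i * binomLeft b ((k : ℤ) - i) = binomLeft (a + b) k := by
  rw [binomLeft, if_pos (by omega), Int.toNat_natCast, Ring.add_choose_eq _ (Commute.all _ _),
    Finset.Nat.sum_antidiagonal_eq_sum_range_succ (fun i j => Ring.choose a i * Ring.choose b j)]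
  refine Finset.sum_congr rfl fun i hi => ?_
  have := Finset.mem_range.1 hi
  rw [binomLeft, binomLeft, if_pos (by omega), if_pos (by omega), Int.toNat_natCast,
    show ((k : ℤ) - i).toNat = k - i by omega]

/-- The Leibniz rule: the Taylor expansion of `q(x_none + x_s, x_t)` is multiplied with the
substituted `F`. On coefficients it is Vandermonde's identity. The sum is finite because neither
factor has negative powers of `x_none`. -/
theorem slice_subst_conv_none [Finite ι] (hst : s ≠ t) (hF : Sparse (mergeHom s) F)
    (hq : IsLaurent q) (k : ℕ) :
    slice k (subst binomLeft none (some s) (conv q none (some t) F)) =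
      ∑ i ∈ Finset.range (k + 1), conv (taylorCoeff q i) s t
        (slice ((k : ℤ) - i) (subst binomLeft none (some s) F)) := by
  funext d
  set m : Option ι → ℤ := fun o => o.elim k d with hm
  have hfin := finite_conv_moved hF hq (mergeHom_single_none s) hst m
  set f : ℤ × (ℤ × ℤ) → W := fun x => q x.2 • F (moved none (some s) m x.1 -
    Pi.single none x.2.1 - Pi.single (some t) x.2.2) with hf
  have hff : (Function.support f).Finite :=
    hfin.subset fun x hx => ⟨left_ne_zero_of_smul hx, right_ne_zero_of_smul hx⟩
  have e1 : slice k (subst binomLeft none (some s) (conv q none (some t) F)) d =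
      ∑ᶠ x : ℤ × (ℤ × ℤ), binomLeft x.1 k • f x := by
    rw [finsum_curry _ (hff.subset fun x hx => right_ne_zero_of_smul hx)]
    refine finsum_congr fun n => ?_
    rw [conv, zsmul_finsum]
    rfl
  have e2 : ∀ i ∈ Finset.range (k + 1), conv (taylorCoeff q i) s t
      (slice ((k : ℤ) - i) (subst binomLeft none (some s) F)) d =
      ∑ᶠ x : ℤ × (ℤ × ℤ), (binomLeft x.2.1 i * binomLeft (x.1 - x.2.1) ((k : ℤ) - i)) • f x := by
    intro i _
    rw [← finsum_comp_equiv (Equiv.prodComm (ℤ × ℤ) ℤ), finsum_curry, conv,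
      ← finsum_comp_equiv (Equiv.subRight ((i : ℤ), (0 : ℤ)))]
    · refine finsum_congr fun D => ?_
      rw [slice, subst, smul_finsum, ← finsum_comp_equiv (Equiv.subRight D.1)]
      refine finsum_congr fun n => ?_
      have e3 : moved none (some s) (fun o => o.elim ((k : ℤ) - i) (d - Pi.single s
          ((Equiv.subRight ((i : ℤ), (0 : ℤ))) D).1 - Pi.single t
          ((Equiv.subRight ((i : ℤ), (0 : ℤ))) D).2)) ((Equiv.subRight D.1) n) =
          moved none (some s) m n - Pi.single none D.1 - Pi.single (some t) D.2 := by
        funext o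
        cases o with
        | none => simp [moved_s]
        | some j =>
          by_cases h : j = s
          · subst h
            rw [moved_t]
            simp [moved_t, hst, hm]
            ring
          · rw [moved_ne (by simp) (by simpa using h)]
            simp only [Pi.sub_apply]
            rw [moved_ne (by simp) (by simpa using h)]
            simp [h, hm, Pi.single_apply]
      rw [e3]
      simp only [hf, taylorCoeff, Option.elim_none, Equiv.coe_prodComm, Prod.swap_prod_mk,
        Equiv.subRight_apply, Prod.fst_sub, Prod.snd_sub, sub_add_cancel, sub_zero,
        ← Int.cast_smul_eq_zsmul ℂ, smul_smul, Int.cast_mul]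
      congr 1
      ring
    · refine (hff.preimage (Equiv.prodComm (ℤ × ℤ) ℤ).injective.injOn).subset fun x hx => ?_
      exact right_ne_zero_of_smul hx
  rw [e1, Finset.sum_apply, Finset.sum_congr rfl e2, ← finsum_sum_comm]
  · refine finsum_congr fun x => ?_
    rw [← Finset.sum_smul, sum_binomLeft_mul, add_sub_cancel]
  · exact fun i _ => hff.subset fun x hx => right_ne_zero_of_smul hx

theorem slice_subst_of_neg {k : ℤ} (hk : k < 0) (F : (Option ι → ℤ) → W) :
    slice k (subst binomLeft none (some s) F) = 0 := by
  funext d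
  exact subst_binomLeft_of_neg (by simpa using hk)

end Leibniz

/-! ### Sparse words -/

section SparseWord

variable {ι : Type*} [DecidableEq ι] {W : Type*} [AddCommGroup W] [Module ℂ W]

theorem finite_comp {X Y W : Type*} [Zero W] {DX : Set X} {DY : Set Y} {φ : X → W → W}
    {ψ : Y → W → W} (h1 : ∀ w, {x | x ∈ DX ∧ φ x w ≠ 0}.Finite) (h0 : ∀ x, φ x 0 = 0)
    (h2 : ∀ w, {y | y ∈ DY ∧ ψ y w ≠ 0}.Finite) (w : W) :
    {z : X × Y | (z.1 ∈ DX ∧ z.2 ∈ DY) ∧ φ z.1 (ψ z.2 w) ≠ 0}.Finite := by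
  refine ((h2 w).biUnion fun y _ => (h1 (ψ y w)).image (·, y)).subset ?_
  rintro ⟨x, y⟩ ⟨⟨hx, hy⟩, h⟩
  refine Set.mem_biUnion (x := y) ⟨hy, fun h' => h ?_⟩ ⟨x, ⟨hx, h⟩, rfl⟩
  simp only at h' ⊢
  rw [h', h0]

theorem wordOp_congr {L : List (ι × VertexOperator ℂ W)} {m n : ι → ℤ}
    (h : ∀ x ∈ L, m x.1 = n x.1) : wordOp L m = wordOp L n :=
  congrArg List.prod (List.map_congr_left fun x hx => by rw [h x hx])

/-- The exponents in the labels of `L`, extended by zero. -/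
def labelPart (L : List (ι × VertexOperator ℂ W)) (m : ι → ℤ) : ι → ℤ :=
  fun i => if i ∈ L.map Prod.fst then m i else 0

theorem wordOp_labelPart (L : List (ι × VertexOperator ℂ W)) (m : ι → ℤ) :
    wordOp L (labelPart L m) = wordOp L m :=
  wordOp_congr fun _ hx => if_pos (List.mem_map_of_mem hx)

theorem finite_wordOp {L : List (ι × VertexOperator ℂ W)} (hd : (L.map Prod.fst).Nodup) (K : ℤ)
    (w : W) : {m : ι → ℤ | ((∀ i ∈ L.map Prod.fst, m i ≤ K) ∧ ∀ i ∉ L.map Prod.fst, m i = 0) ∧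
      wordOp L m w ≠ 0}.Finite := by
  induction L generalizing w with
  | nil =>
    refine (Set.finite_singleton 0).subset fun m hm => ?_
    exact funext fun i => hm.1.2 i (by simp)
  | cons x L ih =>
    obtain ⟨i, a⟩ := x
    rw [List.map_cons, List.nodup_cons] at hd
    have h1 : ∀ w, {n : ℤ | n ∈ Set.Iic K ∧ HVertexOperator.coeff a n w ≠ 0}.Finite := by
      intro w
      obtain ⟨N, hN⟩ := coeff_bddBelow a w
      refine (Set.finite_Icc N K).subset fun n hn => ⟨?_, hn.1⟩
      by_contra h
      exact hn.2 (hN n (by omega))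
    have h := finite_comp h1 (fun n => map_zero _) (ih hd.2) w
    have hinj : Function.Injective fun m : ι → ℤ => (m i, Function.update m i 0) := by
      intro m n hmn
      simp only [Prod.mk.injEq] at hmn
      funext j
      by_cases hj : j = i
      · rw [hj, hmn.1]
      · simpa [hj] using congrFun hmn.2 j
    refine (h.preimage hinj.injOn).subset ?_
    rintro m ⟨⟨hm1, hm2⟩, hm⟩
    have hne : ∀ j ∈ L.map Prod.fst, j ≠ i := fun j hj h => hd.1 (h ▸ hj)
    refine ⟨⟨hm1 i (by simp), fun j hj => ?_, fun j hj => ?_⟩, ?_⟩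
    · simp only [Function.update_of_ne (hne j hj)]
      exact hm1 j (by simp only [List.map_cons, List.mem_cons]; exact Or.inr hj)
    · by_cases hji : j = i
      · simp [hji]
      · simp only [Function.update_of_ne hji]
        exact hm2 j (by simp only [List.map_cons, List.mem_cons, not_or]; exact ⟨hji, hj⟩)
    · rw [wordOp_cons] at hm
      have e : wordOp L (Function.update m i 0) = wordOp L m :=
        wordOp_congr fun x hx => Function.update_of_ne (hne _ (List.mem_map_of_mem hx)) _ _
      simpa only [e] using hm

theorem sparse_wordSeries {L : List (ι × VertexOperator ℂ W)} (hd : (L.map Prod.fst).Nodup)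
    (hc : ∀ i, i ∈ L.map Prod.fst) (w : W) : Sparse (AddMonoidHom.id _) (wordSeries L w) :=
  fun K => (finite_wordOp hd K w).subset fun _ hm =>
    ⟨⟨fun i _ => hm.1 i, fun i hi => absurd (hc i) hi⟩, hm.2⟩

/-- An upper bound on merged exponents bounds those of `A` and `B` separately, but only the sum of
the two middle exponents. That is enough because `F w` is bounded below in both. -/
theorem sparse_spread {A B : List (ι × VertexOperator ℂ W)} {s : ι}
    (hd : (A.map Prod.fst ++ s :: B.map Prod.fst).Nodup)
    (hc : ∀ i, i ∈ A.map Prod.fst ++ s :: B.map Prod.fst) {F : W → (Fin 2 → ℤ) → W}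
    (hF : ∀ w, LowerTrunc (F w)) (h0 : F 0 = 0) (w : W) :
    Sparse (mergeHom s) (spread ![none, some s] (wordOp (A.map (Prod.map some id)))
      (wordOp (B.map (Prod.map some id))) F w) := by
  intro K
  rw [List.nodup_append, List.nodup_cons] at hd
  obtain ⟨hdA, ⟨hsB, hdB⟩, hAB⟩ := hd
  have hsA : s ∉ A.map Prod.fst := fun h => hAB s h s (by simp) rfl
  have hF0 : ∀ w, {d : Fin 2 → ℤ | d ∈ {d | d 0 + d 1 ≤ K} ∧ F w d ≠ 0}.Finite := by
    intro w
    obtain ⟨N, hN⟩ := hF w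
    refine ((Set.finite_Icc N (K - N)).prod (Set.finite_Icc N (K - N))).image
      (fun x : ℤ × ℤ => ![x.1, x.2]) |>.subset ?_
    rintro d ⟨h1, h2⟩
    have h3 : ∀ i, N ≤ d i := fun i => by
      by_contra h
      exact h2 (hN d ⟨i, by omega⟩)
    have h1 : d 0 + d 1 ≤ K := h1
    have := h3 0
    have := h3 1
    refine ⟨(d 0, d 1), ⟨⟨by simpa, by simp only; omega⟩, ⟨by simpa, by simp only; omega⟩⟩, ?_⟩
    funext i; fin_cases i <;> rfl
  have h := finite_comp (finite_wordOp hdA K) (fun m => map_zero _)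
    (finite_comp (φ := fun d w => F w d) hF0 (fun d => by simp only [h0]; rfl)
      (finite_wordOp hdB K)) w
  have hinj : Function.Injective fun m : Option ι → ℤ =>
      (labelPart A (m ∘ some), m ∘ ![none, some s], labelPart B (m ∘ some)) := by
    intro m n hmn
    simp only [Prod.mk.injEq] at hmn
    obtain ⟨h1, h2, h3⟩ := hmn
    funext o
    cases o with
    | none => exact congrFun h2 0
    | some j =>
      rcases List.mem_append.1 (hc j) with hj | hj
      · simpa only [labelPart, if_pos hj, Function.comp_apply] using congrFun h1 j
      · rcases List.mem_cons.1 hj with rfl | hj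
        · exact congrFun h2 1
        · simpa only [labelPart, if_pos hj, Function.comp_apply] using congrFun h3 j
  have hlabel : ∀ {L : List (ι × VertexOperator ℂ W)} {m : Option ι → ℤ},
      (∀ i, mergeHom s m i ≤ K) → s ∉ L.map Prod.fst →
      (∀ i ∈ L.map Prod.fst, labelPart L (m ∘ some) i ≤ K) ∧
        ∀ i ∉ L.map Prod.fst, labelPart L (m ∘ some) i = 0 := by
    intro L m hm hs
    refine ⟨fun i hi => ?_, fun i hi => if_neg hi⟩
    have := hm i
    rw [mergeHom_apply, Pi.single_eq_of_ne (ne_of_mem_of_not_mem hi hs), add_zero] at this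
    simpa only [labelPart, if_pos hi, Function.comp_apply] using this
  refine (h.preimage hinj.injOn).subset ?_
  rintro m ⟨hm, hm0⟩
  refine ⟨⟨hlabel hm hsA, ⟨?_, hlabel hm hsB⟩⟩, ?_⟩
  · have := hm s
    rw [mergeHom_apply, Pi.single_eq_same, add_comm] at this
    exact this
  · simpa only [wordOp_labelPart, spread, wordOp_map] using hm0

end SparseWord

/-! ### Identification of two variables -/

section Mergeable

open MvPolynomial (aeval X C rename)

variable {ι : Type*} [DecidableEq ι] {W : Type*} [AddCommGroup W] [Module ℂ W] {s t : ι}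
  {Q : (W → (ι → ℤ) → W) → Prop} {Φ Ψ : W → (Option ι → ℤ) → W}

theorem mergeHom_single_nonneg (s : ι) (u : Option ι) (i : ι) :
    0 ≤ mergeHom s (Pi.single u 1) i := by
  cases u with
  | none => rw [mergeHom_single_none, Pi.single_apply]; split_ifs <;> simp
  | some j => rw [mergeHom_single_some, Pi.single_apply]; split_ifs <;> simp

/-- After multiplication by `f(x_none, x_s)`, the substitution `x_none ↦ x_none + x_s` is defined,
and the coefficients of the result belong to `Q`. -/
def MergeableBy (s : ι) (Q : (W → (ι → ℤ) → W) → Prop) (Φ : W → (Option ι → ℤ) → W)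
    (f : MvPolynomial (Option ι) ℂ) : Prop :=
  (∀ w, Sparse (mergeHom s) (act (Option ι) W f (Φ w))) ∧
    ∀ k, Q fun w => slice k (subst binomLeft none (some s) (act (Option ι) W f (Φ w)))

/-- The family is mergeable after multiplication by some nonzero `f(x_none, x_s)`. -/
def Mergeable (s : ι) (Q : (W → (ι → ℤ) → W) → Prop) (Φ : W → (Option ι → ℤ) → W) : Prop :=
  ∃ f : MvPolynomial (Fin 2) ℂ, f ≠ 0 ∧ MergeableBy s Q Φ (rename ![none, some s] f)

theorem IsActClosed.slice_act_one (hQ : IsActClosed Q) (h : ∀ k, Q fun w => slice k (Ψ w))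
    (p : MvPolynomial (Option ι) ℂ) (k : ℤ) :
    Q fun w => slice k (NonlocalVA.act (Option ι) W p (Ψ w)) := by
  have := hQ.slice_act (K := k) (g := 1) (Ψ := Ψ) (fun j _ => by simpa only [act_one] using h j) p k
    le_rfl
  simpa only [act_one] using this

variable [Finite ι]

theorem MergeableBy.mul (hQ : IsActClosed Q) {f : MvPolynomial (Option ι) ℂ}
    (h : MergeableBy s Q Φ f) (g : MvPolynomial (Option ι) ℂ) : MergeableBy s Q Φ (g * f) := by
  refine ⟨fun w => ?_, fun k => ?_⟩
  · rw [act_mul]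
    exact (h.1 w).act (mergeHom_single_nonneg s) g
  · have e : ∀ w, subst binomLeft none (some s) (act (Option ι) W (g * f) (Φ w)) =
        act (Option ι) W (substAlg none (some s) g)
          (subst binomLeft none (some s) (act (Option ι) W f (Φ w))) := fun w => by
      rw [act_mul, subst_act isPascal_binomLeft (by simp) (h.1 w).substitutable]
    simp only [e]
    exact hQ.slice_act_one h.2 _ k

theorem Mergeable.zero (hQ : IsActClosed Q) : Mergeable s Q fun _ : W => 0 := by
  refine ⟨1, one_ne_zero, fun w => ?_, fun k => ?_⟩
  · rw [map_zero]; exact sparse_zero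
  · simp only [map_zero, subst_zero]
    exact hQ.zero

theorem Mergeable.add (hQ : IsActClosed Q) (hΦ : Mergeable s Q Φ) (hΨ : Mergeable s Q Ψ) :
    Mergeable s Q fun w => Φ w + Ψ w := by
  obtain ⟨f, hf, h1⟩ := hΦ
  obtain ⟨g, hg, h2⟩ := hΨ
  have h1 := h1.mul hQ (rename ![none, some s] g)
  have h2 := h2.mul hQ (rename ![none, some s] f)
  rw [← map_mul] at h1 h2
  rw [mul_comm] at h1
  refine ⟨f * g, mul_ne_zero hf hg, fun w => ?_, fun k => ?_⟩
  · rw [map_add]; exact (h1.1 w).add (h2.1 w)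
  · have e : ∀ w, slice k (subst binomLeft none (some s)
        (act (Option ι) W (rename ![none, some s] (f * g)) (Φ w + Ψ w))) = _ + _ := fun w => by
      rw [map_add, subst_add (h1.1 w).substitutable (h2.1 w).substitutable, slice_add]
    simp only [e]
    exact hQ.add (h1.2 k) (h2.2 k)

theorem IsActClosed.sum (hQ : IsActClosed Q) {κ : Type*} (I : Finset κ) {Φ : κ → W → (ι → ℤ) → W}
    (h : ∀ i ∈ I, Q (Φ i)) : Q fun w => ∑ i ∈ I, Φ i w := by
  classical
  induction I using Finset.induction_on with
  | empty => simpa using hQ.zero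
  | insert i I hi ih =>
    simp only [Finset.sum_insert hi]
    exact hQ.add (h i (Finset.mem_insert_self _ _)) (ih fun j hj => h j (Finset.mem_insert_of_mem hj))

/-- The same `f` works, since `q` commutes with it. Coefficients of the substituted product are then
finite sums of series in `x_s, x_t` times earlier coefficients, by `slice_subst_conv_none` or
`subst_conv_some`. -/
theorem Mergeable.conv (hQ : IsActClosed Q) (hst : s ≠ t)
    (hQc : ∀ {q} {Φ : W → (ι → ℤ) → W}, IsLaurent q → Q Φ → Q fun w => NonlocalVA.conv q s t (Φ w))
    {q : ℤ × ℤ → ℂ} (hq : IsLaurent q) {u : Option ι} (hu : u = none ∨ u = some s)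
    (hs : ∀ w, Convolvable q u (some t) (Φ w)) (hΦ : Mergeable s Q Φ) :
    Mergeable s Q fun w => NonlocalVA.conv q u (some t) (Φ w) := by
  obtain ⟨f, hf, h1, h2⟩ := hΦ
  have hu' : ∀ d, mergeHom s (Pi.single u d) = Pi.single s d := by
    rcases hu with rfl | rfl
    exacts [mergeHom_single_none s, mergeHom_single_some s s]
  refine ⟨f, hf, fun w => ?_, fun k => ?_⟩
  · rw [← conv_act (hs w)]
    exact (h1 w).conv hu' (mergeHom_single_some s t) hst hq
  · simp only [← conv_act (hs _)]
    rcases hu with rfl | rfl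
    · rcases lt_or_ge k 0 with hk | hk
      · simp only [slice_subst_of_neg hk]
        exact hQ.zero
      · lift k to ℕ using hk
        simp only [slice_subst_conv_none hst (h1 _) hq]
        exact hQ.sum _ fun i _ => hQc (hq.taylorCoeff i) (h2 _)
    · simp only [subst_conv_some hst (h1 _) hq]
      simp only [slice_eq_restrict, restrict_conv some (Option.some_injective ι)]
      simp only [← slice_eq_restrict]
      exact hQc hq (h2 k)

/-- The pairs `(x_none, x_t)` and `(x_s, x_t)`. -/
def MergeRel (s t : ι) (u v : Option ι) : Prop := (u = none ∨ u = some s) ∧ v = some t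

theorem ConvSpan.mergeable (hQ : IsActClosed Q) (hst : s ≠ t)
    (hQc : ∀ {q} {Φ : W → (ι → ℤ) → W}, IsLaurent q → Q Φ → Q fun w => NonlocalVA.conv q s t (Φ w))
    (h : ConvSpan (MergeRel s t)
      {Φ | (∀ w, Sparse (AddMonoidHom.id _) (Φ w)) ∧ Mergeable s Q Φ} Φ) : Mergeable s Q Φ := by
  induction h with
  | base hb => exact hb.2
  | zero => exact .zero hQ
  | add _ _ h1 h2 => exact h1.add hQ h2
  | @conv u v q Φ hr hq hΦ ih =>
    obtain ⟨hu, rfl⟩ := hr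
    have hut : u ≠ some t := by rcases hu with rfl | rfl <;> simp [hst]
    refine ih.conv hQ hst hQc hq hu fun w => ?_
    refine Sparse.convolvable (h := AddMonoidHom.id _) (fun _ => rfl) (fun _ => rfl) hut ?_ hq
    refine hΦ.sparse ?_ (fun _ h => h.1) w
    rintro u v ⟨hu, rfl⟩
    refine ⟨u, some t, ?_, fun _ => rfl, fun _ => rfl⟩
    rcases hu with rfl | rfl <;> simp [hst]

variable (s) in
/-- The polynomials for which the substitution `x_none ↦ x_none + x_s` gives a leading coefficient
in `M`. -/
def leadMonoid (M : Submonoid (MvPolynomial ι ℂ)) : Submonoid (MvPolynomial (Option ι) ℂ) where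
  carrier := {F | HasLead M (substAlg none (some s) F)}
  one_mem' := by
    simp only [Set.mem_ofPred_eq, map_one]
    exact .one
  mul_mem' h1 h2 := by
    simp only [Set.mem_ofPred_eq, map_mul]
    exact h1.mul h2

/-- Identifying `x_none` with `x_s` returns `p` itself. Exchange polynomials thus stay in `M`, which
is decisive for products of forms. -/
theorem rename_mem_leadMonoid {M : Submonoid (MvPolynomial ι ℂ)} {p : MvPolynomial ι ℂ}
    (hp : p ∈ M) {f : ι → Option ι} (hf : ∀ i, (f i).getD s = i) : rename f p ∈ leadMonoid s M := by
  refine hasLead_of_setZero hp ?_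
  rw [setZero_substAlg_rename]
  simp only [hf]
  exact congrArg _ (MvPolynomial.rename_id_apply p)

/-- The coefficients of `Ψ = Θ(x_none + x_s, …)` belong to `Q` after multiplication by suitable
polynomials if `P Θ` is mergeable. -/
theorem Mergeable.exists_act_slice (hQ : IsActClosed Q) {M : Submonoid (MvPolynomial ι ℂ)}
    {Θ : W → (Option ι → ℤ) → W} {P : MvPolynomial (Option ι) ℂ} (hP : P ∈ leadMonoid s M)
    (h : Mergeable s Q fun w => act (Option ι) W P (Θ w)) {p : MvPolynomial (Fin 2) ℂ} (hp : p ≠ 0)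
    (hΨ : ∀ q w, act (Option ι) W (substAlg none (some s) (q * rename ![none, some s] p)) (Ψ w) =
      subst binomLeft none (some s) (act (Option ι) W (q * rename ![none, some s] p) (Θ w)))
    {N : ℤ} (hN : ∀ k < N, ∀ w, slice k (Ψ w) = 0) (k : ℤ) :
    ∃ P₀ ∈ M, ∃ g : Polynomial ℂ, g ≠ 0 ∧
      Q fun w => act ι W (Polynomial.aeval (X s) g * P₀) (slice k (Ψ w)) := by
  obtain ⟨f, hf, h⟩ := h
  have h := (h.mul hQ (rename ![none, some s] p)).2
  obtain ⟨l₁, P₀, h₁, hP₀, e₁⟩ := hP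
  obtain ⟨l₂, g, h₂, hg, e₂⟩ := exists_substAlg_eq s (mul_ne_zero hf hp)
  -- The exchange polynomial contributes `P₀ ∈ M` and the merging polynomial `f p` in `x_none, x_s`
  -- contributes `g(x_s)`; the third argument collects the remaining terms of the product of the two
  -- expansions.
  obtain ⟨n, hn⟩ := hQ.exists_pow (Ψ := Ψ) (N := N) (P := P₀ * Polynomial.aeval (X s) g)
    (h := rename some P₀ * h₂ + h₁ * rename some (Polynomial.aeval (X s) g) + X none * h₁ * h₂) hN
    (fun k => by
      have e : X none ^ (l₁ + l₂) * (rename some (P₀ * Polynomial.aeval (X s) g) + X none *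
          (rename some P₀ * h₂ + h₁ * rename some (Polynomial.aeval (X s) g) + X none * h₁ * h₂)) =
          substAlg none (some s) (P * rename ![none, some s] f * rename ![none, some s] p) := by
        rw [mul_assoc P, ← map_mul (rename ![none, some s]), map_mul (substAlg _ _), e₁, e₂,
          map_mul]
        ring
      have h1 : ∀ w, slice k (act (Option ι) W (rename some (P₀ * Polynomial.aeval (X s) g) +
          X none * (rename some P₀ * h₂ + h₁ * rename some (Polynomial.aeval (X s) g) +
            X none * h₁ * h₂)) (Ψ w)) = slice (k + (l₁ + l₂ : ℕ)) (subst binomLeft none (some s)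
          (act (Option ι) W (rename ![none, some s] p * rename ![none, some s] f)
            (act (Option ι) W P (Θ w)))) := by
        intro w
        rw [← act_mul (rename ![none, some s] p * _),
          show rename ![none, some s] p * rename ![none, some s] f * P =
            P * rename ![none, some s] f * rename ![none, some s] p by ring, ← hΨ, ← e, act_mul,
          slice_act_X_none_pow, add_sub_cancel_right]
      simp only [h1]
      exact h _) k
  refine ⟨P₀ ^ n, pow_mem hP₀ n, g ^ n, pow_ne_zero n hg, ?_⟩
  rwa [map_pow, ← mul_pow, mul_comm (Polynomial.aeval _ _)]

end Mergeable

/-! ### Division by polynomials in one variable -/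

section Inverse

open MvPolynomial (aeval X C rename)

theorem exists_inverse_coeff {g : Polynomial ℂ} (hg : g ≠ 0) : ∃ r : ℤ → ℂ,
    (∃ N, ∀ d < N, r d = 0) ∧ ∀ d : ℤ, (g.sum fun j c => c * r (d - j)) = if d = 0 then 1 else 0 := by
  set L : LaurentSeries ℂ := g.sum fun j c => HahnSeries.single (j : ℤ) c with hL
  have hL0 : L ≠ 0 := by
    intro h
    refine hg (Polynomial.ext fun n => ?_)
    have h1 := congrArg (fun x : LaurentSeries ℂ => x.coeff n) h
    simp only [hL, Polynomial.sum_def, HahnSeries.coeff_sum, HahnSeries.coeff_single,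
      HahnSeries.coeff_zero, Nat.cast_inj] at h1
    simpa [eq_comm] using h1
  refine ⟨(L⁻¹).coeff, ⟨_, fun d hd => HahnSeries.coeff_eq_zero_of_lt_order hd⟩, fun d => ?_⟩
  have h1 := congrArg (fun x : LaurentSeries ℂ => x.coeff d) (mul_inv_cancel₀ hL0)
  simp only [HahnSeries.coeff_one] at h1
  refine Eq.trans ?_ (h1.trans (by congr))
  conv_rhs => rw [hL, Polynomial.sum_def, Finset.sum_mul]
  rw [HahnSeries.coeff_sum, Polynomial.sum_def]
  refine Finset.sum_congr rfl fun j _ => ?_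
  have h2 := HahnSeries.coeff_single_mul_add (r := g.coeff j) (x := L⁻¹) (a := d - j) (b := (j : ℤ))
  rw [sub_add_cancel] at h2
  exact h2.symm

variable {σ : Type*} [DecidableEq σ] {W : Type*} [AddCommGroup W] [Module ℂ W]

/-- The coefficients of `1/g` in `ℂ((x_s))` are viewed as a series in `x_s, x_t` that is constant in
`x_t`. -/
theorem exists_conv_act_eq {g : Polynomial ℂ} (hg : g ≠ 0) : ∃ q, IsLaurent q ∧
    ∀ {s t : σ} {F : (σ → ℤ) → W}, Convolvable q s t F →
      conv q s t (act σ W (Polynomial.aeval (X s) g) F) = F := by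
  obtain ⟨r, ⟨N, hN⟩, hr⟩ := exists_inverse_coeff hg
  refine ⟨fun d => if d.2 = 0 then r d.1 else 0, ⟨min N 0, fun d hd => ?_⟩, ?_⟩
  · simp only
    split_ifs with h
    · exact hN _ (by omega)
    · rfl
  intro s t F hF
  rw [conv_act hF]
  funext m
  rw [act_aeval_X, Polynomial.sum_def]
  set q : ℤ × ℤ → ℂ := fun d => if d.2 = 0 then r d.1 else 0 with hq
  have e : ∀ j : ℕ, conv q s t F (m - Pi.single s (j : ℤ)) = ∑ᶠ d : ℤ × ℤ,
      q (d - ((j : ℤ), 0)) • F (m - Pi.single s d.1 - Pi.single t d.2) := by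
    intro j
    rw [conv, ← finsum_comp_equiv (Equiv.subRight ((j : ℤ), (0 : ℤ)))]
    refine finsum_congr fun d => ?_
    simp only [Equiv.subRight_apply, Prod.fst_sub, Prod.snd_sub, sub_zero, Pi.single_sub]
    congr 2
    abel
  have hfin : ∀ j : ℕ, (Function.support fun d : ℤ × ℤ => g.coeff j •
      q (d - ((j : ℤ), 0)) • F (m - Pi.single s d.1 - Pi.single t d.2)).Finite := by
    intro j
    refine ((hF (m - Pi.single s (j : ℤ))).preimage
      (sub_left_injective (b := ((j : ℤ), (0 : ℤ)))).injOn).subset fun d hd => ?_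
    have hd := right_ne_zero_of_smul hd
    refine ⟨left_ne_zero_of_smul hd, ?_⟩
    have h := right_ne_zero_of_smul hd
    simp only [Prod.fst_sub, Prod.snd_sub, sub_zero, Pi.single_sub]
    convert h using 2
    abel
  simp only [e, smul_finsum]
  rw [← finsum_sum_comm _ _ fun j _ => hfin j, finsum_eq_single _ 0]
  · simp only [← smul_assoc, ← Finset.sum_smul, hq, Prod.snd_sub, Prod.fst_sub, Prod.fst_zero,
      Prod.snd_zero, sub_zero, if_true, Pi.single_zero, smul_eq_mul]
    have := hr 0
    rw [Polynomial.sum_def, if_pos rfl] at this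
    rw [this, one_smul]
  · intro d hd
    simp only [← smul_assoc, ← Finset.sum_smul, hq, Prod.snd_sub, Prod.fst_sub, sub_zero,
      smul_eq_mul]
    by_cases h2 : d.2 = 0
    · have h1 : d.1 ≠ 0 := fun h1 => hd (Prod.ext h1 h2)
      have := hr d.1
      rw [Polynomial.sum_def, if_neg h1] at this
      simp only [h2, if_true, this, zero_smul]
    · simp [h2]

end Inverse

/-! ### Exchange relations for the generated subspace -/

section ExchangeOpe

open MvPolynomial (aeval X C rename)

variable {W : Type*} [AddCommGroup W] [Module ℂ W] {T U : Set (VertexOperator ℂ W)}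

theorem isActClosed_swapSpan : IsActClosed (SwapSpan T U) where
  zero := ConvSpan.zero
  add := ConvSpan.add
  act p h := h.act p

theorem SwapSpan.conv {s t : Fin 2} (hst : s ≠ t) {q : ℤ × ℤ → ℂ} (hq : IsLaurent q)
    {Φ : W → (Fin 2 → ℤ) → W} (h : SwapSpan T U Φ) :
    SwapSpan T U fun w => NonlocalVA.conv q s t (Φ w) := by
  by_cases hs : s = 0
  · exact ConvSpan.conv ⟨hs, by omega⟩ hq h
  · exact ConvSpan.conv_symm (s := t) (t := s) ⟨by omega, by omega⟩ hq h

/-- A polynomial in one variable is divided out inside `ℂ((x₁, x₂))`. So the factor `g(x_s)`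
produced by merging need not belong to `M`. -/
theorem SwapSpan.of_act_aeval {s : Fin 2} {g : Polynomial ℂ} (hg : g ≠ 0)
    {Φ : W → (Fin 2 → ℤ) → W} (hΦ : ∀ w, Sparse (AddMonoidHom.id _) (Φ w))
    (h : SwapSpan T U fun w => NonlocalVA.act (Fin 2) W (Polynomial.aeval (X s) g) (Φ w)) :
    SwapSpan T U Φ := by
  obtain ⟨t, hst⟩ := exists_ne s
  obtain ⟨q, hq, e⟩ := exists_conv_act_eq (σ := Fin 2) (W := W) hg
  have e' : Φ = fun w => NonlocalVA.conv q s t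
      (NonlocalVA.act (Fin 2) W (Polynomial.aeval (X s) g) (Φ w)) := by
    funext w
    exact (e ((hΦ w).convolvable (s' := s) (t' := t) (fun _ => rfl) (fun _ => rfl) hst.symm hq)).symm
  rw [e']
  exact h.conv hst.symm hq

variable {σ : Type*} [DecidableEq σ] {R : σ → σ → Prop} {𝓑 : Set (W → (σ → ℤ) → W)}
  {M : Submonoid (MvPolynomial (Fin 2) ℂ)} {M' : Submonoid (MvPolynomial σ ℂ)}

/-- Exchange of two adjacent letters in a word. -/
theorem Exchange.convSpan_word {a c : VertexOperator ℂ W} (h : Exchange M T U a c)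
    (hR : ∀ u, ∃ v, R u v ∨ R v u) (hR' : ∃ s t, R s t) {i j : σ} (hij : i ≠ j) (hRij : R i j ∨ R j i)
    (hM : ∀ p ∈ M, rename ![i, j] p ∈ M') {A B : List (σ × VertexOperator ℂ W)}
    (hA : ∀ x ∈ A, x.1 ≠ i ∧ x.1 ≠ j) (hB : ∀ x ∈ B, x.1 ≠ i ∧ x.1 ≠ j)
    (hbase : ∀ u ∈ T, ∀ v ∈ U, ∃ p ∈ M', ConvSpan R 𝓑 fun w =>
      act σ W p (wordSeries (A ++ (j, u) :: (i, v) :: B) w)) :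
    ∃ p ∈ M', ConvSpan R 𝓑 fun w => act σ W p (wordSeries (A ++ (i, a) :: (j, c) :: B) w) := by
  have he : Function.Injective ![i, j] := by
    intro s t hst
    fin_cases s <;> fin_cases t <;> simp_all
  have ind : ∀ {L : List (σ × VertexOperator ℂ W)}, (∀ x ∈ L, x.1 ≠ i ∧ x.1 ≠ j) →
      IndepOf ![i, j] (wordOp L) := fun hL => indepOf_wordOp fun x hx t => by
    fin_cases t
    exacts [(hL x hx).1.symm, (hL x hx).2.symm]
  have iA := ind hA
  have iB := ind hB
  have key : ∀ {Φ : W → (Fin 2 → ℤ) → W}, SwapSpan T U Φ → ∃ p ∈ M', ConvSpan R 𝓑 fun w =>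
      act σ W p (spread ![i, j] (wordOp A) (wordOp B) Φ w) := by
    intro Φ hΦ
    unfold SwapSpan at hΦ
    induction hΦ with
    | base hb =>
      obtain ⟨u, hu, v, hv, rfl⟩ := hb
      simp only [spread_opPair_wordOp]
      exact hbase u hu v hv
    | zero =>
      refine ⟨1, one_mem _, ?_⟩
      simp only [act_one]
      have : (fun w => spread ![i, j] (wordOp A) (wordOp B) (fun _ => 0) w) =
          fun _ : W => (0 : (σ → ℤ) → W) := by
        funext w m; simp [spread]
      rw [this]
      exact .zero
    | @add Φ Ψ _ _ h1 h2 =>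
      obtain ⟨p, hp, h1⟩ := h1
      obtain ⟨q, hq, h2⟩ := h2
      refine ⟨p * q, mul_mem hp hq, ?_⟩
      have e : ∀ w, act σ W (p * q) (spread ![i, j] (wordOp A) (wordOp B) (fun w => Φ w + Ψ w) w) =
          act σ W q (act σ W p (spread ![i, j] (wordOp A) (wordOp B) Φ w)) +
          act σ W p (act σ W q (spread ![i, j] (wordOp A) (wordOp B) Ψ w)) := by
        intro w
        rw [← act_mul, ← act_mul, mul_comm q, ← map_add]
        congr 1
        funext m; simp [spread]
      simp only [e]
      exact (h1.act hR hR' q).add (h2.act hR hR' p)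
    | @conv s t q Φ hr hq hΦ ih =>
      obtain ⟨rfl, rfl⟩ := hr
      obtain ⟨p, hp, h⟩ := ih
      have hc := SwapSpan.convolvable hΦ hq
      refine ⟨p, hp, ?_⟩
      have e : ∀ w, act σ W p (spread ![i, j] (wordOp A) (wordOp B) (fun w => conv q 0 1 (Φ w)) w) =
          conv q i j (act σ W p (spread ![i, j] (wordOp A) (wordOp B) Φ w)) := fun w => by
        have := conv_spread he iA iB hc w
        have h2 := conv_act (convolvable_spread he iA iB hc w) p
        simp only [Matrix.cons_val_zero, Matrix.cons_val_one] at this h2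
        rw [← this, h2]
      simp only [e]
      exact hRij.elim (fun hR => h.conv hR hq) (fun hR => h.conv_symm hR hq)
  obtain ⟨p, hp, h⟩ := h
  obtain ⟨p', hp', h⟩ := key h
  refine ⟨p' * rename ![i, j] p, mul_mem hp' (hM p hp), ?_⟩
  have e : ∀ w, act σ W (p' * rename ![i, j] p) (wordSeries (A ++ (i, a) :: (j, c) :: B) w) =
      act σ W p' (spread ![i, j] (wordOp A) (wordOp B) (fun w => act (Fin 2) W p (pair a c w)) w) := by
    intro w
    rw [act_mul, ← spread_pair_wordOp, act_spread he iA iB]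
  simp only [e]
  exact h

variable {s t : Fin 2} {A B : List (Fin 2 × VertexOperator ℂ W)} {a b : VertexOperator ℂ W}

theorem nodup_none_some (hd : (A.map Prod.fst ++ s :: B.map Prod.fst).Nodup) :
    ((A.map (Prod.map some id) ++ (none, a) :: (some s, b) ::
      B.map (Prod.map some id)).map Prod.fst).Nodup := by
  have e : (A.map (Prod.map some id) ++ (none, a) :: (some s, b) ::
      B.map (Prod.map some id)).map Prod.fst =
      (A.map Prod.fst).map some ++ none :: ((s :: B.map Prod.fst).map some) := by
    simp [Function.comp_def]
  rw [e]
  refine (List.perm_middle.nodup_iff).2 (List.nodup_cons.2 ⟨by simp, ?_⟩)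
  rw [← List.map_append]
  exact List.Nodup.map (Option.some_injective _) hd

theorem mem_none_some (hc : ∀ i, i ∈ A.map Prod.fst ++ s :: B.map Prod.fst) (o : Option (Fin 2)) :
    o ∈ (A.map (Prod.map some id) ++ (none, a) :: (some s, b) ::
      B.map (Prod.map some id)).map Prod.fst := by
  cases o with
  | none => simp
  | some j => simpa [Function.comp_def] using hc j

/-- The families that generate the mergeable ones. -/
def MergeBase (s : Fin 2) (T U : Set (VertexOperator ℂ W)) :
    Set (W → (Option (Fin 2) → ℤ) → W) :=
  {Φ | (∀ w, Sparse (AddMonoidHom.id _) (Φ w)) ∧ Mergeable s (SwapSpan T U) Φ}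

theorem ne_of_nodup (hd : (A.map Prod.fst ++ s :: B.map Prod.fst).Nodup) :
    (∀ x ∈ A, x.1 ≠ s) ∧ ∀ x ∈ B, x.1 ≠ s := by
  rw [List.nodup_append, List.nodup_cons] at hd
  exact ⟨fun x hx => hd.2.2 _ (List.mem_map_of_mem hx) _ (by simp),
    fun x hx => ne_of_mem_of_not_mem (List.mem_map_of_mem hx) hd.2.1.1⟩

/-- The polynomial clearing `a, b` serves as `f`. By the definition of `ope`, the substituted
coefficients are combinations of words in which `a, b` is replaced by some `ope a b k`. -/
theorem wordSeries_mem_mergeBase (hd : (A.map Prod.fst ++ s :: B.map Prod.fst).Nodup)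
    (hc : ∀ i, i ∈ A.map Prod.fst ++ s :: B.map Prod.fst) (hab : Compat a b)
    (h : ∀ k, SwapSpan T U (wordSeries (A ++ (s, ope a b k) :: B))) :
    wordSeries (A.map (Prod.map some id) ++ (none, a) :: (some s, b) :: B.map (Prod.map some id)) ∈
      MergeBase s T U := by
  obtain ⟨hA, hB⟩ := ne_of_nodup hd
  refine ⟨sparse_wordSeries (nodup_none_some hd) (mem_none_some hc), ?_⟩
  obtain ⟨p, hp, hab⟩ := hab
  have iA := indepOf_wordOp_map hA
  have iB := indepOf_wordOp_map hB
  have he := injective_none_some s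
  refine ⟨p, hp, fun w => ?_, fun k => ?_⟩
  · rw [← spread_pair_wordOp, act_spread he iA iB]
    refine sparse_spread hd hc (clears_iff.1 hab) ?_ w
    have : pair a b 0 = 0 := by funext m; simp [pair]
    rw [this, map_zero]
  · have e : ∀ w, slice k (subst binomLeft none (some s) (act _ W (rename ![none, some s] p)
        (wordSeries (A.map (Prod.map some id) ++ (none, a) :: (some s, b) ::
          B.map (Prod.map some id)) w))) = slice k (act _ W (substAlg none (some s)
        (rename ![none, some s] p)) (spread ![none, some s] (wordOp (A.map (Prod.map some id)))
          (wordOp (B.map (Prod.map some id))) (opeFormal a b) w)) := by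
      intro w
      have := (spread_ope he iA iB hp hab 1 w).2
      rw [one_mul, spread_pair_wordOp] at this
      exact congrArg _ this.symm
    simp only [e]
    refine isActClosed_swapSpan.slice_act_one (fun k => ?_) _ k
    simp only [slice_spread_opeFormal]
    exact h k

/-- Exchange relations for the longer word descend to the word with the product: substitute, extract
the coefficient of `x_none^k`, and divide by the polynomial in `x_s` alone. -/
theorem exists_swapSpan_ope (hst : s ≠ t) (hd : (A.map Prod.fst ++ s :: B.map Prod.fst).Nodup)
    (hc : ∀ i, i ∈ A.map Prod.fst ++ s :: B.map Prod.fst) (hab : Compat a b)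
    (h : ∃ P ∈ leadMonoid s M, ConvSpan (MergeRel s t) (MergeBase s T U) fun w =>
      act (Option (Fin 2)) W P (wordSeries (A.map (Prod.map some id) ++ (none, a) :: (some s, b) ::
        B.map (Prod.map some id)) w)) (k : ℤ) :
    ∃ p ∈ M, SwapSpan T U fun w =>
      act (Fin 2) W p (wordSeries (A ++ (s, ope a b k) :: B) w) := by
  obtain ⟨hA, hB⟩ := ne_of_nodup hd
  obtain ⟨p, hp, hcl⟩ := hab
  obtain ⟨P, hP, h⟩ := h
  obtain ⟨N, hN⟩ := exists_ope_eq_zero a b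
  obtain ⟨p₀, hp₀, g, hg, h⟩ := (h.mergeable isActClosed_swapSpan hst fun hq hΦ =>
    hΦ.conv hst hq).exists_act_slice isActClosed_swapSpan hP hp
    (Ψ := spread ![none, some s] (wordOp (A.map (Prod.map some id)))
      (wordOp (B.map (Prod.map some id))) (opeFormal a b)) (N := N)
    (fun q w => by
      rw [← spread_pair_wordOp]
      exact (spread_ope (injective_none_some s) (indepOf_wordOp_map hA)
        (indepOf_wordOp_map hB) hp hcl q w).2)
    (fun k hk w => by
      rw [slice_spread_opeFormal, hN k hk]
      funext d
      rw [wordSeries, wordOp_append_apply, wordOp_cons]; simp) k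
  refine ⟨p₀, hp₀, SwapSpan.of_act_aeval (s := s) hg (fun w => ?_) ?_⟩
  · exact (sparse_wordSeries (by simpa using hd) (by simpa using hc) w).act
      (fun u i => by simp [Pi.single_apply]; split_ifs <;> simp) p₀
  · simpa only [act_mul, slice_spread_opeFormal] using h

end ExchangeOpe

/-! ### Pseudo-locality of the generated subspace -/

section GeneratedExchange

open MvPolynomial (aeval X C rename)

variable {W : Type*} [AddCommGroup W] [Module ℂ W] {S T U : Set (VertexOperator ℂ W)}
  {M : Submonoid (MvPolynomial (Fin 2) ℂ)} {a b c : VertexOperator ℂ W}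

theorem pair_eq_wordSeries (a c : VertexOperator ℂ W) (w : W) :
    pair a c w = wordSeries [(0, a), (1, c)] w := by
  funext m
  rw [wordSeries, wordOp_cons, wordOp_cons]; rfl

theorem opPair_eq_wordSeries (u v : VertexOperator ℂ W) :
    opPair u v = wordSeries [(1, u), (0, v)] := by
  funext w m
  rw [wordSeries, wordOp_cons, wordOp_cons, opPair, toFormal_comp₂]; rfl

theorem mergeRel_total {s t : Fin 2} (hst : s ≠ t) (u : Option (Fin 2)) :
    ∃ v, MergeRel s t u v ∨ MergeRel s t v u := by
  cases u with
  | none => exact ⟨some t, Or.inl ⟨Or.inl rfl, rfl⟩⟩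
  | some j =>
    by_cases hj : j = s
    · exact ⟨some t, Or.inl ⟨Or.inr (by rw [hj]), rfl⟩⟩
    · exact ⟨none, Or.inr ⟨Or.inl rfl, congrArg some (by omega)⟩⟩

theorem exchange_of_pair_eq_zero (h : ∀ w, pair a c w = 0) : Exchange M T U a c := by
  refine ⟨1, one_mem _, ?_⟩
  simp only [h, map_zero]
  exact ConvSpan.zero

theorem Exchange.of_pair_eq_add {a₁ a₂ c₁ c₂ : VertexOperator ℂ W} (h₁ : Exchange M T U a₁ c₁)
    (h₂ : Exchange M T U a₂ c₂) (h : ∀ w, pair a c w = pair a₁ c₁ w + pair a₂ c₂ w) :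
    Exchange M T U a c := by
  obtain ⟨p, hp, h₁⟩ := h₁
  obtain ⟨q, hq, h₂⟩ := h₂
  refine ⟨p * q, mul_mem hp hq, ?_⟩
  have e : ∀ w, act (Fin 2) W (p * q) (pair a c w) = act (Fin 2) W q (act (Fin 2) W p (pair a₁ c₁ w))
      + act (Fin 2) W p (act (Fin 2) W q (pair a₂ c₂ w)) := fun w => by
    rw [h, map_add, ← act_mul, ← act_mul, mul_comm q]
  simp only [e]
  exact ConvSpan.add (h₁.act q) (h₂.act p)

theorem Exchange.of_pair_eq_smul {a₁ c₁ : VertexOperator ℂ W} (h₁ : Exchange M T U a₁ c₁) {x : ℂ}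
    (h : ∀ w, pair a c w = x • pair a₁ c₁ w) : Exchange M T U a c := by
  obtain ⟨p, hp, h₁⟩ := h₁
  refine ⟨p, hp, ?_⟩
  have e : ∀ w, act (Fin 2) W p (pair a c w) = act (Fin 2) W (C x) (act (Fin 2) W p (pair a₁ c₁ w)) :=
    fun w => by rw [h, map_smul, act_C]
  simp only [e]
  exact h₁.act _

variable (hG : ∀ a b, Generated S a → Generated S b → Compat a b)
include hG

/-- Induction on the right operator, with the left one in `S`. The operator that has moved to the
right is again in `S`, so the induction hypotheses, stated for all of `S`, can be applied twice for
a product. -/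
theorem exchange_mem_generated (hS : ∀ a ∈ S, ∀ b ∈ S, Exchange M S S a b)
    (hc : Generated S c) : ∀ a ∈ S, Exchange M {a | Generated S a} S a c := by
  induction hc with
  | mem h =>
    intro a ha
    obtain ⟨p, hp, h⟩ := hS a ha _ h
    exact ⟨p, hp, h.mono (fun _ => .mem) subset_rfl⟩
  | zero => exact fun a _ => exchange_of_pair_eq_zero fun w => by funext m; simp [pair]
  | add _ _ h1 h2 =>
    exact fun a ha => (h1 a ha).of_pair_eq_add (h2 a ha) fun w => by funext m; simp [pair]
  | smul x _ h1 => exact fun a ha => (h1 a ha).of_pair_eq_smul (x := x) fun w => by funext m; simp [pair]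
  | @ope b c hb hc' hbc k h1 h2 =>
    intro a ha
    have key := exists_swapSpan_ope (M := M) (T := {a | Generated S a}) (U := S) (s := 1) (t := 0)
      (A := [(0, a)]) (B := []) (by decide) (by simp) (by simp [Fin.forall_fin_two]) hbc ?_ k
    · simp only [List.cons_append, List.nil_append, ← pair_eq_wordSeries] at key
      exact key
    -- The letter `a` passes `b` and becomes `v`, which then passes `c`; the two letters left in
    -- front are merged by `ope`.
    refine (h1 a ha).convSpan_word (i := some 0) (j := none) (A := []) (B := [(some 1, c)])
      (mergeRel_total (by decide)) ⟨none, some 0, Or.inl rfl, rfl⟩ (by simp)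
      (Or.inr ⟨Or.inl rfl, rfl⟩)
      (fun p hp => rename_mem_leadMonoid hp (by simp [Fin.forall_fin_two])) (by simp) (by simp)
      fun u hu v hv => ?_
    refine (h2 v hv).convSpan_word (i := some 0) (j := some 1) (A := [(none, u)]) (B := [])
      (mergeRel_total (by decide)) ⟨none, some 0, Or.inl rfl, rfl⟩ (by simp)
      (Or.inr ⟨Or.inr rfl, rfl⟩)
      (fun p hp => rename_mem_leadMonoid hp (by simp [Fin.forall_fin_two])) (by simp) (by simp)
      fun u' hu' v' hv' => ⟨1, one_mem _, ?_⟩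
    simp only [act_one]
    refine .base (wordSeries_mem_mergeBase (s := 1) (A := []) (B := [(0, v')]) (by simp)
      (by simp [Fin.forall_fin_two]) (hG u u' hu hu') fun j => ?_)
    rw [List.nil_append, ← opPair_eq_wordSeries]
    exact .base ⟨_, .ope hu hu' (hG u u' hu hu') j, v', hv', rfl⟩

/-- Induction on the left operator, with the right one any generated element; the case of a left
operator in `S` is the preceding lemma. For a product, `c` passes `b` and the operator so obtained
passes `a`. -/
theorem exchange_generated (hS : ∀ a ∈ S, ∀ b ∈ S, Exchange M S S a b)
    (ha : Generated S a) : ∀ c, Generated S c →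
      Exchange M {a | Generated S a} {a | Generated S a} a c := by
  induction ha with
  | mem h =>
    intro c hc
    obtain ⟨p, hp, h⟩ := exchange_mem_generated hG hS hc _ h
    exact ⟨p, hp, h.mono subset_rfl fun _ => .mem⟩
  | zero => exact fun c _ => exchange_of_pair_eq_zero fun w => by funext m; simp [pair]
  | add _ _ h1 h2 =>
    exact fun c hc => (h1 c hc).of_pair_eq_add (h2 c hc) fun w => by funext m; simp [pair]
  | smul x _ h1 => exact fun c hc => (h1 c hc).of_pair_eq_smul (x := x) fun w => by funext m; simp [pair]
  | @ope a b ha hb hab k h1 h2 =>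
    intro c hc
    have key := exists_swapSpan_ope (M := M) (T := {a | Generated S a}) (U := {a | Generated S a})
      (s := 0) (t := 1) (A := []) (B := [(1, c)]) (by decide) (by simp)
      (by simp [Fin.forall_fin_two]) hab ?_ k
    · simp only [List.nil_append, ← pair_eq_wordSeries] at key
      exact key
    refine (h2 c hc).convSpan_word (i := some 0) (j := some 1) (A := [(none, a)]) (B := [])
      (mergeRel_total (by decide)) ⟨none, some 1, Or.inl rfl, rfl⟩ (by simp)
      (Or.inl ⟨Or.inr rfl, rfl⟩)
      (fun p hp => rename_mem_leadMonoid hp (by simp [Fin.forall_fin_two])) (by simp) (by simp)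
      fun u hu v hv => ?_
    refine (h1 u hu).convSpan_word (i := none) (j := some 1) (A := []) (B := [(some 0, v)])
      (mergeRel_total (by decide)) ⟨none, some 1, Or.inl rfl, rfl⟩ (by simp)
      (Or.inl ⟨Or.inl rfl, rfl⟩)
      (fun p hp => rename_mem_leadMonoid hp (by simp [Fin.forall_fin_two])) (by simp) (by simp)
      fun u' hu' v' hv' => ⟨1, one_mem _, ?_⟩
    simp only [act_one]
    refine .base (wordSeries_mem_mergeBase (s := 0) (A := [(1, u')]) (B := []) (by simp)
      (by simp [Fin.forall_fin_two]) (hG v' v hv' hv) fun j => ?_)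
    rw [List.cons_append, List.nil_append, ← opPair_eq_wordSeries]
    exact .base ⟨u', hu', _, .ope hv' hv (hG v' v hv' hv) j, rfl⟩

end GeneratedExchange

end NonlocalVA

end

theorem theorem4 {W : Type*} [AddCommGroup W] [Module ℂ W] (S : Set (VertexOperator ℂ W))
    (hS : IsPseudoLocal S) :
    -- `⟨S⟩` is the smallest closed quasi compatible subspace that contains `S` and `1_W`
    IsLeast (closedQuasiCompatible S) (generated S) ∧
    ∃ (Y : generated S →ₗ[ℂ] VertexOperator ℂ (generated S)) (one : generated S),
      -- the vacuum vector is `1_W`, and the vertex operator map is `Y_𝓔`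
      (one : VertexOperator ℂ W) = idOp W ∧
      (∀ (a b : generated S) (p : MvPolynomial (Fin 2) ℂ) (_ : p ≠ 0)
        (h : Clears p (a : VertexOperator ℂ W) (b : VertexOperator ℂ W)) (n : ℤ),
        ((VertexOperator.ncoeff (Y a) n b : generated S) : VertexOperator ℂ W) = nthProd p h n) ∧
      IsNonlocalVertexAlgebra Y one ∧
      -- `W` with `Y_W(α(x), x₀) = α(x₀)` is a faithful pseudo-local quasi module
      IsPseudoLocalQuasiModule Y one (generated S).subtype ∧
      Function.Injective (generated S).subtype ∧
      ∀ Γ : Subgroup ℂˣ, IsPseudoGammaLocal Γ S →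
        IsPseudoGammaLocalQuasiModule Γ Y one (generated S).subtype := by
  have hleast := isLeast_generated hS
  obtain ⟨hU, hc, -, h1⟩ := hleast.1
  have hrange : Set.range (generated S).subtype = {a | Generated (insert (idOp W) S) a} :=
    Subtype.range_coe.trans (by rw [generated_eq hS]; rfl)
  have hcompat : ∀ a b, Generated (insert (idOp W) S) a → Generated (insert (idOp W) S) b →
      Compat a b := by
    rw [generated_eq hS] at hU
    exact fun a b ha hb => hU.compat ha hb
  have hquasi := isQuasiModule_vertexMap hU hc h1
  refine ⟨hleast, vertexMap (generated S) hU hc, ⟨idOp W, h1⟩, rfl, fun a b p hp h n => ?_,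
    hquasi.algebra, ⟨hquasi, ?_⟩, Subtype.val_injective, fun Γ hΓ => ⟨hquasi, ?_⟩⟩
  · rw [nthProd_eq_ope hp, ← coeff_vertexMap hU hc]
    rfl
  · rw [hrange]
    -- The same exchange theorem is used twice: here for the monoid of nonzero polynomials, below
    -- for the products of forms attached to `Γ`.
    exact isPseudoLocal_of_exchange fun a ha b hb => exchange_generated hcompat
      (exchange_insert_idOp fun _ ha _ hb => hS.exchange ha hb) ha b hb
  · rw [hrange]
    exact isPseudoGammaLocal_of_exchange fun a ha b hb => exchange_generated hcompat
      (exchange_insert_idOp fun _ ha _ hb => hΓ.exchange ha hb) ha b hb
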